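/- Let $\pi : V \to B$ be a smooth principal $\mathbb{S}^1$-bundle, where $V$ and $B$ are smooth manifolds of dimensions $n+1$ and $n$ and $B$ is path connected, and let $X$ be the fundamental vector field $X(x)=\frac{d}{dt}\big|_{t=0} e^{it}\cdot x$ on $V$. Let $\mathbb{S}^1$ act on $T^*V$ by $u\cdot(x,\varphi) = (u\cdot x,\ \varphi\circ (T_x\rho(u))^{-1})$, where $\rho(u)(x)=u\cdot x$, and put $H(x,\varphi)=\langle\varphi, X(x)\rangle$. Equip $T^*V\times\mathbb{C}$ with the symplectic form $\omega_{\mathrm{can}}\oplus\omega_{\mathrm{std}}$, where $\omega_{\mathrm{can}}=d\lambda$ is the differential of the Liouville form and $\omega_{\mathrm{std}}=dx\wedge dy$, with the free circle action $u\cdot(x,\varphi,z)=(u\cdot x,u\cdot\varphi,\bar u z)$, and put $\widetilde H(x,\varphi,z)=H(x,\varphi)-\frac12|z|^2$. For $\xi\in\mathbb{R}$ let $W_\xi=\widetilde H^{-1}(\xi)/\mathbb{S}^1$ (the symplectic cut of $T^*V$ at level $\xi$) and let $Q_\xi=H^{-1}(\xi)/\mathbb{S}^1$, regarded as a subset of $W_\xi$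 through $[x,\varphi]\mapsto[x,\varphi,0]$. Then $W_\xi$ carries the structure of a symplectic manifold of dimension $2n+2$ given by symplectic reduction: the level $\widetilde H^{-1}(\xi)$ is an embedded submanifold of $T^*V\times\mathbb{C}$, the projection $\widetilde H^{-1}(\xi)\to W_\xi$ is a smooth submersion, and the symplectic form on $W_\xi$ pulls back to the restriction of $\omega_{\mathrm{can}}\oplus\omega_{\mathrm{std}}$ to the level. For this structure: 1. the formula $u\cdot[x,\varphi,z]=[x,\varphi,uz]$ defines a smooth action of $\mathbb{S}^1$ on $W_\xi$ by symplectic diffeomorphisms, which is Hamiltonian with the smooth invariant Hamiltonian $h([x,\varphi,z])=\frac12|z|^2$ (that is, $\iota_Y\omega=-dh$, where $\omega$ is the symplectic form of $W_\xi$ and $Y$ the fundamental vector field of the action); 2. the fixed points of this action are exactly the points of $Q_\xi$; 3. at each fixed point $w$, the sum of the weights of the linearised action is $1$. Here integers $m_0,\dots,m_n$ are called weights at $w$ if, for some complex structure $J$ on $T_wW_\xi$ that is compatible with the symplectic form and invariant under the linearised action, $T_wW_\xi$ has a $J$-complex basis in which, for all $u\in\mathbb{S}^1$, the linearised action of $u$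 is the diagonal matrix with entries $u^{m_0},\dots,u^{m_n}$; such integers exist, and $m_0+\dots+m_n=1$ for every choice of them. -/

import Mathlib

open scoped Manifold ContDiff Topology

/-! ## Differential forms on smooth manifolds without boundary -/

/-- (Not necessarily continuous) differential `k`-forms on a manifold `M` modelled on `I`. -/
abbrev DForm {E : Type*} [NormedAddCommGroup E] [NormedSpace ℝ E] {H : Type*} [TopologicalSpace H]
    (I : ModelWithCorners ℝ E H) (M : Type*) [TopologicalSpace M] [ChartedSpace H M] (k : ℕ) :
    Type _ :=
  ∀ x : M, (TangentSpace I x) [⋀^Fin k]→L[ℝ] ℝ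

section Forms

variable {E : Type*} [NormedAddCommGroup E] [NormedSpace ℝ E]
  {H : Type*} [TopologicalSpace H] (I : ModelWithCorners ℝ E H)
  {M : Type*} [TopologicalSpace M] [ChartedSpace H M]
  {E' : Type*} [NormedAddCommGroup E'] [NormedSpace ℝ E']
  {H' : Type*} [TopologicalSpace H'] (I' : ModelWithCorners ℝ E' H')
  {M' : Type*} [TopologicalSpace M'] [ChartedSpace H' M'] {k : ℕ}

/-- The pullback `f^* σ` of a differential form. -/
noncomputable def DForm.pullback (f : M → M') (σ : DForm I' M' k) : DForm I M k :=
  fun x => (σ (f x)).compContinuousLinearMap (mfderiv I I' f x)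

/-- The expression of `σ` in the preferred chart at `c`: its pullback by the inverse chart, a form
on the model space `E`, meaningful on the (open) target of the chart. -/
noncomputable def DForm.inChart (σ : DForm I M k) (c : M) : E → E [⋀^Fin k]→L[ℝ] ℝ :=
  DForm.pullback 𝓘(ℝ, E) I (extChartAt I c).symm σ

/-- A form is smooth if its expressions in all the preferred charts are smooth. -/
def DForm.IsSmooth (σ : DForm I M k) : Prop :=
  ∀ c : M, ContDiffOn ℝ ∞ (DForm.inChart I σ c) (extChartAt I c).target

/-- The exterior derivative, computed at each point `x` in the preferred chart at `x`. -/
noncomputable def DForm.d (σ : DForm I M k) : DForm I M (k + 1) :=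
  fun x => (extDeriv (DForm.inChart I σ x) (extChartAt I x x)).compContinuousLinearMap
    (mfderiv I 𝓘(ℝ, E) (extChartAt I x) x)

/-- A symplectic form: a smooth closed nondegenerate 2-form. -/
structure IsSymplecticForm (σ : DForm I M 2) : Prop where
  smooth : DForm.IsSmooth I σ
  closed : DForm.d I σ = 0
  nondegenerate : ∀ (x : M) (v : TangentSpace I x),
    (∀ w : TangentSpace I x, σ x ![v, w] = 0) → v = 0

end Forms

/-! ## Circle actions -/

section CircleActions

variable {E : Type*} [NormedAddCommGroup E] [NormedSpace ℝ E]
  {H : Type*} [TopologicalSpace H] (I : ModelWithCorners ℝ E H)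
  {M : Type*} [TopologicalSpace M] [ChartedSpace H M] [MulAction Circle M]

/-- The fundamental vector field `x ↦ d/dt|_{t=0} exp(it) • x` of a circle action. (The derivative
lies in the tangent space at `exp(0) • x = x`.) -/
noncomputable def circleVectorField (x : M) : TangentSpace I x :=
  (mfderiv 𝓘(ℝ, ℝ) I (fun t : ℝ => Circle.exp t • x) 0 (1 : ℝ) : E)

/-- The circle action on the manifold `M` is a smooth action by symplectic diffeomorphisms of
`(M, σ)`, and it is Hamiltonian with Hamiltonian function `h`: the function `h` is smooth and
invariant, and `ι_X σ = - dh` for the fundamental vector field `X`. With this sign, multiplication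
by unit complex numbers on `(ℂ, dx ∧ dy)` has Hamiltonian `|z|² / 2`. -/
structure IsHamiltonianCircleAction (σ : DForm I M 2) (h : M → ℝ) : Prop where
  smooth_action : ContMDiff ((𝓡 1).prod I) I ∞ (fun p : Circle × M => p.1 • p.2)
  symplectic : ∀ u : Circle, DForm.pullback I I (fun x : M => u • x) σ = σ
  smooth_hamiltonian : ContMDiff I 𝓘(ℝ, ℝ) ∞ h
  invariant : ∀ (u : Circle) (x : M), h (u • x) = h x
  hamiltonian : ∀ (x : M) (v : TangentSpace I x),
    σ x ![circleVectorField I x, v] = - (mfderiv I 𝓘(ℝ, ℝ) h x v : ℝ)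

/-- The linearised action `T_x ρ(u)` at a fixed point `x` (an endomorphism of `T_x M`,
as `u • x = x`). -/
noncomputable def linearisedAction (x : M) (u : Circle) : TangentSpace I x →L[ℝ] TangentSpace I x :=
  (mfderiv I I (fun y : M => u • y) x : E →L[ℝ] E)

/-- `m 0, …, m (k-1)` are the weights of the linearised circle action at the fixed point `x` of the
symplectic manifold `(M, σ)`: for some complex structure `J` on `T_x M` that is compatible
with `σ x` and invariant under the linearised action, there is a `J`-complex basis `e` of `T_x M`
(so that the `e j` and the `J (e j)` form a real basis) in which `T_x ρ(u)` is the diagonal matrix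
with entries `u ^ m 0, …, u ^ m (k-1)`, for all `u`. -/
def IsWeights (σ : DForm I M 2) (x : M) {k : ℕ} (m : Fin k → ℤ) : Prop :=
  ∃ J : TangentSpace I x →L[ℝ] TangentSpace I x,
    (∀ a, J (J a) = -a) ∧
    (∀ a b, σ x ![J a, J b] = σ x ![a, b]) ∧
    (∀ a, a ≠ 0 → 0 < σ x ![a, J a]) ∧
    (∀ u a, linearisedAction I x u (J a) = J (linearisedAction I x u a)) ∧
    ∃ b : Module.Basis (Fin k ⊕ Fin k) ℝ (TangentSpace I x),
      (∀ j, b (Sum.inr j) = J (b (Sum.inl j))) ∧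
      ∀ (u : Circle) (j : Fin k),
        linearisedAction I x u (b (Sum.inl j)) =
          ((u ^ m j : Circle) : ℂ).re • b (Sum.inl j) +
          ((u ^ m j : Circle) : ℂ).im • J (b (Sum.inl j))

end CircleActions

/-- `π : V → B` is a (smooth) principal circle bundle: the circle acts on `V` preserving the fibres
of `π`, and `π` is locally, over the base, equivariantly diffeomorphic to the trivial bundle
`U × S¹ → U` (where the circle acts by multiplication on the second factor). -/
structure IsPrincipalCircleBundle (n : ℕ)
    {V : Type*} [TopologicalSpace V] [ChartedSpace (EuclideanSpace ℝ (Fin (n + 1))) V]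
    [MulAction Circle V]
    {B : Type*} [TopologicalSpace B] [ChartedSpace (EuclideanSpace ℝ (Fin n)) B]
    (π : V → B) : Prop where
  smooth : ContMDiff (𝓡 (n + 1)) (𝓡 n) ∞ π
  smul_fibre : ∀ (u : Circle) (x : V), π (u • x) = π x
  locally_trivial : ∀ b : B, ∃ U : Set B, IsOpen U ∧ b ∈ U ∧
    ∃ Φ : OpenPartialHomeomorph V (B × Circle),
      Φ.source = π ⁻¹' U ∧ Φ.target = U ×ˢ Set.univ ∧
      ContMDiffOn (𝓡 (n + 1)) ((𝓡 n).prod (𝓡 1)) ∞ Φ Φ.source ∧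
      ContMDiffOn ((𝓡 n).prod (𝓡 1)) (𝓡 (n + 1)) ∞ Φ.symm Φ.target ∧
      ∀ x ∈ Φ.source, (Φ x).1 = π x ∧ ∀ u : Circle, Φ (u • x) = ((Φ x).1, u * (Φ x).2)

/-! ## The cotangent bundle and its symplectic cut -/

section Cut

variable (n : ℕ) (V : Type*) [TopologicalSpace V]
  [ChartedSpace (EuclideanSpace ℝ (Fin (n + 1))) V]

/-- The cotangent bundle `T^* V`; its points are written `⟨x, φ⟩` with `φ ∈ T_x^* V`. -/
abbrev Cotangent : Type _ :=
  Bundle.TotalSpace (EuclideanSpace ℝ (Fin (n + 1)) →L[ℝ] ℝ)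
    (fun x : V => TangentSpace (𝓡 (n + 1)) x →L[ℝ] ℝ)

section

variable {n V}

lemma Cotangent.mk_congr {x y : V} (h : x = y) (a b : EuclideanSpace ℝ (Fin (n + 1)) →L[ℝ] ℝ)
    (hab : a = b) : (⟨x, a⟩ : Cotangent n V) = ⟨y, b⟩ := by
  subst h; subst hab; rfl

end

variable [IsManifold (𝓡 (n + 1)) ∞ V]

/-- The model of the manifold `T^* V`. -/
noncomputable abbrev cotangentModel :
    ModelWithCorners ℝ
      (EuclideanSpace ℝ (Fin (n + 1)) × (EuclideanSpace ℝ (Fin (n + 1)) →L[ℝ] ℝ))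
      (ModelProd (EuclideanSpace ℝ (Fin (n + 1))) (EuclideanSpace ℝ (Fin (n + 1)) →L[ℝ] ℝ)) :=
  (𝓡 (n + 1)).prod 𝓘(ℝ, EuclideanSpace ℝ (Fin (n + 1)) →L[ℝ] ℝ)

/-- The Liouville form `λ_{(x, φ)}(v) = φ (T p_V v)` on `T^* V`, where `p_V : T^* V → V`. -/
noncomputable def liouvilleForm : DForm (cotangentModel n) (Cotangent n V) 1 :=
  fun p => ContinuousAlternatingMap.ofSubsingleton ℝ (TangentSpace (cotangentModel n) p) ℝ
    (0 : Fin 1)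
    (p.2 ∘L mfderiv (cotangentModel n) (𝓡 (n + 1)) (fun q : Cotangent n V => q.1) p)

/-- The canonical symplectic form `dλ = ∑ dpᵢ ∧ dqᵢ` on `T^* V`. -/
noncomputable def canonicalForm : DForm (cotangentModel n) (Cotangent n V) 2 :=
  DForm.d (cotangentModel n) (liouvilleForm n V)

/-- The standard symplectic form `dx ∧ dy` on `ℂ`. -/
noncomputable def standardForm : DForm 𝓘(ℝ, ℂ) ℂ 2 :=
  fun _ =>
    ({ toFun := fun v : Fin 2 → ℂ => (v 0).re * (v 1).im - (v 0).im * (v 1).re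
       map_update_add' := by
         intro _ m i x y
         fin_cases i <;> simp [Function.update] <;> ring
       map_update_smul' := by
         intro _ m i c x
         fin_cases i <;> simp [Function.update] <;> ring
       cont := by fun_prop
       map_eq_zero_of_eq' := by
         intro v i j h hij
         have h01 : v 0 = v 1 := by
           fin_cases i <;> fin_cases j <;> simp_all
         rw [h01]; ring } : ℂ [⋀^Fin 2]→L[ℝ] ℝ)

/-- The model of the manifold `T^* V × ℂ`. -/
noncomputable abbrev cutAmbientModel :
    ModelWithCorners ℝ
      ((EuclideanSpace ℝ (Fin (n + 1)) × (EuclideanSpace ℝ (Fin (n + 1)) →L[ℝ] ℝ)) × ℂ)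
      (ModelProd
        (ModelProd (EuclideanSpace ℝ (Fin (n + 1))) (EuclideanSpace ℝ (Fin (n + 1)) →L[ℝ] ℝ)) ℂ) :=
  (cotangentModel n).prod 𝓘(ℝ, ℂ)

/-- The symplectic form `ω_can ⊕ ω_std` on `T^* V × ℂ`. -/
noncomputable def cutAmbientForm : DForm (cutAmbientModel n) (Cotangent n V × ℂ) 2 :=
  DForm.pullback (cutAmbientModel n) (cotangentModel n) Prod.fst (canonicalForm n V) +
    DForm.pullback (cutAmbientModel n) 𝓘(ℝ, ℂ) Prod.snd standardForm

variable [MulAction Circle V]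

variable {n V} in
/-- The lifted action `u • (x, φ) = (u • x, φ ∘ (T_x ρ(u))⁻¹)` on `T^* V`. -/
noncomputable def cotangentAct (u : Circle) (p : Cotangent n V) : Cotangent n V :=
  ⟨u • p.1, p.2 ∘L (mfderiv (𝓡 (n + 1)) (𝓡 (n + 1)) (fun y : V => u • y) p.1).inverse⟩

variable {n V} in
/-- The Hamiltonian `H (x, φ) = ⟨φ, X x⟩`, where `X` is the fundamental vector field. -/
noncomputable def cotangentHamiltonian (p : Cotangent n V) : ℝ :=
  p.2 (circleVectorField (𝓡 (n + 1)) p.1)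

variable {n V} in
/-- The circle action `u • (x, φ, z) = (u • x, u • φ, ū z)` on `T^* V × ℂ`. -/
noncomputable def cutAct (u : Circle) (p : Cotangent n V × ℂ) : Cotangent n V × ℂ :=
  (cotangentAct u p.1, (starRingEnd ℂ) (u : ℂ) * p.2)

variable {n V} in
/-- The Hamiltonian `H (x, φ) - |z|² / 2` on `T^* V × ℂ`. -/
noncomputable def cutHamiltonian (p : Cotangent n V × ℂ) : ℝ :=
  cotangentHamiltonian p.1 - ‖p.2‖ ^ 2 / 2

/-- The level set `{H = ξ}` in `T^* V`. -/
def CotangentLevel (ξ : ℝ) : Type _ := {p : Cotangent n V // cotangentHamiltonian p = ξ}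

/-- The level set `{H - |z|² / 2 = ξ}` in `T^* V × ℂ`. -/
def CutLevel (ξ : ℝ) : Type _ := {p : Cotangent n V × ℂ // cutHamiltonian p = ξ}

noncomputable instance (ξ : ℝ) : TopologicalSpace (CutLevel n V ξ) := instTopologicalSpaceSubtype

variable {n V} in
/-- The inclusion of the level set `{H - |z|² / 2 = ξ}` in `T^* V × ℂ`. -/
def CutLevel.incl {ξ : ℝ} (p : CutLevel n V ξ) : Cotangent n V × ℂ := p.1

section ActionLemmas

variable {n V}

lemma cotangentAct_one (p : Cotangent n V) : cotangentAct 1 p = p := by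
  have h : (fun y : V => (1 : Circle) • y) = id := funext fun y => one_smul _ _
  refine Cotangent.mk_congr (one_smul _ _) _ _ ?_
  have hA : (mfderiv (𝓡 (n + 1)) (𝓡 (n + 1)) (fun y : V => (1 : Circle) • y) p.1 :
      EuclideanSpace ℝ (Fin (n + 1)) →L[ℝ] EuclideanSpace ℝ (Fin (n + 1))) =
      ContinuousLinearMap.id ℝ _ := by
    rw [h]; exact mfderiv_id
  refine (congrArg (fun A : EuclideanSpace ℝ (Fin (n + 1)) →L[ℝ] EuclideanSpace ℝ (Fin (n + 1)) =>
    (p.2 : EuclideanSpace ℝ (Fin (n + 1)) →L[ℝ] ℝ) ∘L A.inverse) hA).trans ?_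
  have hI : (ContinuousLinearMap.id ℝ (EuclideanSpace ℝ (Fin (n + 1)))).inverse =
      ContinuousLinearMap.id ℝ _ := ContinuousLinearMap.inverse_id
  exact ContinuousLinearMap.ext fun v => congrArg p.2 (DFunLike.congr_fun hI v)

lemma cutAct_one (p : Cotangent n V × ℂ) : cutAct 1 p = p := by
  simp [cutAct, cotangentAct_one]

variable [ContMDiffSMul (𝓡 1) (𝓡 (n + 1)) ∞ Circle V]

lemma cotangentAct_mul (u v : Circle) (p : Cotangent n V) :
    cotangentAct (u * v) p = cotangentAct u (cotangentAct v p) := by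
  have h : (fun y : V => (u * v) • y) = (fun y : V => u • y) ∘ (fun y : V => v • y) :=
    funext fun y => mul_smul _ _ _
  refine Cotangent.mk_congr (mul_smul _ _ _) _ _ ?_
  let Φ := fun g : Circle => Diffeomorph.smul (𝓡 1) (𝓡 (n + 1)) (M := V) ∞ g
  have hd : ∀ (g : Circle) (y : V),
      MDifferentiableAt (𝓡 (n + 1)) (𝓡 (n + 1)) (fun y : V => g • y) y :=
    fun g y => (Φ g).mdifferentiable (by simp) y
  have hi : ∀ (g : Circle) (y : V),
      (mfderiv (𝓡 (n + 1)) (𝓡 (n + 1)) (fun y : V => g • y) y).IsInvertible :=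
    fun g y => ⟨(Φ g).mfderivToContinuousLinearEquiv (by simp) y, rfl⟩
  have hA : (mfderiv (𝓡 (n + 1)) (𝓡 (n + 1)) (fun y : V => (u * v) • y) p.1 :
      EuclideanSpace ℝ (Fin (n + 1)) →L[ℝ] EuclideanSpace ℝ (Fin (n + 1))) =
      (mfderiv (𝓡 (n + 1)) (𝓡 (n + 1)) (fun y : V => u • y) (v • p.1)) ∘L
        (mfderiv (𝓡 (n + 1)) (𝓡 (n + 1)) (fun y : V => v • y) p.1) := by
    rw [h]; exact mfderiv_comp _ (hd u _) (hd v _)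
  refine (congrArg (fun A : EuclideanSpace ℝ (Fin (n + 1)) →L[ℝ] EuclideanSpace ℝ (Fin (n + 1)) =>
    (p.2 : EuclideanSpace ℝ (Fin (n + 1)) →L[ℝ] ℝ) ∘L A.inverse) hA).trans ?_
  exact congrArg (fun A : EuclideanSpace ℝ (Fin (n + 1)) →L[ℝ] EuclideanSpace ℝ (Fin (n + 1)) =>
    (p.2 : EuclideanSpace ℝ (Fin (n + 1)) →L[ℝ] ℝ) ∘L A)
    (ContinuousLinearMap.IsInvertible.inverse_comp_of_left (hi u (v • p.1))
      (f := mfderiv (𝓡 (n + 1)) (𝓡 (n + 1)) (fun y : V => v • y) p.1))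

lemma cutAct_mul (u v : Circle) (p : Cotangent n V × ℂ) :
    cutAct (u * v) p = cutAct u (cutAct v p) := by
  simp [cutAct, cotangentAct_mul, mul_assoc]

end ActionLemmas

variable [ContMDiffSMul (𝓡 1) (𝓡 (n + 1)) ∞ Circle V] (ξ : ℝ)

/-- Two points of the level `{H = ξ}` are equivalent if they lie in the same circle orbit. -/
def cotangentLevelSetoid : Setoid (CotangentLevel n V ξ) where
  r p q := ∃ u : Circle, q.1 = cotangentAct u p.1
  iseqv :=
    { refl := fun p => ⟨1, (cotangentAct_one p.1).symm⟩
      symm := by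
        rintro p q ⟨u, hu⟩
        exact ⟨u⁻¹, by rw [hu, ← cotangentAct_mul, inv_mul_cancel, cotangentAct_one]⟩
      trans := by
        rintro p q r ⟨u, hu⟩ ⟨v, hv⟩
        exact ⟨v * u, by rw [hv, hu, cotangentAct_mul]⟩ }

/-- Two points of the level `{H - |z|² / 2 = ξ}` are equivalent if they lie in the same orbit of the
circle action `u • (x, φ, z) = (u • x, u • φ, ū z)`. -/
def cutLevelSetoid : Setoid (CutLevel n V ξ) where
  r p q := ∃ u : Circle, q.1 = cutAct u p.1
  iseqv :=
    { refl := fun p => ⟨1, (cutAct_one p.1).symm⟩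
      symm := by
        rintro p q ⟨u, hu⟩
        exact ⟨u⁻¹, by rw [hu, ← cutAct_mul, inv_mul_cancel, cutAct_one]⟩
      trans := by
        rintro p q r ⟨u, hu⟩ ⟨v, hv⟩
        exact ⟨v * u, by rw [hv, hu, cutAct_mul]⟩ }

/-- The reduced space `Q_ξ = {H = ξ} / S¹` of the cotangent bundle. -/
def ReducedSpace : Type _ := Quotient (cotangentLevelSetoid n V ξ)

/-- The symplectic cut `W_ξ = {H - |z|² / 2 = ξ} / S¹`, as a topological space. -/
def SymplecticCut : Type _ := Quotient (cutLevelSetoid n V ξ)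

instance : TopologicalSpace (SymplecticCut n V ξ) :=
  inferInstanceAs (TopologicalSpace (Quotient (cutLevelSetoid n V ξ)))

variable {n V ξ}

/-- The projection `(x, φ, z) ↦ [x, φ, z]` of the level `{H - |z|² / 2 = ξ}` onto `W_ξ`. -/
def SymplecticCut.mk (p : CutLevel n V ξ) : SymplecticCut n V ξ :=
  Quotient.mk (cutLevelSetoid n V ξ) p

/-- The embedding `Q_ξ → W_ξ`, `[x, φ] ↦ [x, φ, 0]`. -/
noncomputable def ReducedSpace.toCut : ReducedSpace n V ξ → SymplecticCut n V ξ :=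
  Quotient.lift
    (fun p : CotangentLevel n V ξ => SymplecticCut.mk (⟨(p.1, 0), by
      simpa [cutHamiltonian] using p.2⟩ : CutLevel n V ξ))
    (by
      rintro p q ⟨u, hu⟩
      exact Quotient.sound ⟨u, by simp [cutAct, hu]⟩)

/-- The rotation `(x, φ, z) ↦ (x, φ, u z)` of the level `{H - |z|² / 2 = ξ}`. -/
noncomputable def CutLevel.rotate (u : Circle) (p : CutLevel n V ξ) : CutLevel n V ξ :=
  ⟨(p.1.1, (u : ℂ) * p.1.2), by
    have h := p.2
    rw [cutHamiltonian] at h ⊢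
    rw [norm_mul, Circle.norm_coe, one_mul]
    exact h⟩

/-- The circle action `u • [x, φ, z] = [x, φ, u z]` on the symplectic cut. -/
noncomputable instance : MulAction Circle (SymplecticCut n V ξ) where
  smul u := Quotient.map (CutLevel.rotate u) (by
    rintro p q ⟨v, hv⟩
    exact ⟨v, by simp [CutLevel.rotate, cutAct, hv, mul_left_comm]⟩)
  one_smul w := by
    induction w using Quotient.inductionOn with
    | h p => exact congrArg (Quotient.mk _) (Subtype.ext (by simp [CutLevel.rotate]))
  mul_smul u v w := by
    induction w using Quotient.inductionOn with
    | h p => exact congrArg (Quotient.mk _) (Subtype.ext (by simp [CutLevel.rotate, mul_assoc]))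

/-- The function `[x, φ, z] ↦ |z|² / 2` on the symplectic cut. -/
noncomputable def SymplecticCut.hamiltonian : SymplecticCut n V ξ → ℝ :=
  Quotient.lift (fun p : CutLevel n V ξ => ‖p.1.2‖ ^ 2 / 2) (by
    rintro p q ⟨u, hu⟩
    rw [hu, cutAct, norm_mul, RCLike.norm_conj, Circle.norm_coe, one_mul])

/-- `W_ξ`, with a given smooth structure and the 2-form `σ`, is the symplectic reduction of
`(T^* V × ℂ, ω_can ⊕ ω_std)` at the level `{H - |z|² / 2 = ξ}`: this level is an embedded
submanifold of `T^* V × ℂ` (of dimension `2 n + 3`, with the given smooth structure), the projection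
onto `W_ξ` (of dimension `2 n + 2`) is a smooth submersion, and `σ` is the symplectic form on `W_ξ`
whose pullback to the level is the restriction of `ω_can ⊕ ω_std`. The smooth structures and
the form are uniquely determined by these properties. -/
structure IsSymplecticReduction
    [ChartedSpace (EuclideanSpace ℝ (Fin (2 * n + 3))) (CutLevel n V ξ)]
    [ChartedSpace (EuclideanSpace ℝ (Fin (2 * n + 2))) (SymplecticCut n V ξ)]
    (σ : DForm (𝓡 (2 * n + 2)) (SymplecticCut n V ξ) 2) : Prop where
  isManifold_level : IsManifold (𝓡 (2 * n + 3)) ∞ (CutLevel n V ξ)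
  isManifold_cut : IsManifold (𝓡 (2 * n + 2)) ∞ (SymplecticCut n V ξ)
  embedding : Manifold.IsSmoothEmbedding (𝓡 (2 * n + 3)) (cutAmbientModel n) ∞
    (CutLevel.incl : CutLevel n V ξ → Cotangent n V × ℂ)
  submersion : Manifold.IsSubmersion (𝓡 (2 * n + 3)) (𝓡 (2 * n + 2)) ∞
    (SymplecticCut.mk : CutLevel n V ξ → SymplecticCut n V ξ)
  symplectic : IsSymplecticForm (𝓡 (2 * n + 2)) σ
  pullback_eq :
    DForm.pullback (𝓡 (2 * n + 3)) (𝓡 (2 * n + 2))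
      (SymplecticCut.mk : CutLevel n V ξ → SymplecticCut n V ξ) σ =
    DForm.pullback (𝓡 (2 * n + 3)) (cutAmbientModel n)
      (CutLevel.incl : CutLevel n V ξ → Cotangent n V × ℂ) (cutAmbientForm n V)

end Cut

/-!
The symplectic cut is, near each of its points, the standard symplectic vector space
`ℝⁿ × ℝⁿ × ℂ` with coordinates `(q, p, w)`, form `∑ dpᵢ ∧ dqᵢ + dx ∧ dy` and circle action
`u • (q, p, w) = (q, p, u w)`. All the assertions are read off from this local model.

*The local model.* A local trivialisation of the bundle, a chart of the base and the angular
coordinate of the circle give charts `(q, t)` of `V`, with `t ∈ (-π, π)`, in which the circle acts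
by translations of `t` (`IsAdaptedChart`, `IsPrincipalCircleBundle.hasAdaptedCharts`). In the
induced coordinates `(q, t, p, h)` of `T^* V` the Liouville form is `∑ pᵢ dqᵢ + h dt`, and `H` is
the coefficient `h`. On `T^* V × ℂ`, the coordinates `k = h - |z|² / 2 - ξ`, `t`, `q`, `p` and
`w = exp (i t) z` are used (`ambientChart`): the level `{H - |z|² / 2 = ξ}` is `{k = 0}`, the circle
acts by translations of `t` alone (`ambientChart_symm_eq_cutAct`), and hence `(t, q, p, w)` are
coordinates of the level and `(q, p, w)` are coordinates of its quotient (`levelChart`,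
`cutChart`). On the level, the form `d(∑ pᵢ dqᵢ + (ξ + |w|² / 2) dt)` on the first factor and the
form `dx ∧ dy` in `z = exp (-i t) w` on the second one add up to `∑ dpᵢ ∧ dqᵢ + dx ∧ dy` in
`(q, p, w)` (`pullback_cutAmbientForm`).

*Existence.* An adapted chart that meets an orbit of `V` contains all of its points but one, so that
two adapted charts that meet an orbit share a point of it (`exists_mem_levelChart_source_inter`).
Therefore the coordinate changes of the quotient are restrictions of those of the level, and are
smooth. In these charts the inclusion of the level is `y ↦ (0, y)` and the projection is
`(t, a) ↦ a`, and the forms on the quotient fit together because their pullbacks to the level agree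
(`exists_isSymplecticReduction`).

*Arbitrary reductions.* Let smooth structures and a form be given which make `W_ξ` the symplectic
reduction. Since the level is embedded, its charts are smooth for the given structure, and since a
submersion has local sections, so are the charts of the quotient (`contMDiffAt_cutChart`). The form
is determined by its pullback to the level, so it is the standard one in these charts
(`eq_pullback_cutChart`). There, the action is the rotation of `w`, its vector field is
`i w ∂ / ∂w`, and `h = |w|² / 2` is its Hamiltonian
(`IsSymplecticReduction.isHamiltonianCircleAction`). The fixed points are the points with `w = 0`,
that is, with `z = 0`.

*Weights.* At a fixed point the tangent map of a chart is a symplectic isomorphism which conjugates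
the linearised action to `(q, p, w) ↦ (q, p, u w)` (`IsSymplecticReduction.exists_linearisation`).
The standard complex structure has the weights `0, …, 0, 1`. For any compatible invariant complex
structure `J`, the trace of the action is both `2 ∑ Re u ^ mⱼ` and `2 n + 2 Re u`. Comparing the two
at suitable `u` shows that one weight is `1` or `-1` and that the others vanish
(`exists_weight_eq_one_or_neg_one`). A weight `-1` would have an eigenvector `e` with
`i • e = -J e`, so that `σ(e, i • e) = -σ(e, J e) < 0`, whereas `σ(e, i • e) = |w(e)|² ≥ 0` in the
local model (`sum_weights_eq_one`).
-/

open Set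

/-! ### Charts of the cotangent bundle -/

section SmoothChart
variable {n : ℕ} {V : Type*} [TopologicalSpace V]
  [ChartedSpace (EuclideanSpace ℝ (Fin (n + 1))) V]
  {F : Type*} [NormedAddCommGroup F] [NormedSpace ℝ F]

/-- A local diffeomorphism from an open subset of `V` to an open subset of the vector space `F`. -/
structure IsSmoothChart (χ : OpenPartialHomeomorph V F) : Prop where
  contMDiffOn : ContMDiffOn (𝓡 (n + 1)) 𝓘(ℝ, F) ∞ χ χ.source
  contMDiffOn_symm : ContMDiffOn 𝓘(ℝ, F) (𝓡 (n + 1)) ∞ χ.symm χ.target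

namespace IsSmoothChart
variable {χ : OpenPartialHomeomorph V F}

lemma contMDiffAt (hχ : IsSmoothChart (n := n) χ) {x : V} (hx : x ∈ χ.source) :
    ContMDiffAt (𝓡 (n + 1)) 𝓘(ℝ, F) ∞ χ x :=
  hχ.contMDiffOn.contMDiffAt (χ.open_source.mem_nhds hx)

lemma contMDiffAt_symm (hχ : IsSmoothChart (n := n) χ) {y : F} (hy : y ∈ χ.target) :
    ContMDiffAt 𝓘(ℝ, F) (𝓡 (n + 1)) ∞ χ.symm y :=
  hχ.contMDiffOn_symm.contMDiffAt (χ.open_target.mem_nhds hy)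

lemma mdifferentiable (hχ : IsSmoothChart (n := n) χ) : χ.MDifferentiable (𝓡 (n + 1)) 𝓘(ℝ, F) :=
  ⟨hχ.contMDiffOn.mdifferentiableOn (by simp), hχ.contMDiffOn_symm.mdifferentiableOn (by simp)⟩

lemma mfderiv_symm_comp (hχ : IsSmoothChart (n := n) χ) {x : V} {y : F} (hx : x ∈ χ.source)
    (hxy : χ x = y) :
    (mfderiv 𝓘(ℝ, F) (𝓡 (n + 1)) χ.symm y : F →L[ℝ] EuclideanSpace ℝ (Fin (n + 1))) ∘L
      (mfderiv (𝓡 (n + 1)) 𝓘(ℝ, F) χ x : EuclideanSpace ℝ (Fin (n + 1)) →L[ℝ] F) = .id ℝ _ := by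
  subst hxy
  exact hχ.mdifferentiable.symm_comp_deriv hx

lemma mfderiv_comp_symm (hχ : IsSmoothChart (n := n) χ) {x : V} {y : F} (hx : x ∈ χ.source)
    (hxy : χ x = y) :
    (mfderiv (𝓡 (n + 1)) 𝓘(ℝ, F) χ x : EuclideanSpace ℝ (Fin (n + 1)) →L[ℝ] F) ∘L
      (mfderiv 𝓘(ℝ, F) (𝓡 (n + 1)) χ.symm y : F →L[ℝ] EuclideanSpace ℝ (Fin (n + 1))) =
      .id ℝ _ := by
  obtain rfl : x = χ.symm y := by rw [← hxy, χ.left_inv hx]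
  exact hχ.mdifferentiable.comp_symm_deriv (hxy ▸ χ.map_source hx)

end IsSmoothChart

/-- The map `(x, φ) ↦ (χ x, φ ∘ (T_x χ)⁻¹)` induced by a chart `χ`. -/
noncomputable def cotangentLiftFun (χ : OpenPartialHomeomorph V F) (p : Cotangent n V) :
    F × (F →L[ℝ] ℝ) :=
  (χ p.1, p.2 ∘L
    (mfderiv 𝓘(ℝ, F) (𝓡 (n + 1)) χ.symm (χ p.1) : F →L[ℝ] EuclideanSpace ℝ (Fin (n + 1))))

/-- The inverse of the map `cotangentLiftFun χ`. -/
noncomputable def cotangentLiftInv (χ : OpenPartialHomeomorph V F) (q : F × (F →L[ℝ] ℝ)) :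
    Cotangent n V :=
  ⟨χ.symm q.1, q.2 ∘L
    (mfderiv (𝓡 (n + 1)) 𝓘(ℝ, F) χ (χ.symm q.1) : EuclideanSpace ℝ (Fin (n + 1)) →L[ℝ] F)⟩

lemma cotangentLiftInv_left {χ : OpenPartialHomeomorph V F} (hχ : IsSmoothChart (n := n) χ)
    {p : Cotangent n V} (hp : p.1 ∈ χ.source) : cotangentLiftInv χ (cotangentLiftFun χ p) = p := by
  have h := hχ.mfderiv_symm_comp (χ.map_target (χ.map_source hp)) (χ.right_inv (χ.map_source hp))
  exact Cotangent.mk_congr (χ.left_inv hp) _ _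
    (ContinuousLinearMap.ext fun v => congrArg p.2 (DFunLike.congr_fun h v))

lemma cotangentLiftInv_right {χ : OpenPartialHomeomorph V F} (hχ : IsSmoothChart (n := n) χ)
    {q : F × (F →L[ℝ] ℝ)} (hq : q.1 ∈ χ.target) :
    cotangentLiftFun χ (cotangentLiftInv (n := n) χ q) = q := by
  have h := hχ.mfderiv_comp_symm (χ.map_target hq) rfl
  exact Prod.ext (χ.right_inv hq)
    (ContinuousLinearMap.ext fun v => congrArg q.2 (DFunLike.congr_fun h v))

end SmoothChart

section CotangentLift
open Bundle
variable {n : ℕ} {V : Type*} [TopologicalSpace V]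
  [ChartedSpace (EuclideanSpace ℝ (Fin (n + 1))) V] [IsManifold (𝓡 (n + 1)) ∞ V]
variable {E' : Type*} [NormedAddCommGroup E'] [NormedSpace ℝ E']
  {H' : Type*} [TopologicalSpace H'] {I' : ModelWithCorners ℝ E' H'}
  {N : Type*} [TopologicalSpace N] [ChartedSpace H' N]
  {F : Type*} [NormedAddCommGroup F] [NormedSpace ℝ F]

/-- The trivialisation of `T^* V` at `x₀` sends a covector `φ` to its composition with the inverse
of the trivialisation of `T V`. -/
lemma Cotangent.inCoordinates_eq (x₀ x : V) (φ : TangentSpace (𝓡 (n + 1)) x →L[ℝ] ℝ) :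
    ContinuousLinearMap.inCoordinates (EuclideanSpace ℝ (Fin (n + 1))) (TangentSpace (𝓡 (n + 1))) ℝ
      (fun _ : V => ℝ) x₀ x x₀ x φ =
    φ ∘L (trivializationAt (EuclideanSpace ℝ (Fin (n + 1)))
      (TangentSpace (𝓡 (n + 1))) x₀).symmL ℝ x := by
  ext v
  simp [ContinuousLinearMap.inCoordinates]

/-- Smoothness of `y ↦ (f y, A_y ∘ D_y)` when `D_y : T_{f y} V → F` and `A_y : F → ℝ` are smooth
families of linear maps. -/
lemma Cotangent.contMDiffAt_mk {f : N → V} {D : ∀ y, TangentSpace (𝓡 (n + 1)) (f y) →L[ℝ] F}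
    {A : N → F →L[ℝ] ℝ} {y₀ : N} (hf : ContMDiffAt I' (𝓡 (n + 1)) ∞ f y₀)
    (hD : ContMDiffAt I' 𝓘(ℝ, EuclideanSpace ℝ (Fin (n + 1)) →L[ℝ] F) ∞
      (inTangentCoordinates (𝓡 (n + 1)) 𝓘(ℝ, F) f (fun _ => (0 : F)) D y₀) y₀)
    (hA : ContMDiffAt I' 𝓘(ℝ, F →L[ℝ] ℝ) ∞ A y₀) :
    ContMDiffAt I' (cotangentModel n) ∞ (fun y => (⟨f y, A y ∘L D y⟩ : Cotangent n V)) y₀ := by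
  rw [contMDiffAt_hom_bundle]
  refine ⟨hf, (hA.clm_comp hD).congr_of_eventuallyEq (.of_forall fun y => ?_)⟩
  simp only [Cotangent.inCoordinates_eq]
  ext v
  simp [inTangentCoordinates, ContinuousLinearMap.inCoordinates]
  rfl

/-- Smoothness of `y ↦ φ_y ∘ L_y` when `y ↦ (x_y, φ_y)` is a smooth family of covectors and `L_y`
a smooth family of linear maps into `T_{x_y} V`. The base point of `L_y` is called `h y` to allow
for expressions that equal `x_y` only near `y₀`. -/
lemma Cotangent.contMDiffAt_comp {f : N → Cotangent n V} {g : N → F} {h : N → V}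
    {L : N → F →L[ℝ] EuclideanSpace ℝ (Fin (n + 1))} {y₀ : N}
    (hf : ContMDiffAt I' (cotangentModel n) ∞ f y₀) (hh : ∀ᶠ y in 𝓝 y₀, h y = (f y).1)
    (hL : ContMDiffAt I' 𝓘(ℝ, F →L[ℝ] EuclideanSpace ℝ (Fin (n + 1))) ∞
      (inTangentCoordinates 𝓘(ℝ, F) (𝓡 (n + 1)) g h L y₀) y₀) :
    ContMDiffAt I' 𝓘(ℝ, F →L[ℝ] ℝ) ∞
      (fun y => ((f y).2 : EuclideanSpace ℝ (Fin (n + 1)) →L[ℝ] ℝ) ∘L L y) y₀ := by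
  rw [contMDiffAt_hom_bundle] at hf
  have h1 : ∀ᶠ y in 𝓝 y₀, (f y).1 ∈ (trivializationAt (EuclideanSpace ℝ (Fin (n + 1)))
      (TangentSpace (𝓡 (n + 1))) (f y₀).1).baseSet :=
    hf.1.continuousAt.preimage_mem_nhds
      ((trivializationAt _ _ _).open_baseSet.mem_nhds (mem_baseSet_trivializationAt _ _ _))
  refine (hf.2.clm_comp hL).congr_of_eventuallyEq ((h1.and hh).mono fun y hy => ?_)
  obtain ⟨hy1, hy2⟩ := hy
  simp only [inTangentCoordinates, hh.self_of_nhds, Cotangent.inCoordinates_eq]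
  simp only [ContinuousLinearMap.inCoordinates, TangentBundle.symmL_model_space]
  generalize h y = z at hy2 ⊢
  subst hy2
  ext v
  exact congrArg (f y).2 ((trivializationAt (EuclideanSpace ℝ (Fin (n + 1)))
      (TangentSpace (𝓡 (n + 1))) (f y₀).1).symmL_continuousLinearMapAt (R := ℝ) hy1 (L y v)).symm

lemma contMDiffAt_cotangentLiftFun {χ : OpenPartialHomeomorph V F} (hχ : IsSmoothChart (n := n) χ)
    {p : Cotangent n V} (hp : p.1 ∈ χ.source) :
    ContMDiffAt (cotangentModel n) 𝓘(ℝ, F × (F →L[ℝ] ℝ)) ∞ (cotangentLiftFun χ) p := by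
  have h1 : ContMDiffAt (cotangentModel n) 𝓘(ℝ, F) ∞ (fun p : Cotangent n V => χ p.1) p :=
    (hχ.contMDiffAt hp).comp p (Bundle.contMDiffAt_proj _)
  refine h1.prodMk_space ?_
  have h2 := ContMDiffAt.mfderiv (J := cotangentModel n) (I := 𝓘(ℝ, F)) (I' := 𝓡 (n + 1))
    (n := ∞) (m := ∞) (fun _ : Cotangent n V => (χ.symm : F → V))
    (fun p : Cotangent n V => χ p.1) (x₀ := p)
    (by
      exact (hχ.contMDiffAt_symm (χ.map_source hp)).comp (p, χ p.1) contMDiffAt_snd) h1 (by simp)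
  refine Cotangent.contMDiffAt_comp contMDiffAt_id ?_ h2
  filter_upwards [(FiberBundle.continuous_proj _ _).continuousAt.preimage_mem_nhds
    (χ.open_source.mem_nhds hp)] with p' hp' using χ.left_inv hp'

lemma contMDiffAt_cotangentLiftInv {χ : OpenPartialHomeomorph V F} (hχ : IsSmoothChart (n := n) χ)
    {q : F × (F →L[ℝ] ℝ)} (hq : q.1 ∈ χ.target) :
    ContMDiffAt 𝓘(ℝ, F × (F →L[ℝ] ℝ)) (cotangentModel n) ∞ (cotangentLiftInv (n := n) χ) q := by
  have h0 : ContMDiffAt 𝓘(ℝ, F × (F →L[ℝ] ℝ)) 𝓘(ℝ, F) ∞ (Prod.fst : F × (F →L[ℝ] ℝ) → F) q :=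
    contDiff_fst.contMDiff.contMDiffAt
  have h1 : ContMDiffAt 𝓘(ℝ, F × (F →L[ℝ] ℝ)) (𝓡 (n + 1)) ∞
      (fun q : F × (F →L[ℝ] ℝ) => χ.symm q.1) q :=
    (hχ.contMDiffAt_symm hq).comp q h0
  have h2 := ContMDiffAt.mfderiv (J := 𝓘(ℝ, F × (F →L[ℝ] ℝ))) (I := 𝓡 (n + 1)) (I' := 𝓘(ℝ, F))
    (n := ∞) (m := ∞) (fun _ : F × (F →L[ℝ] ℝ) => (χ : V → F))
    (fun q : F × (F →L[ℝ] ℝ) => χ.symm q.1) (x₀ := q)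
    ((hχ.contMDiffAt (χ.map_target hq)).comp (q, χ.symm q.1) contMDiffAt_snd) h1 (by simp)
  refine Cotangent.contMDiffAt_mk (D := fun q => mfderiv (𝓡 (n + 1)) 𝓘(ℝ, F) χ (χ.symm q.1))
    (A := Prod.snd) h1 ?_ contDiff_snd.contMDiff.contMDiffAt
  refine h2.congr_of_eventuallyEq (.of_forall fun y => ?_)
  simp only [inTangentCoordinates, ContinuousLinearMap.inCoordinates,
    TangentBundle.continuousLinearMapAt_model_space]
  rfl

/-- The chart `(x, φ) ↦ (χ x, φ ∘ (T_x χ)⁻¹)` of `T^* V` induced by a chart `χ` of `V`. -/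
noncomputable def cotangentLift (χ : OpenPartialHomeomorph V F) (hχ : IsSmoothChart (n := n) χ) :
    OpenPartialHomeomorph (Cotangent n V) (F × (F →L[ℝ] ℝ)) where
  toFun := cotangentLiftFun χ
  invFun := cotangentLiftInv χ
  source := {p | p.1 ∈ χ.source}
  target := χ.target ×ˢ univ
  map_source' _ hp := ⟨χ.map_source hp, trivial⟩
  map_target' _ hq := χ.map_target hq.1
  left_inv' _ hp := cotangentLiftInv_left hχ hp
  right_inv' _ hq := cotangentLiftInv_right hχ hq.1
  open_source := χ.open_source.preimage (FiberBundle.continuous_proj _ _)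
  open_target := χ.open_target.prod isOpen_univ
  continuousOn_toFun _ hp :=
    (contMDiffAt_cotangentLiftFun hχ hp).continuousAt.continuousWithinAt
  continuousOn_invFun _ hq :=
    (contMDiffAt_cotangentLiftInv hχ hq.1).continuousAt.continuousWithinAt

end CotangentLift

/-! ### Pullbacks and exterior derivatives of differential forms -/

section Pullback
variable {E : Type*} [NormedAddCommGroup E] [NormedSpace ℝ E]
  {H : Type*} [TopologicalSpace H] {I : ModelWithCorners ℝ E H}
  {M : Type*} [TopologicalSpace M] [ChartedSpace H M]
  {E' : Type*} [NormedAddCommGroup E'] [NormedSpace ℝ E']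
  {H' : Type*} [TopologicalSpace H'] {I' : ModelWithCorners ℝ E' H'}
  {M' : Type*} [TopologicalSpace M'] [ChartedSpace H' M']
  {E'' : Type*} [NormedAddCommGroup E''] [NormedSpace ℝ E'']
  {H'' : Type*} [TopologicalSpace H''] {I'' : ModelWithCorners ℝ E'' H''}
  {M'' : Type*} [TopologicalSpace M''] [ChartedSpace H'' M'']
  {k : ℕ}

lemma DForm.pullback_congr {f g : M → M'} {x : M} (h : f =ᶠ[𝓝 x] g) (σ : DForm I' M' k) :
    DForm.pullback I I' f σ x = DForm.pullback I I' g σ x := by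
  have h1 := h.mfderiv_eq (I := I) (I' := I')
  have h2 := h.self_of_nhds
  let σ' : M' → E' [⋀^Fin k]→L[ℝ] ℝ := σ
  change (σ' (f x)).compContinuousLinearMap (mfderiv I I' f x : E →L[ℝ] E') =
    (σ' (g x)).compContinuousLinearMap (mfderiv I I' g x : E →L[ℝ] E')
  rw [h2]
  exact congrArg (σ' (g x)).compContinuousLinearMap h1

lemma DForm.pullback_comp {f : M → M'} {g : M' → M''} {x : M}
    (hg : MDifferentiableAt I' I'' g (f x)) (hf : MDifferentiableAt I I' f x)
    (σ : DForm I'' M'' k) :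
    DForm.pullback I I'' (g ∘ f) σ x =
      DForm.pullback I I' f (DForm.pullback I' I'' g σ) x := by
  ext v
  simp only [DForm.pullback, mfderiv_comp x hg hf]
  rfl

lemma DForm.pullback_apply_pair (f : M → M') (σ : DForm I' M' 2) (x : M) (u v : TangentSpace I x) :
    DForm.pullback I I' f σ x ![u, v] = σ (f x) ![mfderiv I I' f x u, mfderiv I I' f x v] := by
  change (σ (f x)) (mfderiv I I' f x ∘ ![u, v]) = _
  congr 1
  ext i : 1
  fin_cases i <;> rfl

/-- The exterior derivative commutes with pulling back to a vector space. -/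
lemma DForm.pullback_d [I.Boundaryless] [IsManifold I ∞ M] {g : E' → M} {y : E'} {σ : DForm I M k}
    (hg : ContMDiffAt 𝓘(ℝ, E') I ∞ g y)
    (hσ : DifferentiableAt ℝ (DForm.inChart I σ (g y)) (extChartAt I (g y) (g y))) :
    DForm.pullback 𝓘(ℝ, E') I g (DForm.d I σ) y =
      extDeriv (DForm.pullback 𝓘(ℝ, E') I g σ : E' → E' [⋀^Fin k]→L[ℝ] ℝ) y := by
  set c := extChartAt I (g y) with hc
  have hgs : ∀ᶠ y' in 𝓝 y, ContMDiffAt 𝓘(ℝ, E') I 1 g y' :=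
    haveI : IsManifold I 1 M := .of_le (n := ∞) (by simp)
    (contMDiffAt_iff_contMDiffAt_nhds (by simp)).1 (hg.of_le (by simp))
  have hsrc : ∀ᶠ y' in 𝓝 y, g y' ∈ c.source :=
    hg.continuousAt.preimage_mem_nhds (extChartAt_source_mem_nhds (g y))
  have hcg : ContMDiffAt 𝓘(ℝ, E') 𝓘(ℝ, E) ∞ (c ∘ g) y :=
    (contMDiffAt_extChartAt (x := g y)).comp y hg
  have hcd : ∀ x ∈ c.source, MDifferentiableAt I 𝓘(ℝ, E) c x := fun x hx =>
    mdifferentiableAt_extChartAt (by simpa [hc] using hx)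
  have hsd : ∀ z ∈ c.target, MDifferentiableAt 𝓘(ℝ, E) I c.symm z := fun z hz => by
    have := mdifferentiableWithinAt_extChartAt_symm (I := I) (x := g y) hz
    rwa [I.range_eq_univ, mdifferentiableWithinAt_univ] at this
  -- Near `y`, the pullback by `g` is the pullback of the expression in the chart by `c ∘ g`.
  have key : (DForm.pullback 𝓘(ℝ, E') I g σ : E' → E' [⋀^Fin k]→L[ℝ] ℝ) =ᶠ[𝓝 y]
      fun y' => (DForm.inChart I σ (g y) ((c ∘ g) y')).compContinuousLinearMap
        (fderiv ℝ (c ∘ g) y') := by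
    filter_upwards [hgs, hsrc.eventually_nhds] with y' h1 h2
    have h2' := h2.self_of_nhds
    have h3 : c.symm ∘ (c ∘ g) =ᶠ[𝓝 y'] g := h2.mono fun z hz => c.left_inv hz
    have h4 : MDifferentiableAt 𝓘(ℝ, E') I g y' := h1.mdifferentiableAt (by simp)
    have h5 : MDifferentiableAt 𝓘(ℝ, E') 𝓘(ℝ, E) (c ∘ g) y' := (hcd _ h2').comp y' h4
    refine (DForm.pullback_congr h3 σ).symm.trans
      ((DForm.pullback_comp (f := c ∘ g) (hsd _ (c.map_source h2')) h5 σ).trans ?_)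
    rw [DForm.pullback, mfderiv_eq_fderiv]
    rfl
  rw [key.extDeriv_eq, extDeriv_pullback (f := c ∘ g) (r := ∞) hσ hcg.contDiffAt
    (by simpa using WithTop.coe_le_coe.2 (le_top : (2 : ℕ∞) ≤ ⊤))]
  have h6 : fderiv ℝ (c ∘ g) y = (mfderiv I 𝓘(ℝ, E) c (g y) : E →L[ℝ] E) ∘L
      (mfderiv 𝓘(ℝ, E') I g y : E' →L[ℝ] E) := by
    rw [← mfderiv_eq_fderiv]
    exact mfderiv_comp y (hcd _ (mem_extChartAt_source (g y)))
      (hg.mdifferentiableAt (by simp))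
  rw [h6]
  rfl

end Pullback

/-! ### The Liouville form in charts -/

section Liouville
variable {n : ℕ} {V : Type*} [TopologicalSpace V]
  [ChartedSpace (EuclideanSpace ℝ (Fin (n + 1))) V] [IsManifold (𝓡 (n + 1)) ∞ V]
  {F : Type*} [NormedAddCommGroup F] [NormedSpace ℝ F]
  {F' : Type*} [NormedAddCommGroup F'] [NormedSpace ℝ F']

lemma DifferentiableAt.ofSubsingletonLIE {f : F → F →L[ℝ] ℝ} {y : F}
    (hf : DifferentiableAt ℝ f y) :
    DifferentiableAt ℝ
      (fun y' => ContinuousAlternatingMap.ofSubsingletonLIE (0 : Fin 1) (f y')) y :=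
  (ContinuousAlternatingMap.ofSubsingletonLIE (𝕜 := ℝ) (E := F) (F := ℝ)
    (0 : Fin 1)).toContinuousLinearEquiv.differentiableAt.comp y hf

/-- The covector at `y` to which the Liouville form pulls back under `g`. -/
noncomputable def liouvillePullback (g : F → Cotangent n V) (y : F) : F →L[ℝ] ℝ :=
  ((g y).2 : EuclideanSpace ℝ (Fin (n + 1)) →L[ℝ] ℝ) ∘L
    (mfderiv 𝓘(ℝ, F) (𝓡 (n + 1)) (fun y => (g y).1) y : F →L[ℝ] EuclideanSpace ℝ (Fin (n + 1)))

lemma pullback_liouvilleForm {g : F → Cotangent n V} {y : F}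
    (hg : MDifferentiableAt 𝓘(ℝ, F) (cotangentModel n) g y) :
    DForm.pullback 𝓘(ℝ, F) (cotangentModel n) g (liouvilleForm n V) y =
      ContinuousAlternatingMap.ofSubsingletonLIE (0 : Fin 1) (liouvillePullback g y) := by
  have hp : MDifferentiableAt (cotangentModel n) (𝓡 (n + 1)) (fun q : Cotangent n V => q.1) (g y) :=
    (Bundle.contMDiffAt_proj (n := ∞) _).mdifferentiableAt (by simp)
  have h1 : (mfderiv 𝓘(ℝ, F) (𝓡 (n + 1)) (fun y => (g y).1) y : F →L[ℝ] _) = _ :=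
    mfderiv_comp y hp hg
  ext v
  exact congrArg (g y).2 (DFunLike.congr_fun h1 (v 0)).symm

lemma contDiffAt_liouvillePullback {g : F → Cotangent n V} {y : F}
    (hg : ContMDiffAt 𝓘(ℝ, F) (cotangentModel n) ∞ g y) :
    ContDiffAt ℝ ∞ (liouvillePullback g) y := by
  have h1 : ContMDiffAt 𝓘(ℝ, F) (𝓡 (n + 1)) ∞ (fun y => (g y).1) y :=
    (Bundle.contMDiffAt_proj _).comp y hg
  have h2 := ContMDiffAt.mfderiv (n := ∞) (m := ∞) (fun _ : F => fun y => (g y).1) id (x₀ := y)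
    (ContMDiffAt.comp (y, id y) (g := fun y => (g y).1) h1 contMDiffAt_snd) contMDiffAt_id (by simp)
  exact (Cotangent.contMDiffAt_comp hg (.of_forall fun _ => rfl) h2).contDiffAt

/-- The canonical form is the exterior derivative of the Liouville form, also after pulling back. -/
lemma pullback_canonicalForm {g : F → Cotangent n V} {y : F}
    (hg : ∀ᶠ y' in 𝓝 y, ContMDiffAt 𝓘(ℝ, F) (cotangentModel n) ∞ g y') :
    DForm.pullback 𝓘(ℝ, F) (cotangentModel n) g (canonicalForm n V) y =
      extDeriv (fun y' => ContinuousAlternatingMap.ofSubsingletonLIE (0 : Fin 1)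
        (liouvillePullback g y')) y := by
  have h1 : (DForm.pullback 𝓘(ℝ, F) (cotangentModel n) g (liouvilleForm n V) :
      F → F [⋀^Fin 1]→L[ℝ] ℝ) =ᶠ[𝓝 y] fun y' =>
      ContinuousAlternatingMap.ofSubsingletonLIE (0 : Fin 1) (liouvillePullback g y') :=
    hg.mono fun y' hy' => pullback_liouvilleForm (hy'.mdifferentiableAt (by simp))
  rw [canonicalForm, DForm.pullback_d hg.self_of_nhds, h1.extDeriv_eq]
  set c := extChartAt (cotangentModel n) (g y)
  have hc : ∀ z ∈ c.target, ContMDiffAt 𝓘(ℝ, EuclideanSpace ℝ (Fin (n + 1)) ×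
      (EuclideanSpace ℝ (Fin (n + 1)) →L[ℝ] ℝ)) (cotangentModel n) ∞ c.symm z := fun z hz =>
    (contMDiffOn_extChartAt_symm (g y)).contMDiffAt
      ((isOpen_extChartAt_target (g y)).mem_nhds hz)
  have hz : c (g y) ∈ c.target := mem_extChartAt_target (g y)
  have h2 : DForm.inChart (cotangentModel n) (liouvilleForm n V) (g y) =ᶠ[𝓝 (c (g y))] fun z =>
      ContinuousAlternatingMap.ofSubsingletonLIE (0 : Fin 1)
        (liouvillePullback c.symm z) :=
    Filter.mem_of_superset ((isOpen_extChartAt_target (g y)).mem_nhds hz) fun z hz =>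
      pullback_liouvilleForm ((hc z hz).mdifferentiableAt (by simp))
  refine DifferentiableAt.congr_of_eventuallyEq ?_ h2
  exact DifferentiableAt.ofSubsingletonLIE
    ((contDiffAt_liouvillePullback (hc _ hz)).differentiableAt (by simp))

/-- In the chart of `T^* V` induced by a chart of `V`, the Liouville form is `∑ pᵢ dqᵢ`. -/
lemma liouvillePullback_cotangentLift {χ : OpenPartialHomeomorph V F}
    (hχ : IsSmoothChart (n := n) χ)
    {q : F' → F} {p : F' → F →L[ℝ] ℝ} {y : F'} (hq : DifferentiableAt ℝ q y) (hy : q y ∈ χ.target) :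
    liouvillePullback (fun y => (cotangentLift χ hχ).symm (q y, p y)) y = p y ∘L fderiv ℝ q y := by
  have h1 : (mfderiv 𝓘(ℝ, F') (𝓡 (n + 1)) (fun y => χ.symm (q y)) y : F' →L[ℝ] _) = _ :=
    mfderiv_comp y ((hχ.contMDiffAt_symm hy).mdifferentiableAt (by simp)) hq.mdifferentiableAt
  have h2 := hχ.mfderiv_comp_symm (χ.map_target hy) (χ.right_inv hy)
  ext v
  refine (congrArg (fun w => p y (mfderiv (𝓡 (n + 1)) 𝓘(ℝ, F) χ (χ.symm (q y)) w))
    (DFunLike.congr_fun h1 v)).trans ?_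
  rw [mfderiv_eq_fderiv]
  exact congrArg (p y) (DFunLike.congr_fun h2 _)

end Liouville

/-! ### The lifted circle action in charts -/

lemma IsSmoothChart.chartAt {n : ℕ} {V : Type*} [TopologicalSpace V]
    [ChartedSpace (EuclideanSpace ℝ (Fin (n + 1))) V] [IsManifold (𝓡 (n + 1)) ∞ V] (x : V) :
    IsSmoothChart (n := n) (chartAt (EuclideanSpace ℝ (Fin (n + 1))) x) where
  contMDiffOn := contMDiffOn_chart
  contMDiffOn_symm := contMDiffOn_chart_symm

section CotangentAction
variable {n : ℕ} {V : Type*} [TopologicalSpace V]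
  [ChartedSpace (EuclideanSpace ℝ (Fin (n + 1))) V]
  [MulAction Circle V] [ContMDiffSMul (𝓡 1) (𝓡 (n + 1)) ∞ Circle V]
  {F : Type*} [NormedAddCommGroup F]

lemma contMDiff_smul_circle (u : Circle) :
    ContMDiff (𝓡 (n + 1)) (𝓡 (n + 1)) ∞ (fun y : V => u • y) :=
  (Diffeomorph.smul (𝓡 1) (𝓡 (n + 1)) (M := V) ∞ u).contMDiff

lemma mdifferentiableAt_smul_circle (u : Circle) (x : V) :
    MDifferentiableAt (𝓡 (n + 1)) (𝓡 (n + 1)) (fun y : V => u • y) x :=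
  (contMDiff_smul_circle u).mdifferentiable (by simp) x

lemma mfderiv_smul_comp {u v : Circle} (huv : v * u = 1) {x y : V} (hxy : u • x = y) :
    (mfderiv (𝓡 (n + 1)) (𝓡 (n + 1)) (fun y : V => v • y) y :
        EuclideanSpace ℝ (Fin (n + 1)) →L[ℝ] EuclideanSpace ℝ (Fin (n + 1))) ∘L
      (mfderiv (𝓡 (n + 1)) (𝓡 (n + 1)) (fun y : V => u • y) x) = .id ℝ _ := by
  subst hxy
  have h1 : (fun y : V => v • y) ∘ (fun y : V => u • y) = id :=
    funext fun y => by simp [← mul_smul, huv]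
  have h2 : mfderiv (𝓡 (n + 1)) (𝓡 (n + 1)) ((fun y : V => v • y) ∘ (fun y : V => u • y)) x = _ :=
    mfderiv_comp x (mdifferentiableAt_smul_circle v _) (mdifferentiableAt_smul_circle u x)
  rw [h1, mfderiv_id] at h2
  exact h2.symm

/-- The lifted action, with the inverse of `T_x ρ(u)` written as `T_{u x} ρ(u⁻¹)`. -/
lemma cotangentAct_eq (u : Circle) (p : Cotangent n V) :
    cotangentAct u p = ⟨u • p.1, (p.2 : EuclideanSpace ℝ (Fin (n + 1)) →L[ℝ] ℝ) ∘L
      (mfderiv (𝓡 (n + 1)) (𝓡 (n + 1)) (fun y : V => u⁻¹ • y) (u • p.1) :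
        EuclideanSpace ℝ (Fin (n + 1)) →L[ℝ] EuclideanSpace ℝ (Fin (n + 1)))⟩ := by
  refine Cotangent.mk_congr rfl _ _ ?_
  have h1 := mfderiv_smul_comp (n := n) (inv_mul_cancel u) (x := p.1) rfl
  have h2 := mfderiv_smul_comp (n := n) (mul_inv_cancel u) (inv_smul_smul u p.1)
  exact congrArg (fun A : EuclideanSpace ℝ (Fin (n + 1)) →L[ℝ] EuclideanSpace ℝ (Fin (n + 1)) =>
    (p.2 : EuclideanSpace ℝ (Fin (n + 1)) →L[ℝ] ℝ) ∘L A) (ContinuousLinearMap.inverse_eq h2 h1)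

/-- The chart `χ ∘ ρ(u)⁻¹`. -/
noncomputable def translateChart (u : Circle) (χ : OpenPartialHomeomorph V F) :
    OpenPartialHomeomorph V F :=
  (Diffeomorph.smul (𝓡 1) (𝓡 (n + 1)) (M := V) ∞ u⁻¹).toHomeomorph.transOpenPartialHomeomorph χ

lemma translateChart_symm_apply (u : Circle) (χ : OpenPartialHomeomorph V F) (y : F) :
    (translateChart (n := n) u χ).symm y = u • χ.symm y := by
  have h : (translateChart (n := n) u χ).symm y = u⁻¹⁻¹ • χ.symm y := rfl
  rw [h, inv_inv]

variable [NormedSpace ℝ F]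

lemma IsSmoothChart.translateChart {χ : OpenPartialHomeomorph V F} (hχ : IsSmoothChart (n := n) χ)
    (u : Circle) : IsSmoothChart (n := n) (translateChart (n := n) u χ) where
  contMDiffOn := hχ.contMDiffOn.comp (contMDiff_smul_circle u⁻¹).contMDiffOn fun _ hx => hx
  contMDiffOn_symm :=
    ((contMDiff_smul_circle u).comp_contMDiffOn hχ.contMDiffOn_symm).congr
      fun y _ => translateChart_symm_apply u χ y

lemma mfderiv_translateChart {χ : OpenPartialHomeomorph V F} (hχ : IsSmoothChart (n := n) χ)
    (u : Circle) {x y : V} (hx : x ∈ χ.source) (hxy : u⁻¹ • y = x) :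
    (mfderiv (𝓡 (n + 1)) 𝓘(ℝ, F) (translateChart (n := n) u χ) y :
      EuclideanSpace ℝ (Fin (n + 1)) →L[ℝ] F) =
    (mfderiv (𝓡 (n + 1)) 𝓘(ℝ, F) χ x : EuclideanSpace ℝ (Fin (n + 1)) →L[ℝ] F) ∘L
      (mfderiv (𝓡 (n + 1)) (𝓡 (n + 1)) (fun y : V => u⁻¹ • y) y :
        EuclideanSpace ℝ (Fin (n + 1)) →L[ℝ] EuclideanSpace ℝ (Fin (n + 1))) := by
  subst hxy
  exact mfderiv_comp (f := fun y : V => u⁻¹ • y) (g := χ) y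
    ((hχ.contMDiffAt hx).mdifferentiableAt (by simp)) (mdifferentiableAt_smul_circle u⁻¹ _)

/-- In the charts induced by `χ` and by `χ ∘ ρ(u)⁻¹`, the lifted action is the identity. -/
lemma cotangentAct_cotangentLiftInv {χ : OpenPartialHomeomorph V F} (hχ : IsSmoothChart (n := n) χ)
    (u : Circle) {q : F × (F →L[ℝ] ℝ)} (hq : q.1 ∈ χ.target) :
    cotangentAct u (cotangentLiftInv (n := n) χ q) =
      cotangentLiftInv (translateChart (n := n) u χ) q := by
  rw [cotangentAct_eq]
  refine Cotangent.mk_congr (translateChart_symm_apply u χ _).symm _ _ ?_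
  rw [translateChart_symm_apply, mfderiv_translateChart hχ u (χ.map_target hq) (inv_smul_smul u _)]
  rfl

variable [IsManifold (𝓡 (n + 1)) ∞ V]

lemma contMDiff_cotangentAct (u : Circle) :
    ContMDiff (cotangentModel n) (cotangentModel n) ∞ (cotangentAct u : Cotangent n V → _) := by
  intro p
  have hχ := IsSmoothChart.chartAt (n := n) p.1
  set χ := chartAt (EuclideanSpace ℝ (Fin (n + 1))) p.1
  have hp : p.1 ∈ χ.source := mem_chart_source _ p.1
  have h1 := (contMDiffAt_cotangentLiftInv (hχ.translateChart u) (q := cotangentLiftFun χ p)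
    (χ.map_source hp)).comp p (contMDiffAt_cotangentLiftFun hχ hp)
  refine h1.congr_of_eventuallyEq ?_
  filter_upwards [(cotangentLift χ hχ).open_source.mem_nhds hp] with p' hp'
  have h2 := cotangentAct_cotangentLiftInv hχ u (q := cotangentLiftFun χ p') (χ.map_source hp')
  rwa [cotangentLiftInv_left hχ hp'] at h2

lemma contMDiff_cutAct (u : Circle) :
    ContMDiff (cutAmbientModel n) (cutAmbientModel n) ∞ (cutAct u : Cotangent n V × ℂ → _) := by
  refine ((contMDiff_cotangentAct u).comp contMDiff_fst).prodMk ?_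
  have h : ContDiff ℝ ∞ fun z : ℂ => (starRingEnd ℂ) (u : ℂ) * z := contDiff_const.mul contDiff_id
  exact h.contMDiff.comp contMDiff_snd

end CotangentAction

/-! ### The model of the symplectic cut -/

section Model

/-- The model `ℝⁿ × ℝⁿ × ℂ` of the symplectic cut, with coordinates `(q, p, w)`. -/
abbrev CutModel (n : ℕ) : Type :=
  EuclideanSpace ℝ (Fin n) × EuclideanSpace ℝ (Fin n) × ℂ

/-- The covector `∑ pᵢ dqᵢ + h dt` on `ℝⁿ × ℝ`. -/
noncomputable def covectorOf {n : ℕ} (p : EuclideanSpace ℝ (Fin n)) (h : ℝ) :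
    EuclideanSpace ℝ (Fin n) × ℝ →L[ℝ] ℝ :=
  innerSL ℝ p ∘L ContinuousLinearMap.fst ℝ _ ℝ + h • ContinuousLinearMap.snd ℝ _ ℝ

@[simp] lemma covectorOf_apply {n : ℕ} (p : EuclideanSpace ℝ (Fin n)) (h : ℝ)
    (v : EuclideanSpace ℝ (Fin n) × ℝ) : covectorOf p h v = inner ℝ p v.1 + h * v.2 := by
  simp [covectorOf]

/-- The vector `p` with `η = ∑ pᵢ dqᵢ + h dt`. -/
noncomputable def covectorFst {n : ℕ} (η : EuclideanSpace ℝ (Fin n) × ℝ →L[ℝ] ℝ) :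
    EuclideanSpace ℝ (Fin n) :=
  (InnerProductSpace.toDual ℝ _).symm (η ∘L ContinuousLinearMap.inl ℝ _ ℝ)

lemma covectorFst_covectorOf {n : ℕ} (p : EuclideanSpace ℝ (Fin n)) (h : ℝ) :
    covectorFst (covectorOf p h) = p := by
  rw [covectorFst, LinearIsometryEquiv.symm_apply_eq]
  ext v
  simp

lemma covectorOf_covectorFst {n : ℕ} (η : EuclideanSpace ℝ (Fin n) × ℝ →L[ℝ] ℝ) :
    covectorOf (covectorFst η) (η (0, 1)) = η := by
  ext v
  · simp [covectorFst, InnerProductSpace.toDual_symm_apply]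
  · simp

lemma contDiff_covectorFst {n : ℕ} : ContDiff ℝ ∞ (covectorFst (n := n)) :=
  (InnerProductSpace.toDual ℝ (EuclideanSpace ℝ (Fin n))).symm.toContinuousLinearEquiv.contDiff.comp
    (contDiff_id.clm_comp contDiff_const)

lemma contDiff_circleExp : ContDiff ℝ ∞ fun t : ℝ => (Circle.exp t : ℂ) := by
  simp only [Circle.coe_exp]
  exact (Complex.ofRealCLM.contDiff.mul contDiff_const).cexp

lemma contDiff_norm_sq_div_two : ContDiff ℝ ∞ fun z : ℂ => ‖z‖ ^ 2 / 2 :=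
  (contDiff_norm_sq ℝ).div_const _

/-- The coordinate change `(((q, t), η), z) ↦ (k, t, q, p, w)` on `T^*(ℝⁿ × ℝ) × ℂ`, with
`η = p dq + h dt`, `k = h - |z|² / 2 - ξ` and `w = exp (i t) z`. -/
noncomputable def cutShear (n : ℕ) (ξ : ℝ) :
    (((EuclideanSpace ℝ (Fin n) × ℝ) × (EuclideanSpace ℝ (Fin n) × ℝ →L[ℝ] ℝ)) × ℂ) ≃ₜ
      ℝ × ℝ × CutModel n where
  toFun x := (x.1.2 (0, 1) - ‖x.2‖ ^ 2 / 2 - ξ, x.1.1.2, x.1.1.1, covectorFst x.1.2,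
    Circle.exp x.1.1.2 * x.2)
  invFun y := (((y.2.2.1, y.2.1), covectorOf y.2.2.2.1 (ξ + y.1 + ‖y.2.2.2.2‖ ^ 2 / 2)),
    Circle.exp (-y.2.1) * y.2.2.2.2)
  left_inv := by
    rintro ⟨⟨⟨q, t⟩, η⟩, z⟩
    have h1 : ξ + (η (0, 1) - ‖z‖ ^ 2 / 2 - ξ) + ‖z‖ ^ 2 / 2 = η (0, 1) := by ring
    have h2 : (Circle.exp (-t) : ℂ) * (Circle.exp t * z) = z := by
      rw [← mul_assoc, ← Circle.coe_mul, ← Circle.exp_add]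
      simp
    simp only [norm_mul, Circle.norm_coe, one_mul, h1, h2, covectorOf_covectorFst]
  right_inv := by
    rintro ⟨k, t, q, p, w⟩
    have h2 : (Circle.exp t : ℂ) * (Circle.exp (-t) * w) = w := by
      rw [← mul_assoc, ← Circle.coe_mul, ← Circle.exp_add]
      simp
    simp only [norm_mul, Circle.norm_coe, one_mul, h2, covectorFst_covectorOf, covectorOf_apply,
      inner_zero_right, zero_add, mul_one]
    congr 1
    ring
  continuous_toFun := by
    have h1 := (contDiff_covectorFst (n := n)).continuous
    have h2 := contDiff_circleExp.continuous
    have h3 : Continuous fun x : (((EuclideanSpace ℝ (Fin n) × ℝ) ×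
      (EuclideanSpace ℝ (Fin n) × ℝ →L[ℝ] ℝ)) × ℂ) => x.1.2 (0, 1) := by fun_prop
    fun_prop
  continuous_invFun := by
    unfold covectorOf
    fun_prop

lemma contDiff_cutShear (n : ℕ) (ξ : ℝ) : ContDiff ℝ ∞ (cutShear n ξ) := by
  have h1 := contDiff_covectorFst (n := n)
  have h2 := contDiff_circleExp
  have h3 := contDiff_norm_sq_div_two
  have h4 : ContDiff ℝ ∞ fun x : (((EuclideanSpace ℝ (Fin n) × ℝ) ×
      (EuclideanSpace ℝ (Fin n) × ℝ →L[ℝ] ℝ)) × ℂ) => x.1.2 (0, 1) :=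
    (contDiff_snd.comp contDiff_fst).clm_apply contDiff_const
  change ContDiff ℝ ∞ fun x : (((EuclideanSpace ℝ (Fin n) × ℝ) ×
      (EuclideanSpace ℝ (Fin n) × ℝ →L[ℝ] ℝ)) × ℂ) => (_, _, _, _, _)
  exact ((h4.sub (h3.comp contDiff_snd)).sub contDiff_const).prodMk <|
    (contDiff_snd.comp (contDiff_fst.comp contDiff_fst)).prodMk <|
    (contDiff_fst.comp (contDiff_fst.comp contDiff_fst)).prodMk <|
    (h1.comp (contDiff_snd.comp contDiff_fst)).prodMk <|
    (h2.comp (contDiff_snd.comp (contDiff_fst.comp contDiff_fst))).mul contDiff_snd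

lemma contDiff_covectorOf {n : ℕ} {E : Type*} [NormedAddCommGroup E] [NormedSpace ℝ E]
    {p : E → EuclideanSpace ℝ (Fin n)} {h : E → ℝ} (hp : ContDiff ℝ ∞ p) (hh : ContDiff ℝ ∞ h) :
    ContDiff ℝ ∞ fun x => covectorOf (p x) (h x) := by
  unfold covectorOf
  exact (((innerSL ℝ).contDiff.comp hp).clm_comp contDiff_const).add (hh.smul contDiff_const)

lemma contDiff_cutShear_symm (n : ℕ) (ξ : ℝ) : ContDiff ℝ ∞ (cutShear n ξ).symm := by
  have h2 := contDiff_circleExp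
  have h3 := contDiff_norm_sq_div_two
  have hk : ContDiff ℝ ∞ fun y : ℝ × ℝ × CutModel n => y.1 := contDiff_fst
  have ht : ContDiff ℝ ∞ fun y : ℝ × ℝ × CutModel n => y.2.1 := contDiff_fst.comp contDiff_snd
  have ha : ContDiff ℝ ∞ fun y : ℝ × ℝ × CutModel n => y.2.2 := contDiff_snd.comp contDiff_snd
  have hq : ContDiff ℝ ∞ fun y : ℝ × ℝ × CutModel n => y.2.2.1 := contDiff_fst.comp ha
  have hp : ContDiff ℝ ∞ fun y : ℝ × ℝ × CutModel n => y.2.2.2.1 :=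
    contDiff_fst.comp (contDiff_snd.comp ha)
  have hw : ContDiff ℝ ∞ fun y : ℝ × ℝ × CutModel n => y.2.2.2.2 :=
    contDiff_snd.comp (contDiff_snd.comp ha)
  exact ((hq.prodMk ht).prodMk
    (contDiff_covectorOf hp ((contDiff_const.add hk).add (h3.comp hw)))).prodMk
    ((h2.comp ht.neg).mul hw)

end Model

/-! ### Adapted charts and the charts they induce -/

section AmbientChart
variable {n : ℕ} {V : Type*} [TopologicalSpace V]
  [ChartedSpace (EuclideanSpace ℝ (Fin (n + 1))) V]
  [MulAction Circle V]

/-- A chart `(q, t)` of `V` in which the circle acts by translations of the coordinate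
`t ∈ (-π, π)`, and which meets each orbit of the circle in at most one segment `{q} × (-π, π)`, on
which the action is free. The segment misses exactly one point of the orbit. -/
structure IsAdaptedChart (χ : OpenPartialHomeomorph V (EuclideanSpace ℝ (Fin n) × ℝ)) : Prop
    extends IsSmoothChart (n := n) χ where
  /-- The target is a product `A × (-π, π)`. -/
  mem_target_iff : ∀ q t, (q, t) ∈ χ.target ↔ (q, 0) ∈ χ.target ∧ t ∈ Ioo (-Real.pi) Real.pi
  symm_eq_smul : ∀ q t, (q, t) ∈ χ.target → χ.symm (q, t) = Circle.exp t • χ.symm (q, 0)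
  /-- Points of the slice `t = 0` on one orbit coincide, and the action is free there. -/
  free : ∀ q q' (u : Circle), (q, 0) ∈ χ.target → (q', 0) ∈ χ.target →
    u • χ.symm (q, 0) = χ.symm (q', 0) → q = q' ∧ u = 1

variable (n V) in
/-- Every point of `V` lies in the domain of an adapted chart. -/
def HasAdaptedCharts : Prop :=
  ∀ x : V, ∃ χ : OpenPartialHomeomorph V (EuclideanSpace ℝ (Fin n) × ℝ),
    IsAdaptedChart χ ∧ x ∈ χ.source

variable {χ : OpenPartialHomeomorph V (EuclideanSpace ℝ (Fin n) × ℝ)}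

/-- In an adapted chart, the fundamental vector field is `∂ / ∂t`. -/
lemma IsAdaptedChart.circleVectorField_eq (hχ : IsAdaptedChart χ)
    {y : EuclideanSpace ℝ (Fin n) × ℝ} (hy : y ∈ χ.target) :
    circleVectorField (𝓡 (n + 1)) (χ.symm y) =
      (mfderiv 𝓘(ℝ, EuclideanSpace ℝ (Fin n) × ℝ) (𝓡 (n + 1)) χ.symm y (0, 1) :
        EuclideanSpace ℝ (Fin (n + 1))) := by
  obtain ⟨q, t⟩ := y
  let γ : ℝ → EuclideanSpace ℝ (Fin n) × ℝ := fun s => (q, t + s)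
  have hγ : HasFDerivAt γ ((0 : ℝ →L[ℝ] EuclideanSpace ℝ (Fin n)).prod (.id ℝ ℝ)) 0 :=
    (hasFDerivAt_const q (0 : ℝ)).prodMk ((hasFDerivAt_id (0 : ℝ)).const_add t)
  have hγ0 : γ 0 = (q, t) := by simp [γ]
  have h1 : (fun s : ℝ => Circle.exp s • χ.symm (q, t)) =ᶠ[𝓝 0] χ.symm ∘ γ := by
    filter_upwards [hγ.continuousAt.preimage_mem_nhds
      (χ.open_target.mem_nhds (hγ0 ▸ hy))] with s hs
    have hs' : (q, t + s) ∈ χ.target := hs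
    simp only [Function.comp, γ]
    rw [hχ.symm_eq_smul _ _ hy, hχ.symm_eq_smul _ _ hs', ← mul_smul, ← Circle.exp_add, add_comm]
  have h2 : mfderiv 𝓘(ℝ, ℝ) (𝓡 (n + 1)) (χ.symm ∘ γ) 0 = _ :=
    mfderiv_comp_of_eq (x := (0 : ℝ)) (g := χ.symm)
      ((hχ.contMDiffAt_symm hy).mdifferentiableAt (by simp))
      hγ.differentiableAt.mdifferentiableAt hγ0
  have h3 := (h1.mfderiv_eq (I := 𝓘(ℝ, ℝ)) (I' := 𝓡 (n + 1))).trans h2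
  have h4 : (mfderiv 𝓘(ℝ, ℝ) 𝓘(ℝ, EuclideanSpace ℝ (Fin n) × ℝ) γ 0 : ℝ →L[ℝ] _) = _ :=
    mfderiv_eq_fderiv.trans hγ.fderiv
  -- The base point of the derivative is `γ 0`, which equals `(q, t)` only propositionally.
  have h5 : ∀ y', y' = (q, t) →
      (mfderiv 𝓘(ℝ, EuclideanSpace ℝ (Fin n) × ℝ) (𝓡 (n + 1)) χ.symm y' (0, 1) :
        EuclideanSpace ℝ (Fin (n + 1))) =
      (mfderiv 𝓘(ℝ, EuclideanSpace ℝ (Fin n) × ℝ) (𝓡 (n + 1)) χ.symm (q, t) (0, 1) :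
        EuclideanSpace ℝ (Fin (n + 1))) := by rintro _ rfl; rfl
  refine (DFunLike.congr_fun h3 (1 : ℝ)).trans (Eq.trans ?_ (h5 (γ 0) hγ0))
  exact congrArg (mfderiv 𝓘(ℝ, EuclideanSpace ℝ (Fin n) × ℝ) (𝓡 (n + 1)) χ.symm (γ 0) :
    EuclideanSpace ℝ (Fin n) × ℝ →L[ℝ] EuclideanSpace ℝ (Fin (n + 1)))
    (DFunLike.congr_fun h4 (1 : ℝ))

/-- In the chart of `T^* V` induced by an adapted chart, the Hamiltonian is the coefficient of
`dt`. -/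
lemma IsAdaptedChart.cotangentHamiltonian_eq (hχ : IsAdaptedChart χ) {p : Cotangent n V}
    (hp : p.1 ∈ χ.source) : cotangentHamiltonian p = (cotangentLiftFun χ p).2 (0, 1) := by
  have h := hχ.circleVectorField_eq (χ.map_source hp)
  rw [χ.left_inv hp] at h
  exact congrArg (p.2 : EuclideanSpace ℝ (Fin (n + 1)) →L[ℝ] ℝ) h

/-- Adapted charts are invariant under the circle up to a translation of `t`. -/
lemma IsAdaptedChart.mfderiv_translateChart [ContMDiffSMul (𝓡 1) (𝓡 (n + 1)) ∞ Circle V]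
    (hχ : IsAdaptedChart χ)
    {q : EuclideanSpace ℝ (Fin n)} {t : ℝ} (h : (q, t) ∈ χ.target) :
    (mfderiv (𝓡 (n + 1)) 𝓘(ℝ, EuclideanSpace ℝ (Fin n) × ℝ)
      (translateChart (n := n) (Circle.exp t) χ) (χ.symm (q, t)) :
        EuclideanSpace ℝ (Fin (n + 1)) →L[ℝ] _) =
    mfderiv (𝓡 (n + 1)) 𝓘(ℝ, EuclideanSpace ℝ (Fin n) × ℝ) χ (χ.symm (q, t)) := by
  let T : EuclideanSpace ℝ (Fin n) × ℝ → EuclideanSpace ℝ (Fin n) × ℝ := fun y => y - (0, t)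
  have hT : ∀ y, HasFDerivAt T (.id ℝ _) y := fun y => (hasFDerivAt_id y).sub_const (0, t)
  have hx : χ.symm (q, t) ∈ χ.source := χ.map_target h
  have hTx : T (χ (χ.symm (q, t))) ∈ χ.target := by
    have : T (q, t) = (q, 0) := by simp [T]
    rw [χ.right_inv h, this]
    exact ((hχ.mem_target_iff _ _).1 h).1
  have hcont : ContinuousAt (T ∘ χ) (χ.symm (q, t)) :=
    (hT _).continuousAt.comp (χ.continuousAt hx)
  have h1 : translateChart (n := n) (Circle.exp t) χ =ᶠ[𝓝 (χ.symm (q, t))] T ∘ χ := by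
    filter_upwards [χ.open_source.mem_nhds hx,
      hcont.preimage_mem_nhds (χ.open_target.mem_nhds hTx)] with x hx hx'
    obtain ⟨⟨q', t'⟩, hy, rfl⟩ : ∃ y ∈ χ.target, χ.symm y = x :=
      ⟨χ x, χ.map_source hx, χ.left_inv hx⟩
    have hT' : T (q', t') = (q', t' - t) := by simp [T]
    simp only [mem_preimage, Function.comp, χ.right_inv hy, hT'] at hx' ⊢
    have h2 : translateChart (n := n) (Circle.exp t) χ (χ.symm (q', t')) =
      χ ((Circle.exp t)⁻¹ • χ.symm (q', t')) := rfl
    rw [h2, hχ.symm_eq_smul _ _ hy, ← mul_smul, ← Circle.exp_neg, ← Circle.exp_add,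
      neg_add_eq_sub, ← hχ.symm_eq_smul _ _ hx', χ.right_inv hx']
  refine (h1.mfderiv_eq (I := 𝓡 (n + 1)) (I' := 𝓘(ℝ, EuclideanSpace ℝ (Fin n) × ℝ))).trans ?_
  have h3 : mfderiv (𝓡 (n + 1)) 𝓘(ℝ, EuclideanSpace ℝ (Fin n) × ℝ) (T ∘ χ) (χ.symm (q, t)) = _ :=
    mfderiv_comp _ (hT _).differentiableAt.mdifferentiableAt
      ((hχ.contMDiffAt hx).mdifferentiableAt (by simp))
  have h4 := mfderiv_eq_fderiv.trans (hT (χ (χ.symm (q, t)))).fderiv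
  refine h3.trans ?_
  rw [h4]
  rfl

variable [IsManifold (𝓡 (n + 1)) ∞ V]

/-- The chart of `T^* V × ℂ` induced by an adapted chart of `V`. The first coordinate is
`H - |z|² / 2 - ξ`, the second one is `t`, and the remaining ones are invariant under the circle. -/
noncomputable def ambientChart (χ : OpenPartialHomeomorph V (EuclideanSpace ℝ (Fin n) × ℝ))
    (hχ : IsAdaptedChart χ) (ξ : ℝ) :
    OpenPartialHomeomorph (Cotangent n V × ℂ) (ℝ × ℝ × CutModel n) :=
  ((cotangentLift χ hχ.toIsSmoothChart).prod (.refl ℂ)).transHomeomorph (cutShear n ξ)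

lemma mem_ambientChart_source {hχ : IsAdaptedChart χ} {ξ : ℝ} {p : Cotangent n V × ℂ} :
    p ∈ (ambientChart χ hχ ξ).source ↔ p.1.1 ∈ χ.source := by
  simp [ambientChart, cotangentLift]

lemma mem_ambientChart_target {hχ : IsAdaptedChart χ} {ξ k t : ℝ} {a : CutModel n} :
    (k, t, a) ∈ (ambientChart χ hχ ξ).target ↔ (a.1, t) ∈ χ.target := by
  simp [ambientChart, cotangentLift, cutShear]

lemma ambientChart_symm_apply (hχ : IsAdaptedChart χ) (ξ k t : ℝ) (a : CutModel n) :
    (ambientChart χ hχ ξ).symm (k, t, a) =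
      (cotangentLiftInv χ ((a.1, t), covectorOf a.2.1 (ξ + k + ‖a.2.2‖ ^ 2 / 2)),
        Circle.exp (-t) * a.2.2) := rfl

lemma contMDiffAt_ambientChart (hχ : IsAdaptedChart χ) (ξ : ℝ) {p : Cotangent n V × ℂ}
    (hp : p ∈ (ambientChart χ hχ ξ).source) :
    ContMDiffAt (cutAmbientModel n) 𝓘(ℝ, ℝ × ℝ × CutModel n) ∞ (ambientChart χ hχ ξ) p := by
  rw [mem_ambientChart_source] at hp
  have h1 : ContMDiffAt (cutAmbientModel n) _ ∞ (fun p : Cotangent n V × ℂ =>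
      cotangentLiftFun χ p.1) p :=
    (contMDiffAt_cotangentLiftFun hχ.toIsSmoothChart hp).comp p contMDiffAt_fst
  exact (contDiff_cutShear n ξ).contMDiff.contMDiffAt.comp p (h1.prodMk_space contMDiffAt_snd)

lemma contMDiffAt_ambientChart_symm (hχ : IsAdaptedChart χ) (ξ : ℝ) {y : ℝ × ℝ × CutModel n}
    (hy : y ∈ (ambientChart χ hχ ξ).target) :
    ContMDiffAt 𝓘(ℝ, ℝ × ℝ × CutModel n) (cutAmbientModel n) ∞ (ambientChart χ hχ ξ).symm y := by
  have h0 : ((cutShear n ξ).symm y).1.1 ∈ χ.target := mem_ambientChart_target.1 hy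
  have h1 := (contDiff_cutShear_symm n ξ).contMDiff.contMDiffAt (x := y)
  have h2 : ContMDiffAt 𝓘(ℝ, ℝ × ℝ × CutModel n) 𝓘(ℝ, _) ∞
      (fun y => ((cutShear n ξ).symm y).1) y :=
    (contDiff_fst.comp (contDiff_cutShear_symm n ξ)).contMDiff.contMDiffAt
  have h3 : ContMDiffAt 𝓘(ℝ, ℝ × ℝ × CutModel n) 𝓘(ℝ, ℂ) ∞
      (fun y => ((cutShear n ξ).symm y).2) y :=
    (contDiff_snd.comp (contDiff_cutShear_symm n ξ)).contMDiff.contMDiffAt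
  exact ((contMDiffAt_cotangentLiftInv hχ.toIsSmoothChart h0).comp y h2).prodMk h3

lemma ambientChart_fst (hχ : IsAdaptedChart χ) (ξ : ℝ) {p : Cotangent n V × ℂ}
    (hp : p ∈ (ambientChart χ hχ ξ).source) :
    (ambientChart χ hχ ξ p).1 = cutHamiltonian p - ξ := by
  rw [mem_ambientChart_source] at hp
  rw [cutHamiltonian, hχ.cotangentHamiltonian_eq hp]
  rfl

lemma cutHamiltonian_ambientChart_symm (hχ : IsAdaptedChart χ) (ξ : ℝ) {k t : ℝ} {a : CutModel n}
    (ha : (a.1, t) ∈ χ.target) : cutHamiltonian ((ambientChart χ hχ ξ).symm (k, t, a)) = k + ξ := by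
  have h0 := mem_ambientChart_target (hχ := hχ) (ξ := ξ) (k := k).2 ha
  have h := ambientChart_fst hχ ξ ((ambientChart χ hχ ξ).map_target h0)
  rw [(ambientChart χ hχ ξ).right_inv h0] at h
  linarith

variable [ContMDiffSMul (𝓡 1) (𝓡 (n + 1)) ∞ Circle V]

/-- In the chart induced by an adapted chart, the circle acts by translations of `t`. -/
lemma ambientChart_symm_eq_cutAct (hχ : IsAdaptedChart χ) (ξ k : ℝ) {t : ℝ} {a : CutModel n}
    (ha : (a.1, t) ∈ χ.target) :
    (ambientChart χ hχ ξ).symm (k, t, a) =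
      cutAct (Circle.exp t) ((ambientChart χ hχ ξ).symm (k, 0, a)) := by
  have ha0 : (a.1, (0 : ℝ)) ∈ χ.target := ((hχ.mem_target_iff _ _).1 ha).1
  simp only [ambientChart_symm_apply, cutAct]
  refine Prod.ext ?_ ?_
  · simp only
    rw [cotangentAct_cotangentLiftInv hχ.toIsSmoothChart _ ha0]
    have h1 : (translateChart (n := n) (Circle.exp t) χ).symm (a.1, 0) = χ.symm (a.1, t) := by
      rw [translateChart_symm_apply, ← hχ.symm_eq_smul _ _ ha]
    refine Cotangent.mk_congr h1.symm _ _ ?_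
    simp only
    rw [h1, hχ.mfderiv_translateChart ha]
  · simp only [neg_zero, Circle.exp_zero, Circle.coe_one, one_mul, Circle.exp_neg,
      Circle.coe_inv_eq_conj]

end AmbientChart

/-! ### The symplectic form in the induced charts -/

section StandardForm

/-- The symplectic form `∑ dpᵢ ∧ dqᵢ + dx ∧ dy` on `ℝⁿ × ℝⁿ × ℂ`. -/
noncomputable def cutModelForm (n : ℕ) : CutModel n [⋀^Fin 2]→L[ℝ] ℝ where
  toFun v := inner ℝ (v 0).2.1 (v 1).1 - inner ℝ (v 1).2.1 (v 0).1 +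
    ((v 0).2.2.re * (v 1).2.2.im - (v 0).2.2.im * (v 1).2.2.re)
  map_update_add' := by
    intro _ m i x y
    fin_cases i <;> simp [Function.update, inner_add_left, inner_add_right] <;> ring
  map_update_smul' := by
    intro _ m i c x
    fin_cases i <;> simp [Function.update, inner_smul_left, inner_smul_right] <;> ring
  cont := by fun_prop
  map_eq_zero_of_eq' := by
    intro v i j h hij
    have h01 : v 0 = v 1 := by
      fin_cases i <;> fin_cases j <;> simp_all
    rw [h01]; ring

lemma cutModelForm_apply {n : ℕ} (a b : CutModel n) :
    cutModelForm n ![a, b] = inner ℝ a.2.1 b.1 - inner ℝ b.2.1 a.1 +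
      (a.2.2.re * b.2.2.im - a.2.2.im * b.2.2.re) := rfl

/-- The compatible complex structure `(q, p, w) ↦ (p, -q, i w)` on `ℝⁿ × ℝⁿ × ℂ`. -/
noncomputable def cutModelJ (n : ℕ) : CutModel n →L[ℝ] CutModel n :=
  (ContinuousLinearMap.fst ℝ _ _ ∘L ContinuousLinearMap.snd ℝ _ _).prod
    ((-ContinuousLinearMap.fst ℝ _ _).prod
      (Complex.I • (ContinuousLinearMap.snd ℝ _ _ ∘L ContinuousLinearMap.snd ℝ _ _)))

lemma cutModelJ_apply {n : ℕ} (a : CutModel n) :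
    cutModelJ n a = (a.2.1, -a.1, Complex.I * a.2.2) := rfl

lemma cutModelForm_self_J {n : ℕ} {a : CutModel n} (ha : a ≠ 0) :
    0 < cutModelForm n ![a, cutModelJ n a] := by
  obtain ⟨q, p, w⟩ := a
  have h : cutModelForm n ![(q, p, w), cutModelJ n (q, p, w)] =
      ‖p‖ ^ 2 + ‖q‖ ^ 2 + ‖w‖ ^ 2 := by
    rw [cutModelForm_apply, cutModelJ_apply]
    simp [Complex.sq_norm, Complex.normSq_apply]
  rw [h]
  by_contra! hle
  have h1 := sq_nonneg ‖p‖
  have h2 := sq_nonneg ‖q‖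
  have h3 := sq_nonneg ‖w‖
  have hp : ‖p‖ ^ 2 = 0 := by linarith
  have hq : ‖q‖ ^ 2 = 0 := by linarith
  have hw : ‖w‖ ^ 2 = 0 := by linarith
  simp only [ne_eq, OfNat.ofNat_ne_zero, not_false_eq_true, pow_eq_zero_iff, norm_eq_zero]
    at hp hq hw
  exact ha (by simp [hp, hq, hw])

lemma cutModelForm_nondegenerate {n : ℕ} {a : CutModel n}
    (h : ∀ b, cutModelForm n ![a, b] = 0) : a = 0 := by
  by_contra ha
  exact (cutModelForm_self_J ha).ne' (h _)

end StandardForm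

section AmbientForm
variable {n : ℕ} {V : Type*} [TopologicalSpace V]
  [ChartedSpace (EuclideanSpace ℝ (Fin (n + 1))) V] [IsManifold (𝓡 (n + 1)) ∞ V]
  [MulAction Circle V]
  {χ : OpenPartialHomeomorph V (EuclideanSpace ℝ (Fin n) × ℝ)}

/-- The Liouville form on the level `{H - |z|² / 2 = ξ}`, in coordinates `(t, q, p, w)`. -/
noncomputable def levelLiouville (n : ℕ) (ξ : ℝ) (y : ℝ × CutModel n) : ℝ × CutModel n →L[ℝ] ℝ :=
  innerSL ℝ y.2.2.1 ∘L (ContinuousLinearMap.fst ℝ _ _ ∘L ContinuousLinearMap.snd ℝ _ _) +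
    (ξ + ‖y.2.2.2‖ ^ 2 / 2) • ContinuousLinearMap.fst ℝ _ _

lemma fderiv_levelLiouville (ξ : ℝ) (y u v : ℝ × CutModel n) :
    DifferentiableAt ℝ (levelLiouville n ξ) y ∧
    fderiv ℝ (levelLiouville n ξ) y u v =
      inner ℝ u.2.2.1 v.2.1 + inner ℝ y.2.2.2 u.2.2.2 * v.1 := by
  let P : ℝ × CutModel n →L[ℝ] EuclideanSpace ℝ (Fin n) :=
    .comp (.fst ℝ _ _) (.comp (.snd ℝ _ _) (.snd ℝ _ _))
  let W : ℝ × CutModel n →L[ℝ] ℂ := .comp (.snd ℝ _ _) (.comp (.snd ℝ _ _) (.snd ℝ _ _))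
  let Q : ℝ × CutModel n →L[ℝ] EuclideanSpace ℝ (Fin n) := .comp (.fst ℝ _ _) (.snd ℝ _ _)
  have h3 := ((W.hasFDerivAt (x := y)).norm_sq.mul_const (2⁻¹ : ℝ)).const_add ξ
  have h4 := (((innerSL ℝ (E := EuclideanSpace ℝ (Fin n))).hasFDerivAt.comp y
    P.hasFDerivAt).clm_comp
    (hasFDerivAt_const Q y)).add
    (h3.smul_const (ContinuousLinearMap.fst ℝ ℝ (CutModel n)))
  have h5 : HasFDerivAt (levelLiouville n ξ) _ y := h4
  refine ⟨h5.differentiableAt, ?_⟩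
  rw [h5.fderiv]
  have h6 : innerSL ℝ u.2.2.1 v.2.1 = inner ℝ u.2.2.1 v.2.1 := rfl
  simp [P, W, Q]
  rw [h6]
  ring

lemma standardForm_apply (z a b : ℂ) :
    standardForm z ![a, b] = a.re * b.im - a.im * b.re := rfl

lemma standardForm_circle_mul (z : ℂ) (c : Circle) (a b : ℂ) :
    standardForm z ![(c : ℂ) * a, (c : ℂ) * b] = standardForm z ![a, b] := by
  have hc : (c : ℂ).re * (c : ℂ).re + (c : ℂ).im * (c : ℂ).im = 1 := by
    rw [← Complex.normSq_apply, Circle.normSq_coe]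
  simp only [standardForm_apply, Complex.mul_re, Complex.mul_im]
  linear_combination (a.re * b.im - a.im * b.re) * hc

/-- The derivative of `(t, w) ↦ exp (-i t) w`. -/
lemma hasFDerivAt_circleExp_neg_mul (y : ℝ × CutModel n) :
    HasFDerivAt (fun y : ℝ × CutModel n => (Circle.exp (-y.1) : ℂ) * y.2.2.2)
      (((Circle.exp (-y.1) : ℂ)) • ((.comp (.snd ℝ _ _) (.comp (.snd ℝ _ _) (.snd ℝ _ _)) :
        ℝ × CutModel n →L[ℝ] ℂ) - (ContinuousLinearMap.fst ℝ ℝ (CutModel n)).smulRight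
          (Complex.I * y.2.2.2))) y := by
  let W : ℝ × CutModel n →L[ℝ] ℂ := .comp (.snd ℝ _ _) (.comp (.snd ℝ _ _) (.snd ℝ _ _))
  let T : ℝ × CutModel n →L[ℝ] ℂ := .comp Complex.ofRealCLM (.fst ℝ _ _)
  have h1 := (((T.hasFDerivAt (x := y)).neg.mul_const Complex.I).cexp).mul (W.hasFDerivAt (x := y))
  have h2 : HasFDerivAt (fun y : ℝ × CutModel n => (Circle.exp (-y.1) : ℂ) * y.2.2.2) _ y :=
    h1.congr_of_eventuallyEq (.of_forall fun y => by simp [T, W, Complex.exp_neg])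
  refine h2.congr_fderiv (ContinuousLinearMap.ext fun v => ?_)
  simp [T, W, Complex.exp_neg]
  ring

/-- On the level `{H - |z|² / 2 = ξ}`, the form `ω_can ⊕ ω_std` is the standard form in the
coordinates `(q, p, w)`, and the coordinate `t` spans its kernel: the terms `d(|w|² / 2) ∧ dt`
coming from the Liouville form cancel those coming from `z = exp (-i t) w`. -/
lemma pullback_cutAmbientForm (hχ : IsAdaptedChart χ) (ξ : ℝ) {t : ℝ} {a : CutModel n}
    (ha : (a.1, t) ∈ χ.target) (u v : ℝ × CutModel n) :
    DForm.pullback 𝓘(ℝ, ℝ × CutModel n) (cutAmbientModel n)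
      (fun y : ℝ × CutModel n => (ambientChart χ hχ ξ).symm (0, y)) (cutAmbientForm n V) (t, a)
      ![u, v] =
    cutModelForm n ![u.2, v.2] := by
  set g : ℝ × CutModel n → Cotangent n V × ℂ := fun y => (ambientChart χ hχ ξ).symm (0, y) with hg
  have hopen : ∀ᶠ y : ℝ × CutModel n in 𝓝 (t, a), (y.2.1, y.1) ∈ χ.target := by
    have hc : Continuous fun y : ℝ × CutModel n => (y.2.1, y.1) := by fun_prop
    exact hc.continuousAt.preimage_mem_nhds (χ.open_target.mem_nhds ha)
  have hsm : ∀ y : ℝ × CutModel n, (y.2.1, y.1) ∈ χ.target →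
      ContMDiffAt 𝓘(ℝ, ℝ × CutModel n) (cutAmbientModel n) ∞ g y := fun y hy =>
    (contMDiffAt_ambientChart_symm hχ ξ (mem_ambientChart_target.2 hy)).comp y
      (contDiff_prodMk_right (0 : ℝ)).contMDiff.contMDiffAt
  have hsm1 : ∀ y : ℝ × CutModel n, (y.2.1, y.1) ∈ χ.target →
      ContMDiffAt 𝓘(ℝ, ℝ × CutModel n) (cotangentModel n) ∞ (fun y => (g y).1) y := fun y hy =>
    contMDiffAt_fst.comp y (hsm y hy)
  have hgd : MDifferentiableAt 𝓘(ℝ, ℝ × CutModel n) (cutAmbientModel n) g (t, a) :=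
    (hsm _ ha).mdifferentiableAt (by simp)
  have hz := hasFDerivAt_circleExp_neg_mul (t, a)
  have h1 : DForm.pullback 𝓘(ℝ, ℝ × CutModel n) (cutAmbientModel n) g (cutAmbientForm n V) (t, a) =
      DForm.pullback 𝓘(ℝ, ℝ × CutModel n) (cotangentModel n) (fun y => (g y).1)
        (canonicalForm n V) (t, a) + DForm.pullback 𝓘(ℝ, ℝ × CutModel n) 𝓘(ℝ, ℂ)
        (fun y => (g y).2) standardForm (t, a) := by
    have e1 := DForm.pullback_comp (f := g) (g := Prod.fst) (x := (t, a))
      (I'' := cotangentModel n)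
      mdifferentiableAt_fst hgd (canonicalForm n V)
    have e2 := DForm.pullback_comp (f := g) (g := Prod.snd) (x := (t, a)) (I'' := 𝓘(ℝ, ℂ))
      mdifferentiableAt_snd hgd standardForm
    exact (congrArg₂ (· + ·) e1 e2).symm
  -- The Liouville form pulls back to `levelLiouville`, whose exterior derivative is computed next.
  have h2 : (fun y' => (ContinuousAlternatingMap.ofSubsingletonLIE (0 : Fin 1)
      (liouvillePullback (fun y => (g y).1) y') : (ℝ × CutModel n) [⋀^Fin 1]→L[ℝ] ℝ)) =ᶠ[𝓝 (t, a)]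
      fun y' => ContinuousAlternatingMap.ofSubsingletonLIE (0 : Fin 1) (levelLiouville n ξ y') := by
    filter_upwards [hopen] with y hy
    congr 1
    let T : ℝ × CutModel n →L[ℝ] EuclideanSpace ℝ (Fin n) × ℝ :=
      .prod (.comp (.fst ℝ _ _) (.snd ℝ _ _)) (.fst ℝ _ _)
    have e := liouvillePullback_cotangentLift hχ.toIsSmoothChart (q := T) (y := y)
      (p := fun y : ℝ × CutModel n => covectorOf y.2.2.1 (ξ + 0 + ‖y.2.2.2‖ ^ 2 / 2))
      T.differentiableAt hy
    refine Eq.trans e ?_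
    rw [T.fderiv]
    ext v <;> simp [T, levelLiouville]
  have h3 := pullback_canonicalForm (g := fun y => (g y).1) (hopen.mono hsm1)
  rw [h2.extDeriv_eq] at h3
  have hd := (fderiv_levelLiouville ξ (t, a) 0 0).1
  have h4 : ∀ u v, extDeriv (fun y' => (ContinuousAlternatingMap.ofSubsingletonLIE (0 : Fin 1)
      (levelLiouville n ξ y') : (ℝ × CutModel n) [⋀^Fin 1]→L[ℝ] ℝ)) (t, a) ![u, v] =
      fderiv ℝ (levelLiouville n ξ) (t, a) u v - fderiv ℝ (levelLiouville n ξ) (t, a) v u := by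
    intro u v
    rw [extDeriv_apply hd.ofSubsingletonLIE]
    have e : ∀ w : ℝ × CutModel n, (fun y => (ContinuousAlternatingMap.ofSubsingletonLIE (0 : Fin 1)
        (levelLiouville n ξ y) : (ℝ × CutModel n) [⋀^Fin 1]→L[ℝ] ℝ) ![w]) =
        fun y => levelLiouville n ξ y w := fun w => rfl
    have e0 : (0 : Fin 2).removeNth ![u, v] = ![v] := by ext i : 1; fin_cases i; rfl
    have e1 : (1 : Fin 2).removeNth ![u, v] = ![u] := by ext i : 1; fin_cases i; rfl
    have e2 : ∀ w, HasFDerivAt (fun y => levelLiouville n ξ y w)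
        ((fderiv ℝ (levelLiouville n ξ) (t, a)).flip w) (t, a) := fun w => by
      have := hd.hasFDerivAt.clm_apply (hasFDerivAt_const w (t, a))
      simpa using this
    rw [Fin.sum_univ_two, e0, e1, e, e, (e2 v).fderiv, (e2 u).fderiv]
    simp [sub_eq_add_neg]
  have h5 : DForm.pullback 𝓘(ℝ, ℝ × CutModel n) 𝓘(ℝ, ℂ) (fun y => (g y).2) standardForm (t, a)
      ![u, v] = standardForm (g (t, a)).2 ![u.2.2.2 - (u.1 : ℂ) * (Complex.I * a.2.2),
        v.2.2.2 - (v.1 : ℂ) * (Complex.I * a.2.2)] := by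
    rw [← standardForm_circle_mul _ (Circle.exp (-t))]
    have e : ∀ w : ℝ × CutModel n, (mfderiv 𝓘(ℝ, ℝ × CutModel n) 𝓘(ℝ, ℂ)
        (fun y => (g y).2) (t, a) w : ℂ) =
        (Circle.exp (-t) : ℂ) * (w.2.2.2 - (w.1 : ℂ) * (Complex.I * a.2.2)) := by
      intro w
      refine (DFunLike.congr_fun (mfderiv_eq_fderiv.trans hz.fderiv) w).trans ?_
      change (Circle.exp (-t) : ℂ) * (w.2.2.2 - w.1 • (Complex.I * a.2.2)) = _
      rw [Complex.real_smul]
    rw [← e, ← e]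
    exact DForm.pullback_apply_pair _ _ _ _ _
  rw [h1]
  refine (congrArg₂ (· + ·) ((DFunLike.congr_fun h3 ![u, v]).trans (h4 u v)) h5).trans ?_
  rw [(fderiv_levelLiouville ξ (t, a) u v).2, (fderiv_levelLiouville ξ (t, a) v u).2,
    standardForm_apply, cutModelForm_apply]
  simp
  ring

end AmbientForm

/-! ### Existence of adapted charts -/

section AdaptedChart

lemma continuous_circle_coe : Continuous ((↑) : Circle → ℂ) := continuous_subtype_val

/-- The angular coordinate `u ↦ arg (u / τ) ∈ (-π, π)` on the circle. -/
noncomputable def circleArgChart (τ : Circle) : OpenPartialHomeomorph Circle ℝ where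
  toFun u := Complex.arg ((u * τ⁻¹ : Circle) : ℂ)
  invFun t := Circle.exp t * τ
  source := {u | ((u * τ⁻¹ : Circle) : ℂ) ∈ Complex.slitPlane}
  target := Ioo (-Real.pi) Real.pi
  map_source' u hu := ⟨Complex.neg_pi_lt_arg _,
    (Complex.arg_le_pi _).lt_of_ne (Complex.mem_slitPlane_iff_arg.1 hu).1⟩
  map_target' t ht := by
    have h : Circle.exp t * τ * τ⁻¹ = Circle.exp t := by group
    simp only [mem_ofPred_eq, h]
    refine Complex.mem_slitPlane_iff_arg.2 ⟨?_, Circle.coe_ne_zero _⟩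
    rw [Circle.arg_exp ht.1 ht.2.le]
    exact ht.2.ne
  left_inv' u _ := by simp only [Circle.exp_arg]; group
  right_inv' t ht := by
    have h : Circle.exp t * τ * τ⁻¹ = Circle.exp t := by group
    simp only [h, Circle.arg_exp ht.1 ht.2.le]
  open_source := Complex.isOpen_slitPlane.preimage
    (continuous_circle_coe.comp (continuous_id.mul continuous_const))
  open_target := isOpen_Ioo
  continuousOn_toFun u hu := (ContinuousAt.comp (f := fun u : Circle =>
      ((u * τ⁻¹ : Circle) : ℂ)) (Complex.continuousAt_arg hu) (continuous_circle_coe.comp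
        (continuous_id.mul continuous_const)).continuousAt).continuousWithinAt
  continuousOn_invFun := ((Circle.exp.continuous).mul continuous_const).continuousOn

lemma contMDiffOn_circleArgChart (τ : Circle) :
    ContMDiffOn (𝓡 1) 𝓘(ℝ, ℝ) ∞ (circleArgChart τ) (circleArgChart τ).source := by
  intro u hu
  have := finrank_real_complex_fact'
  have h1 : ContMDiffAt (𝓡 1) 𝓘(ℝ, ℂ) ∞ (fun u : Circle => ((u * τ⁻¹ : Circle) : ℂ)) u :=
    (contMDiff_coe_sphere (n := 1) (E := ℂ)).contMDiffAt.comp u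
      ((contMDiff_mul_right (I := 𝓡 1) (a := τ⁻¹) (n := ∞)).contMDiffAt (x := u))
  have h2 : ContDiffAt ℝ ∞ (fun z => (Complex.log z).im) ((u * τ⁻¹ : Circle) : ℂ) :=
    Complex.imCLM.contDiff.contDiffAt.comp _ ((Complex.contDiffAt_log hu).restrict_scalars ℝ)
  exact ((h2.contMDiffAt.comp u h1).congr_of_eventuallyEq
    (.of_forall fun u => (Complex.log_im _).symm)).contMDiffWithinAt

lemma contMDiff_circleArgChart_symm (τ : Circle) :
    ContMDiff 𝓘(ℝ, ℝ) (𝓡 1) ∞ (circleArgChart τ).symm :=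
  (contMDiff_mul_right (I := 𝓡 1) (a := τ) (n := ∞)).comp contMDiff_circleExp

variable {n : ℕ} {V : Type*} [TopologicalSpace V]
  [ChartedSpace (EuclideanSpace ℝ (Fin (n + 1))) V]
  [MulAction Circle V]
  {B : Type*} [TopologicalSpace B] [ChartedSpace (EuclideanSpace ℝ (Fin n)) B]
  [IsManifold (𝓡 n) ∞ B]

/-- A local trivialisation, a chart of the base and the angular coordinate of the circle make up an
adapted chart. -/
lemma IsPrincipalCircleBundle.hasAdaptedCharts {π : V → B} (hπ : IsPrincipalCircleBundle n π) :
    HasAdaptedCharts n V := by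
  intro x₀
  obtain ⟨U, hU, hbU, Φ, hs, ht, hΦ, hΦs, hΦe⟩ := hπ.locally_trivial (π x₀)
  set ψ := chartAt (EuclideanSpace ℝ (Fin n)) (π x₀)
  set τ := (Φ x₀).2 with hτ
  have hx₀ : x₀ ∈ Φ.source := hs ▸ hbU
  let χ : OpenPartialHomeomorph V (EuclideanSpace ℝ (Fin n) × ℝ) :=
    Φ.trans (ψ.prod (circleArgChart τ))
  have hsymm : ∀ q t, χ.symm (q, t) = Φ.symm (ψ.symm q, Circle.exp t * τ) := fun _ _ => rfl
  have htarget : ∀ q t, (q, t) ∈ χ.target ↔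
      (q ∈ ψ.target ∧ t ∈ Ioo (-Real.pi) Real.pi) ∧ ψ.symm q ∈ U := by
    intro q t
    have h : (q, t) ∈ χ.target ↔ (q ∈ ψ.target ∧ t ∈ Ioo (-Real.pi) Real.pi) ∧
        (ψ.symm q, Circle.exp t * τ) ∈ Φ.target := Iff.rfl
    rw [h, ht]
    simp
  have hsmul : ∀ (u : Circle) b s, b ∈ U → u • Φ.symm (b, s) = Φ.symm (b, u * s) := by
    intro u b s hb
    have h1 : (b, s) ∈ Φ.target := ht ▸ ⟨hb, trivial⟩
    have h2 := Φ.map_target h1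
    have h3 : u • Φ.symm (b, s) ∈ Φ.source := by
      rw [hs, mem_preimage, hπ.smul_fibre]
      rwa [hs] at h2
    rw [← Φ.left_inv h3, (hΦe _ h2).2 u, Φ.right_inv h1]
  refine ⟨χ, ⟨⟨?_, ?_⟩, ?_, ?_, ?_⟩, ?_⟩
  · have h1 : ContMDiffOn ((𝓡 n).prod (𝓡 1)) 𝓘(ℝ, EuclideanSpace ℝ (Fin n) × ℝ) ∞
        (ψ.prod (circleArgChart τ)) (ψ.prod (circleArgChart τ)).source := by
      refine ContMDiffOn.prodMk_space ?_ ?_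
      · exact (contMDiffOn_chart (I := 𝓡 n)).comp contMDiffOn_fst fun y hy => hy.1
      · exact (contMDiffOn_circleArgChart τ).comp contMDiffOn_snd fun y hy => hy.2
    exact h1.comp (hΦ.mono fun x hx => hx.1) fun x hx => hx.2
  · have h1 : ContMDiffOn 𝓘(ℝ, EuclideanSpace ℝ (Fin n) × ℝ) ((𝓡 n).prod (𝓡 1)) ∞
        (ψ.prod (circleArgChart τ)).symm (ψ.prod (circleArgChart τ)).target := by
      refine ContMDiffOn.prodMk ?_ ?_
      · exact (contMDiffOn_chart_symm (I := 𝓡 n)).comp contDiff_fst.contMDiff.contMDiffOn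
          fun y hy => hy.1
      · exact ((contMDiff_circleArgChart_symm τ).comp contDiff_snd.contMDiff).contMDiffOn
    exact hΦs.comp (h1.mono fun y hy => hy.1) fun y hy => hy.2
  · intro q t
    rw [htarget, htarget]
    have h0 : (0 : ℝ) ∈ Ioo (-Real.pi) Real.pi := ⟨neg_lt_zero.2 Real.pi_pos, Real.pi_pos⟩
    tauto
  · intro q t h
    rw [hsymm, hsymm, hsmul _ _ _ ((htarget _ _).1 h).2]
    simp
  · intro q q' u h h' hu
    have hq := (htarget _ _).1 h
    have hq' := (htarget _ _).1 h'
    rw [hsymm, hsymm, hsmul _ _ _ hq.2] at hu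
    have h1 := Φ.symm.injOn (show _ ∈ Φ.target from ht ▸ ⟨hq.2, trivial⟩)
      (show _ ∈ Φ.target from ht ▸ ⟨hq'.2, trivial⟩) hu
    simp only [Circle.exp_zero, one_mul, Prod.mk.injEq, mul_eq_right] at h1
    exact ⟨ψ.symm.injOn hq.1.1 hq'.1.1 h1.1, h1.2⟩
  · have h1 : (Φ x₀).1 = π x₀ := (hΦe x₀ hx₀).1
    refine ⟨hx₀, ?_, ?_⟩
    · change (Φ x₀).1 ∈ ψ.source
      rw [h1]
      exact mem_chart_source _ _
    · change (((Φ x₀).2 * τ⁻¹ : Circle) : ℂ) ∈ Complex.slitPlane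
      simp [← hτ]

end AdaptedChart

/-! ### Charts of the level and of the symplectic cut -/

section CutDomain
variable {n : ℕ} {V : Type*} [TopologicalSpace V]
  {χ : OpenPartialHomeomorph V (EuclideanSpace ℝ (Fin n) × ℝ)}

/-- The domain of the parametrisation of the symplectic cut induced by an adapted chart. -/
def cutDomain (χ : OpenPartialHomeomorph V (EuclideanSpace ℝ (Fin n) × ℝ)) : Set (CutModel n) :=
  {a | (a.1, (0 : ℝ)) ∈ χ.target}

lemma isOpen_cutDomain : IsOpen (cutDomain χ) := χ.open_target.preimage (by fun_prop)

end CutDomain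

section Level
variable {n : ℕ} {V : Type*} [TopologicalSpace V]
  [ChartedSpace (EuclideanSpace ℝ (Fin (n + 1))) V] [MulAction Circle V] {ξ : ℝ}
  {χ : OpenPartialHomeomorph V (EuclideanSpace ℝ (Fin n) × ℝ)}

lemma CutLevel.incl_injective :
    Function.Injective (CutLevel.incl : CutLevel n V ξ → Cotangent n V × ℂ) :=
  Subtype.val_injective

lemma CutLevel.cutHamiltonian_incl (p : CutLevel n V ξ) : cutHamiltonian p.incl = ξ := p.2

variable [IsManifold (𝓡 (n + 1)) ∞ V]

lemma CutLevel.isEmbedding_incl :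
    Topology.IsEmbedding (CutLevel.incl : CutLevel n V ξ → Cotangent n V × ℂ) :=
  Topology.IsEmbedding.subtypeVal

/-- A point of `T^* V × ℂ` at which `H - |z|² / 2 = ξ`, as a point of the level. -/
def CutLevel.ofEq (p : Cotangent n V × ℂ) (hp : cutHamiltonian p = ξ) : CutLevel n V ξ := ⟨p, hp⟩

open Classical in
/-- The inverse of the chart `(t, q, p, w)` of the level `{H - |z|² / 2 = ξ}` induced by an adapted
chart, with an arbitrary value outside the target of the chart. -/
noncomputable def levelParam (χ : OpenPartialHomeomorph V (EuclideanSpace ℝ (Fin n) × ℝ))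
    (hχ : IsAdaptedChart χ) (ξ : ℝ) [Nonempty (CutLevel n V ξ)] (y : ℝ × CutModel n) :
    CutLevel n V ξ :=
  if h : (y.2.1, y.1) ∈ χ.target then
    CutLevel.ofEq ((ambientChart χ hχ ξ).symm (0, y.1, y.2))
      ((cutHamiltonian_ambientChart_symm hχ ξ h).trans (zero_add ξ))
  else Classical.arbitrary _

lemma incl_levelParam {hχ : IsAdaptedChart χ} [Nonempty (CutLevel n V ξ)] {y : ℝ × CutModel n}
    (hy : (y.2.1, y.1) ∈ χ.target) :
    (levelParam χ hχ ξ y).incl = (ambientChart χ hχ ξ).symm (0, y) := by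
  rw [levelParam, dif_pos hy]
  rfl

/-- The chart `(t, q, p, w)` of the level `{H - |z|² / 2 = ξ}` induced by an adapted chart. -/
noncomputable def levelChart (χ : OpenPartialHomeomorph V (EuclideanSpace ℝ (Fin n) × ℝ))
    (hχ : IsAdaptedChart χ) (ξ : ℝ) [Nonempty (CutLevel n V ξ)] :
    OpenPartialHomeomorph (CutLevel n V ξ) (ℝ × CutModel n) where
  toFun p := (ambientChart χ hχ ξ p.incl).2
  invFun := levelParam χ hχ ξ
  source := CutLevel.incl ⁻¹' (ambientChart χ hχ ξ).source
  target := (fun y : ℝ × CutModel n => (y.2.1, y.1)) ⁻¹' χ.target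
  map_source' p hp :=
    (mem_ambientChart_target (hχ := hχ) (ξ := ξ)).1 ((ambientChart χ hχ ξ).map_source hp)
  map_target' y hy := by
    rw [mem_preimage, incl_levelParam hy]
    exact (ambientChart χ hχ ξ).map_target ((mem_ambientChart_target (hχ := hχ) (ξ := ξ)).2 hy)
  left_inv' p hp := by
    have h1 := (mem_ambientChart_target (hχ := hχ) (ξ := ξ)).1 ((ambientChart χ hχ ξ).map_source hp)
    have h2 : (0, (ambientChart χ hχ ξ p.incl).2) = ambientChart χ hχ ξ p.incl :=
      Prod.ext (by rw [ambientChart_fst hχ ξ hp, p.cutHamiltonian_incl, sub_self]) rfl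
    apply CutLevel.incl_injective
    rw [incl_levelParam h1, h2]
    exact (ambientChart χ hχ ξ).left_inv hp
  right_inv' y hy := by
    rw [incl_levelParam hy]
    exact congrArg Prod.snd ((ambientChart χ hχ ξ).right_inv
      ((mem_ambientChart_target (hχ := hχ) (ξ := ξ)).2 hy))
  open_source := (ambientChart χ hχ ξ).open_source.preimage CutLevel.isEmbedding_incl.continuous
  open_target := χ.open_target.preimage (by fun_prop)
  continuousOn_toFun := continuous_snd.comp_continuousOn
    ((ambientChart χ hχ ξ).continuousOn.comp CutLevel.isEmbedding_incl.continuous.continuousOn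
      fun _ hp => hp)
  continuousOn_invFun := by
    rw [CutLevel.isEmbedding_incl.continuousOn_iff]
    exact ((ambientChart χ hχ ξ).symm.continuousOn.comp
      (f := fun y : ℝ × CutModel n => ((0 : ℝ), y)) (by fun_prop)
      fun y hy => (mem_ambientChart_target (hχ := hχ) (ξ := ξ)).2 hy).congr
      fun y hy => incl_levelParam hy

variable [Nonempty (CutLevel n V ξ)]

lemma levelChart_apply (hχ : IsAdaptedChart χ) (p : CutLevel n V ξ) :
    levelChart χ hχ ξ p = (ambientChart χ hχ ξ p.incl).2 := rfl

lemma mem_levelChart_source {hχ : IsAdaptedChart χ} {p : CutLevel n V ξ} :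
    p ∈ (levelChart χ hχ ξ).source ↔ p.incl.1.1 ∈ χ.source :=
  mem_ambientChart_source (hχ := hχ) (ξ := ξ)

lemma mem_levelChart_target {hχ : IsAdaptedChart χ} {y : ℝ × CutModel n} :
    y ∈ (levelChart χ hχ ξ).target ↔ (y.2.1, y.1) ∈ χ.target := Iff.rfl

lemma incl_levelChart_symm {hχ : IsAdaptedChart χ} {y : ℝ × CutModel n}
    (hy : y ∈ (levelChart χ hχ ξ).target) :
    ((levelChart χ hχ ξ).symm y).incl = (ambientChart χ hχ ξ).symm (0, y) :=
  incl_levelParam (mem_levelChart_target.1 hy)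

lemma zero_mem_levelChart_target {hχ : IsAdaptedChart χ} {a : CutModel n} (ha : a ∈ cutDomain χ) :
    (0, a) ∈ (levelChart χ hχ ξ).target := mem_levelChart_target.2 ha

lemma snd_mem_cutDomain {hχ : IsAdaptedChart χ} {y : ℝ × CutModel n}
    (hy : y ∈ (levelChart χ hχ ξ).target) : y.2 ∈ cutDomain χ :=
  ((hχ.mem_target_iff _ _).1 (mem_levelChart_target.1 hy)).1

end Level

section CutTopology
variable {n : ℕ} {V : Type*} [TopologicalSpace V]
  [ChartedSpace (EuclideanSpace ℝ (Fin (n + 1))) V]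
  [MulAction Circle V] [ContMDiffSMul (𝓡 1) (𝓡 (n + 1)) ∞ Circle V]

/-- The fundamental vector field is invariant, since the circle is commutative. -/
lemma circleVectorField_smul (u : Circle) (x : V) :
    circleVectorField (𝓡 (n + 1)) (u • x) =
      (mfderiv (𝓡 (n + 1)) (𝓡 (n + 1)) (fun y : V => u • y) x :
        EuclideanSpace ℝ (Fin (n + 1)) →L[ℝ] EuclideanSpace ℝ (Fin (n + 1)))
        (circleVectorField (𝓡 (n + 1)) x) := by
  have h1 : ContMDiff 𝓘(ℝ, ℝ) (𝓡 (n + 1)) ∞ (fun t : ℝ => Circle.exp t • x) :=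
    contMDiff_circleExp.smul contMDiff_const
  have h2 : (fun t : ℝ => Circle.exp t • (u • x)) =
      (fun y : V => u • y) ∘ (fun t : ℝ => Circle.exp t • x) :=
    funext fun t => smul_comm _ _ _
  have h3 : mfderiv 𝓘(ℝ, ℝ) (𝓡 (n + 1)) ((fun y : V => u • y) ∘
      (fun t : ℝ => Circle.exp t • x)) 0 = _ :=
    mfderiv_comp (0 : ℝ) (mdifferentiableAt_smul_circle u _) (h1.mdifferentiable (by simp) 0)
  have h4 : ∀ y, y = x →
      (mfderiv (𝓡 (n + 1)) (𝓡 (n + 1)) (fun y : V => u • y) y :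
        EuclideanSpace ℝ (Fin (n + 1)) →L[ℝ] EuclideanSpace ℝ (Fin (n + 1))) =
      mfderiv (𝓡 (n + 1)) (𝓡 (n + 1)) (fun y : V => u • y) x := by rintro _ rfl; rfl
  have h5 := h4 (Circle.exp 0 • x) (by simp)
  rw [circleVectorField, h2, h3]
  exact DFunLike.congr_fun h5 _

lemma cotangentHamiltonian_cotangentAct (u : Circle) (p : Cotangent n V) :
    cotangentHamiltonian (cotangentAct u p) = cotangentHamiltonian p := by
  rw [cotangentAct_eq]
  refine (congrArg (fun v => p.2 ((mfderiv (𝓡 (n + 1)) (𝓡 (n + 1))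
    (fun y : V => u⁻¹ • y) (u • p.1) :
    EuclideanSpace ℝ (Fin (n + 1)) →L[ℝ] EuclideanSpace ℝ (Fin (n + 1))) v))
    (circleVectorField_smul u p.1)).trans ?_
  exact congrArg p.2 (DFunLike.congr_fun (mfderiv_smul_comp (n := n) (inv_mul_cancel u)
    (x := p.1) rfl) (circleVectorField (𝓡 (n + 1)) p.1))

lemma cutHamiltonian_cutAct (u : Circle) (p : Cotangent n V × ℂ) :
    cutHamiltonian (cutAct u p) = cutHamiltonian p := by
  simp only [cutHamiltonian, cutAct, cotangentHamiltonian_cotangentAct, norm_mul, RCLike.norm_conj,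
    Circle.norm_coe, one_mul]

variable [IsManifold (𝓡 (n + 1)) ∞ V] {ξ : ℝ}

lemma SymplecticCut.mk_eq_mk {p q : CutLevel n V ξ} :
    SymplecticCut.mk p = SymplecticCut.mk q ↔ ∃ u : Circle, q.incl = cutAct u p.incl :=
  Quotient.eq (r := cutLevelSetoid n V ξ)

lemma SymplecticCut.mk_surjective :
    Function.Surjective (SymplecticCut.mk : CutLevel n V ξ → SymplecticCut n V ξ) :=
  Quotient.mk_surjective

lemma SymplecticCut.continuous_mk :
    Continuous (SymplecticCut.mk : CutLevel n V ξ → SymplecticCut n V ξ) :=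
  continuous_quotient_mk'

lemma SymplecticCut.isOpenMap_mk :
    IsOpenMap (SymplecticCut.mk : CutLevel n V ξ → SymplecticCut n V ξ) := by
  intro O hO
  have h1 : IsOpen ((SymplecticCut.mk : CutLevel n V ξ → SymplecticCut n V ξ) ⁻¹'
      (SymplecticCut.mk '' O)) := by
    obtain ⟨O', hO', rfl⟩ := CutLevel.isEmbedding_incl.isOpen_iff.1 hO
    have h2 : (SymplecticCut.mk : CutLevel n V ξ → SymplecticCut n V ξ) ⁻¹'
        (SymplecticCut.mk '' (CutLevel.incl ⁻¹' O')) =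
        ⋃ u : Circle, CutLevel.incl ⁻¹' (cutAct u ⁻¹' O') := by
      ext p
      simp only [mem_preimage, mem_image, mem_iUnion]
      constructor
      · rintro ⟨q, hq, hqp⟩
        obtain ⟨u, hu⟩ := SymplecticCut.mk_eq_mk.1 hqp.symm
        exact ⟨u, hu ▸ hq⟩
      · rintro ⟨u, hu⟩
        refine ⟨⟨cutAct u p.incl, ?_⟩, hu, (SymplecticCut.mk_eq_mk.2 ⟨u, rfl⟩).symm⟩
        rw [cutHamiltonian_cutAct, p.cutHamiltonian_incl]
    rw [h2]
    exact isOpen_iUnion fun u => (hO'.preimage (contMDiff_cutAct u).continuous).preimage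
      CutLevel.isEmbedding_incl.continuous
  exact isQuotientMap_quotient_mk'.isOpen_preimage.1 h1

variable {χ : OpenPartialHomeomorph V (EuclideanSpace ℝ (Fin n) × ℝ)}

section
variable [Nonempty (CutLevel n V ξ)]

/-- The orbits of the level are the lines in the direction of `t`. -/
lemma mk_levelChart_symm {hχ : IsAdaptedChart χ} {y : ℝ × CutModel n}
    (hy : y ∈ (levelChart χ hχ ξ).target) :
    SymplecticCut.mk ((levelChart χ hχ ξ).symm y) =
      SymplecticCut.mk ((levelChart χ hχ ξ).symm (0, y.2)) := by
  have hy0 : (0, y.2) ∈ (levelChart χ hχ ξ).target :=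
    mem_levelChart_target.2 ((hχ.mem_target_iff _ _).1 (mem_levelChart_target.1 hy)).1
  refine (SymplecticCut.mk_eq_mk.2 ⟨Circle.exp y.1, ?_⟩).symm
  rw [incl_levelChart_symm hy, incl_levelChart_symm hy0]
  exact ambientChart_symm_eq_cutAct hχ ξ 0 hy

/-- The parametrisation `(q, p, w) ↦ [t = 0, q, p, w]` of the symplectic cut. -/
noncomputable def cutParam (χ : OpenPartialHomeomorph V (EuclideanSpace ℝ (Fin n) × ℝ))
    (hχ : IsAdaptedChart χ) (ξ : ℝ) [Nonempty (CutLevel n V ξ)] (a : CutModel n) :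
    SymplecticCut n V ξ :=
  SymplecticCut.mk ((levelChart χ hχ ξ).symm (0, a))

lemma mk_eq_cutParam {hχ : IsAdaptedChart χ} {p : CutLevel n V ξ}
    (hp : p ∈ (levelChart χ hχ ξ).source) :
    SymplecticCut.mk p = cutParam χ hχ ξ (levelChart χ hχ ξ p).2 := by
  rw [cutParam, ← mk_levelChart_symm ((levelChart χ hχ ξ).map_source hp),
    (levelChart χ hχ ξ).left_inv hp]

lemma injOn_cutParam (hχ : IsAdaptedChart χ) : InjOn (cutParam χ hχ ξ) (cutDomain χ) := by
  intro a ha b hb hab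
  obtain ⟨u, hu⟩ := SymplecticCut.mk_eq_mk.1 hab
  rw [incl_levelChart_symm (zero_mem_levelChart_target ha),
    incl_levelChart_symm (zero_mem_levelChart_target hb)] at hu
  have h1 : χ.symm (b.1, 0) = u • χ.symm (a.1, 0) := congrArg (fun p => p.1.1) hu
  obtain ⟨-, rfl⟩ := hχ.free _ _ u ha hb h1.symm
  rw [cutAct_one] at hu
  have h2 := (ambientChart χ hχ ξ).symm.injOn ((mem_ambientChart_target (hχ := hχ) (ξ := ξ)).2 hb)
    ((mem_ambientChart_target (hχ := hχ) (ξ := ξ)).2 ha) hu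
  simp only [Prod.mk.injEq, true_and] at h2
  exact h2.symm

lemma continuousOn_cutParam (hχ : IsAdaptedChart χ) :
    ContinuousOn (cutParam χ hχ ξ) (cutDomain χ) :=
  SymplecticCut.continuous_mk.comp_continuousOn
    ((levelChart χ hχ ξ).symm.continuousOn.comp (by fun_prop)
      fun _ ha => zero_mem_levelChart_target (hχ := hχ) (ξ := ξ) ha)

lemma isOpen_image_cutParam (hχ : IsAdaptedChart χ) {O : Set (CutModel n)} (hO : IsOpen O)
    (hOD : O ⊆ cutDomain χ) : IsOpen (cutParam χ hχ ξ '' O) := by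
  have h : cutParam χ hχ ξ '' O = SymplecticCut.mk ''
      ((levelChart χ hχ ξ).source ∩ levelChart χ hχ ξ ⁻¹' (Prod.snd ⁻¹' O)) := by
    ext w
    constructor
    · rintro ⟨a, ha, rfl⟩
      have h0 := zero_mem_levelChart_target (ξ := ξ) (hχ := hχ) (hOD ha)
      refine ⟨_, ⟨(levelChart χ hχ ξ).map_target h0, ?_⟩, rfl⟩
      rw [mem_preimage, (levelChart χ hχ ξ).right_inv h0]
      exact ha
    · rintro ⟨p, ⟨hp, hpO⟩, rfl⟩
      exact ⟨_, hpO, (mk_eq_cutParam hp).symm⟩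
  rw [h]
  exact SymplecticCut.isOpenMap_mk _
    ((levelChart χ hχ ξ).isOpen_inter_preimage (hO.preimage continuous_snd))

/-- The chart `[x, φ, z] ↦ (q, p, w)` of the symplectic cut, inverse to `cutParam`. -/
noncomputable def cutChart (χ : OpenPartialHomeomorph V (EuclideanSpace ℝ (Fin n) × ℝ))
    (hχ : IsAdaptedChart χ) (ξ : ℝ) [Nonempty (CutLevel n V ξ)] :
    OpenPartialHomeomorph (SymplecticCut n V ξ) (CutModel n) :=
  (OpenPartialHomeomorph.ofContinuousOpenRestrict
    ((injOn_cutParam hχ).toPartialEquiv _ (cutDomain χ))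
    (continuousOn_cutParam hχ) (fun O hO => by
      have h : (cutDomain χ).domRestrict (cutParam χ hχ ξ) '' O =
          cutParam χ hχ ξ '' (Subtype.val '' O) := by
        rw [image_image]; rfl
      exact h ▸ isOpen_image_cutParam hχ (isOpen_cutDomain.isOpenMap_subtype_val O hO)
        (Subtype.coe_image_subset _ _)) isOpen_cutDomain).symm

lemma cutChart_symm_apply {hχ : IsAdaptedChart χ} (a : CutModel n) :
    (cutChart χ hχ ξ).symm a = cutParam χ hχ ξ a := rfl

lemma mk_mem_cutChart_source {hχ : IsAdaptedChart χ} {p : CutLevel n V ξ}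
    (hp : p ∈ (levelChart χ hχ ξ).source) : SymplecticCut.mk p ∈ (cutChart χ hχ ξ).source := by
  rw [mk_eq_cutParam hp, ← cutChart_symm_apply]
  exact (cutChart χ hχ ξ).map_target (snd_mem_cutDomain ((levelChart χ hχ ξ).map_source hp))

lemma cutChart_mk {hχ : IsAdaptedChart χ} {p : CutLevel n V ξ}
    (hp : p ∈ (levelChart χ hχ ξ).source) :
    cutChart χ hχ ξ (SymplecticCut.mk p) = (levelChart χ hχ ξ p).2 := by
  rw [mk_eq_cutParam hp, ← cutChart_symm_apply]
  exact (cutChart χ hχ ξ).right_inv (snd_mem_cutDomain ((levelChart χ hχ ξ).map_source hp))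

end

end CutTopology

/-! ### Smoothness of the coordinate changes -/

section Transitions
variable {n : ℕ} {V : Type*} [TopologicalSpace V]
  [ChartedSpace (EuclideanSpace ℝ (Fin (n + 1))) V]
  [MulAction Circle V]
  [IsManifold (𝓡 (n + 1)) ∞ V] {ξ : ℝ} [Nonempty (CutLevel n V ξ)]
  {χ χ' : OpenPartialHomeomorph V (EuclideanSpace ℝ (Fin n) × ℝ)}
  {hχ : IsAdaptedChart χ} {hχ' : IsAdaptedChart χ'}

lemma contDiffAt_levelChart_trans {y : ℝ × CutModel n} (hy : y ∈ (levelChart χ hχ ξ).target)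
    (hy' : (levelChart χ hχ ξ).symm y ∈ (levelChart χ' hχ' ξ).source) :
    ContDiffAt ℝ ∞ (levelChart χ' hχ' ξ ∘ (levelChart χ hχ ξ).symm) y := by
  have h0 : (0, y) ∈ (ambientChart χ hχ ξ).target :=
    (mem_ambientChart_target (hχ := hχ) (ξ := ξ)).2 (mem_levelChart_target.1 hy)
  have h1 : ((levelChart χ hχ ξ).symm y).incl = (ambientChart χ hχ ξ).symm (0, y) :=
    incl_levelChart_symm hy
  have h2 : (ambientChart χ hχ ξ).symm (0, y) ∈ (ambientChart χ' hχ' ξ).source := h1 ▸ hy'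
  have h3 : ContMDiffAt 𝓘(ℝ, ℝ × ℝ × CutModel n) 𝓘(ℝ, ℝ × ℝ × CutModel n) ∞
      (ambientChart χ' hχ' ξ ∘ (ambientChart χ hχ ξ).symm) (0, y) :=
    ContMDiffAt.comp (0, y) (contMDiffAt_ambientChart hχ' ξ h2)
      (contMDiffAt_ambientChart_symm hχ ξ h0)
  have h4 : ContDiffAt ℝ ∞ (fun y : ℝ × CutModel n => ((0 : ℝ), y)) y := by fun_prop
  have h5 := contDiffAt_snd.comp y (h3.contDiffAt.comp y h4)
  refine h5.congr_of_eventuallyEq ?_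
  filter_upwards [(levelChart χ hχ ξ).open_target.mem_nhds hy] with z hz
  simp only [Function.comp, levelChart_apply, incl_levelChart_symm hz]

variable [ContMDiffSMul (𝓡 1) (𝓡 (n + 1)) ∞ Circle V]

/-- Two adapted charts that meet an orbit of the level have a common point on that orbit: each of
them misses at most one point of the orbit. -/
lemma exists_mem_levelChart_source_inter {w : SymplecticCut n V ξ}
    (hw : w ∈ (cutChart χ hχ ξ).source) (hw' : w ∈ (cutChart χ' hχ' ξ).source) :
    ∃ p : CutLevel n V ξ, SymplecticCut.mk p = w ∧ p ∈ (levelChart χ hχ ξ).source ∧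
      p ∈ (levelChart χ' hχ' ξ).source := by
  obtain ⟨a, ha, rfl⟩ : ∃ a ∈ cutDomain χ, cutParam χ hχ ξ a = w :=
    ⟨_, (cutChart χ hχ ξ).map_source hw, (cutChart χ hχ ξ).left_inv hw⟩
  obtain ⟨b, hb, hba⟩ : ∃ b ∈ cutDomain χ', cutParam χ' hχ' ξ b = cutParam χ hχ ξ a :=
    ⟨_, (cutChart χ' hχ' ξ).map_source hw', (cutChart χ' hχ' ξ).left_inv hw'⟩
  obtain ⟨u, hu⟩ := SymplecticCut.mk_eq_mk.1 hba.symm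
  have ht : ∀ t ∈ Ioo (-Real.pi) Real.pi, (t, a) ∈ (levelChart χ hχ ξ).target := fun t ht =>
    mem_levelChart_target.2 ((hχ.mem_target_iff _ _).2 ⟨ha, ht⟩)
  have hs : ∀ t ∈ Ioo (-Real.pi) Real.pi, (t, b) ∈ (levelChart χ' hχ' ξ).target := fun t ht =>
    mem_levelChart_target.2 ((hχ'.mem_target_iff _ _).2 ⟨hb, ht⟩)
  have key : ∀ t ∈ Ioo (-Real.pi) Real.pi, ∀ s ∈ Ioo (-Real.pi) Real.pi,
      Circle.exp t = Circle.exp s * u →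
      (levelChart χ hχ ξ).symm (t, a) = (levelChart χ' hχ' ξ).symm (s, b) := by
    intro t ht1 s hs1 hts
    apply CutLevel.incl_injective
    rw [incl_levelChart_symm (ht t ht1), incl_levelChart_symm (hs s hs1),
      ambientChart_symm_eq_cutAct hχ ξ 0 (mem_levelChart_target.1 (ht t ht1)),
      ambientChart_symm_eq_cutAct hχ' ξ 0 (mem_levelChart_target.1 (hs s hs1)), hts, cutAct_mul,
      ← incl_levelChart_symm (hχ := hχ') (zero_mem_levelChart_target hb), hu,
      incl_levelChart_symm (zero_mem_levelChart_target ha)]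
  -- The choice `t = arg u`, `s = 0` is excluded for `u = -1`, as `t = π` is not in the chart.
  obtain ⟨t, ht1, s, hs1, hts⟩ : ∃ t ∈ Ioo (-Real.pi) Real.pi, ∃ s ∈ Ioo (-Real.pi) Real.pi,
      Circle.exp t = Circle.exp s * u := by
    have hpi := Real.pi_pos
    rcases (Complex.arg_le_pi (u : ℂ)).lt_or_eq with h | h
    · exact ⟨_, ⟨Complex.neg_pi_lt_arg _, h⟩, 0, ⟨by linarith, hpi⟩, by simp⟩
    · refine ⟨Real.pi / 2, ⟨by linarith, by linarith⟩, -(Real.pi / 2),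
        ⟨by linarith, by linarith⟩, ?_⟩
      rw [← Circle.exp_arg u, h, ← Circle.exp_add]
      congr 1; ring
  refine ⟨(levelChart χ hχ ξ).symm (t, a), mk_levelChart_symm (ht t ht1),
    (levelChart χ hχ ξ).map_target (ht t ht1), ?_⟩
  rw [key t ht1 s hs1 hts]
  exact (levelChart χ' hχ' ξ).map_target (hs s hs1)

/-- A coordinate change of the symplectic cut is given by a coordinate change of the level near a
common point of the two charts on the orbit. -/
lemma contDiffAt_cutChart_trans {a : CutModel n} (ha : a ∈ (cutChart χ hχ ξ).target)
    (ha' : (cutChart χ hχ ξ).symm a ∈ (cutChart χ' hχ' ξ).source) :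
    ContDiffAt ℝ ∞ (cutChart χ' hχ' ξ ∘ (cutChart χ hχ ξ).symm) a := by
  obtain ⟨p, hp, hp1, hp2⟩ :=
    exists_mem_levelChart_source_inter ((cutChart χ hχ ξ).map_target ha) ha'
  have h1 : (levelChart χ hχ ξ p).2 = a := by
    rw [← cutChart_mk hp1, hp, (cutChart χ hχ ξ).right_inv ha]
  obtain ⟨t, ht⟩ : ∃ t, levelChart χ hχ ξ p = (t, a) := ⟨_, Prod.ext rfl h1⟩
  have h2 : (t, a) ∈ (levelChart χ hχ ξ).target := ht ▸ (levelChart χ hχ ξ).map_source hp1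
  have h3 : (levelChart χ hχ ξ).symm (t, a) = p := by rw [← ht, (levelChart χ hχ ξ).left_inv hp1]
  have h4 := contDiffAt_levelChart_trans (hχ' := hχ') h2 (h3.symm ▸ hp2)
  have h5 : ContDiffAt ℝ ∞ (fun a : CutModel n => (t, a)) a := by fun_prop
  refine (contDiffAt_snd.comp a (h4.comp a h5)).congr_of_eventuallyEq ?_
  have h6 : ∀ᶠ b in 𝓝 a, (t, b) ∈ (levelChart χ hχ ξ).target :=
    h5.continuousAt.preimage_mem_nhds ((levelChart χ hχ ξ).open_target.mem_nhds h2)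
  have h7 : ContinuousAt ((levelChart χ hχ ξ).symm ∘ fun a : CutModel n => (t, a)) a :=
    ((levelChart χ hχ ξ).symm.continuousAt h2).comp h5.continuousAt
  have h8 : ∀ᶠ b in 𝓝 a, (levelChart χ hχ ξ).symm (t, b) ∈ (levelChart χ' hχ' ξ).source :=
    h7.preimage_mem_nhds ((levelChart χ' hχ' ξ).open_source.mem_nhds (by
      rw [Function.comp, h3]; exact hp2))
  filter_upwards [h6, h8] with b hb hb'
  rw [Function.comp, Function.comp, Function.comp, Function.comp, ← cutChart_mk hb',
    mk_levelChart_symm hb]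
  rfl

end Transitions

/-! ### Local sections of submersions -/

section LocalSection
variable {E E' : Type*} [NormedAddCommGroup E] [NormedSpace ℝ E]
  [NormedAddCommGroup E'] [NormedSpace ℝ E']
  {M : Type*} [TopologicalSpace M] [ChartedSpace E M]
  {M' : Type*} [TopologicalSpace M'] [ChartedSpace E' M']

/-- A submersion has local sections. -/
lemma Manifold.IsSubmersionAt.exists_contMDiffAt_section {f : M → M'} {x : M}
    (h : Manifold.IsSubmersionAt 𝓘(ℝ, E) 𝓘(ℝ, E') ∞ f x) :
    ∃ s : M' → M, ContMDiffAt 𝓘(ℝ, E') 𝓘(ℝ, E) ∞ s (f x) ∧ s (f x) = x ∧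
      ∀ᶠ y in 𝓝 (f x), f (s y) = y := by
  obtain ⟨F, _, _, h⟩ := h
  have hd := h.domChart_mem_maximalAtlas
  have hc := h.codChart_mem_maximalAtlas
  have hx := h.mem_domChart_source
  have hfx := h.mem_codChart_source
  have hw : ∀ z ∈ h.domChart.target, h.codChart (f (h.domChart.symm z)) = (h.equiv z).1 :=
    fun z hz => h.writtenInCharts (by simpa using hz)
  let g : E' → E := fun v => h.equiv.symm (v, (h.equiv (h.domChart x)).2)
  have hg : ContDiff ℝ ∞ g := h.equiv.symm.contDiff.comp (contDiff_id.prodMk contDiff_const)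
  have h0 : h.codChart (f x) = (h.equiv (h.domChart x)).1 := by
    rw [← hw _ (h.domChart.map_source hx), h.domChart.left_inv hx]
  have hgx : g (h.codChart (f x)) = h.domChart x := by simp [g, h0]
  have hcs : ContMDiffAt 𝓘(ℝ, E') 𝓘(ℝ, E) ∞ (g ∘ h.codChart) (f x) :=
    hg.contMDiff.contMDiffAt.comp _ (contMDiffAt_of_mem_maximalAtlas hc hfx)
  refine ⟨h.domChart.symm ∘ (g ∘ h.codChart), ?_, ?_, ?_⟩
  · refine ContMDiffAt.comp _ (contMDiffAt_symm_of_mem_maximalAtlas hd ?_) hcs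
    rw [Function.comp, hgx]
    exact h.domChart.map_source hx
  · simp only [Function.comp, hgx, h.domChart.left_inv hx]
  · have h1 : ∀ᶠ y in 𝓝 (f x), g (h.codChart y) ∈ h.domChart.target :=
      hcs.continuousAt.preimage_mem_nhds (h.domChart.open_target.mem_nhds (by
        rw [Function.comp, hgx]; exact h.domChart.map_source hx))
    filter_upwards [h1, h.codChart.open_source.mem_nhds hfx] with y hy hys
    have h2 := hw _ hy
    have h3 : f (h.domChart.symm (g (h.codChart y))) ∈ h.codChart.source :=
      h.source_subset_preimage_source (h.domChart.map_target hy)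
    refine h.codChart.injOn h3 hys (h2.trans ?_)
    simp [g]

end LocalSection

section MFDerivInverse
variable {E E' : Type*} [NormedAddCommGroup E] [NormedSpace ℝ E]
  [NormedAddCommGroup E'] [NormedSpace ℝ E']
  {H H' : Type*} [TopologicalSpace H] [TopologicalSpace H']
  {I : ModelWithCorners ℝ E H} {I' : ModelWithCorners ℝ E' H'}
  {M : Type*} [TopologicalSpace M] [ChartedSpace H M]
  {M' : Type*} [TopologicalSpace M'] [ChartedSpace H' M']

lemma mfderiv_apply_of_leftInverse {f : M' → M} {g : M → M'} {x : M} {y : M'}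
    (hf : MDifferentiableAt I' I f y) (hg : MDifferentiableAt I I' g x) (hgx : g x = y)
    (h : ∀ᶠ z in 𝓝 x, f (g z) = z) (v : E) :
    (mfderiv I' I f y : E' →L[ℝ] E) ((mfderiv I I' g x : E →L[ℝ] E') v) = v := by
  subst hgx
  have h1 : f ∘ g =ᶠ[𝓝 x] id := h
  have h2 := h1.mfderiv_eq (I := I) (I' := I)
  rw [mfderiv_comp x hf hg, mfderiv_id] at h2
  exact DFunLike.congr_fun h2 v

end MFDerivInverse

/-! ### The induced charts are smooth for every smooth structure of the reduction -/

/-- The constant form `dp ∧ dq + dx ∧ dy` on `ℝⁿ × ℝⁿ × ℂ`, as a differential form. -/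
noncomputable def cutModelDForm (n : ℕ) : DForm 𝓘(ℝ, CutModel n) (CutModel n) 2 :=
  fun _ => cutModelForm n

section SmoothReduction
variable {n : ℕ} {V : Type*} [TopologicalSpace V]
  [ChartedSpace (EuclideanSpace ℝ (Fin (n + 1))) V]
  [MulAction Circle V] [ContMDiffSMul (𝓡 1) (𝓡 (n + 1)) ∞ Circle V]
  [IsManifold (𝓡 (n + 1)) ∞ V] {ξ : ℝ}
  [ChartedSpace (EuclideanSpace ℝ (Fin (2 * n + 3))) (CutLevel n V ξ)]
  [ChartedSpace (EuclideanSpace ℝ (Fin (2 * n + 2))) (SymplecticCut n V ξ)]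

variable (n V ξ) in
/-- The given smooth structures make the level `{H - |z|² / 2 = ξ}` an embedded submanifold of
`T^* V × ℂ` and its projection onto the symplectic cut a submersion. -/
structure IsSmoothReduction : Prop where
  embedding : Manifold.IsSmoothEmbedding (𝓡 (2 * n + 3)) (cutAmbientModel n) ∞
    (CutLevel.incl : CutLevel n V ξ → Cotangent n V × ℂ)
  submersion : Manifold.IsSubmersion (𝓡 (2 * n + 3)) (𝓡 (2 * n + 2)) ∞
    (SymplecticCut.mk : CutLevel n V ξ → SymplecticCut n V ξ)

lemma IsSymplecticReduction.isSmoothReduction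
    {σ : DForm (𝓡 (2 * n + 2)) (SymplecticCut n V ξ) 2} (h : IsSymplecticReduction σ) :
    IsSmoothReduction n V ξ := ⟨h.embedding, h.submersion⟩

end SmoothReduction

section ReductionCharts
variable {n : ℕ} {V : Type*} [TopologicalSpace V]
  [ChartedSpace (EuclideanSpace ℝ (Fin (n + 1))) V]
  [MulAction Circle V]
  [IsManifold (𝓡 (n + 1)) ∞ V] {ξ : ℝ} [Nonempty (CutLevel n V ξ)]
  {χ : OpenPartialHomeomorph V (EuclideanSpace ℝ (Fin n) × ℝ)} {hχ : IsAdaptedChart χ}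
  [ChartedSpace (EuclideanSpace ℝ (Fin (2 * n + 3))) (CutLevel n V ξ)]

lemma contMDiffAt_levelChart (hincl : Manifold.IsSmoothEmbedding (𝓡 (2 * n + 3))
      (cutAmbientModel n) ∞ (CutLevel.incl : CutLevel n V ξ → Cotangent n V × ℂ))
    {p : CutLevel n V ξ} (hp : p ∈ (levelChart χ hχ ξ).source) :
    ContMDiffAt (𝓡 (2 * n + 3)) 𝓘(ℝ, ℝ × CutModel n) ∞ (levelChart χ hχ ξ) p := by
  have h1 : ContMDiffAt (𝓡 (2 * n + 3)) 𝓘(ℝ, ℝ × ℝ × CutModel n) ∞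
      (ambientChart χ hχ ξ ∘ CutLevel.incl) p :=
    ContMDiffAt.comp p (contMDiffAt_ambientChart hχ ξ hp) (hincl.isImmersion.contMDiff p)
  exact (contDiff_snd (𝕜 := ℝ) (E := ℝ) (F := ℝ × CutModel n)).contMDiff.contMDiffAt.comp p h1

/-- Smoothness of a map into the level can be tested after the inclusion, which is an immersion. -/
lemma contMDiffAt_levelChart_symm (hincl : Manifold.IsSmoothEmbedding (𝓡 (2 * n + 3))
      (cutAmbientModel n) ∞ (CutLevel.incl : CutLevel n V ξ → Cotangent n V × ℂ))
    {y : ℝ × CutModel n} (hy : y ∈ (levelChart χ hχ ξ).target) :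
    ContMDiffAt 𝓘(ℝ, ℝ × CutModel n) (𝓡 (2 * n + 3)) ∞ (levelChart χ hχ ξ).symm y := by
  refine (ContMDiffAt.iff_comp_isImmersionAt (hincl.isImmersion.isImmersionAt _)).2
    ⟨(levelChart χ hχ ξ).symm.continuousAt hy, ?_⟩
  have h0 : (0, y) ∈ (ambientChart χ hχ ξ).target :=
    (mem_ambientChart_target (hχ := hχ) (ξ := ξ)).2 (mem_levelChart_target.1 hy)
  refine ((contMDiffAt_ambientChart_symm hχ ξ h0).comp y
    (contDiff_prodMk_right (0 : ℝ)).contMDiff.contMDiffAt).congr_of_eventuallyEq ?_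
  filter_upwards [(levelChart χ hχ ξ).open_target.mem_nhds hy] with z hz
  exact incl_levelChart_symm hz

variable [ContMDiffSMul (𝓡 1) (𝓡 (n + 1)) ∞ Circle V]
  [ChartedSpace (EuclideanSpace ℝ (Fin (2 * n + 2))) (SymplecticCut n V ξ)]

lemma contMDiffAt_cutParam (hred : IsSmoothReduction n V ξ)
    {a : CutModel n} (ha : a ∈ cutDomain χ) :
    ContMDiffAt 𝓘(ℝ, CutModel n) (𝓡 (2 * n + 2)) ∞ (cutParam χ hχ ξ) a :=
  (hred.submersion.contMDiff _).comp a ((contMDiffAt_levelChart_symm hred.embedding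
    (zero_mem_levelChart_target (hχ := hχ) (ξ := ξ) ha)).comp a
      (contDiff_prodMk_right (0 : ℝ)).contMDiff.contMDiffAt)

/-- The chart of the symplectic cut is the composition of a chart of the level and a local section
of the submersion `SymplecticCut.mk`. -/
lemma contMDiffAt_cutChart (hred : IsSmoothReduction n V ξ)
    {w : SymplecticCut n V ξ} (hw : w ∈ (cutChart χ hχ ξ).source) :
    ContMDiffAt (𝓡 (2 * n + 2)) 𝓘(ℝ, CutModel n) ∞ (cutChart χ hχ ξ) w := by
  obtain ⟨p, rfl, hp, -⟩ := exists_mem_levelChart_source_inter hw hw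
  obtain ⟨s, hs, hsp, hfs⟩ := (hred.submersion.isSubmersionAt p).exists_contMDiffAt_section
  have h1 : ContMDiffAt (𝓡 (2 * n + 3)) 𝓘(ℝ, CutModel n) ∞
      (fun p => (levelChart χ hχ ξ p).2) p :=
    (contDiff_snd (𝕜 := ℝ) (E := ℝ) (F := CutModel n)).contMDiff.contMDiffAt.comp p
      (contMDiffAt_levelChart hred.embedding hp)
  refine (h1.comp_of_eq hs hsp).congr_of_eventuallyEq ?_
  have h2 : ∀ᶠ y in 𝓝 (SymplecticCut.mk p), s y ∈ (levelChart χ hχ ξ).source :=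
    hs.continuousAt.preimage_mem_nhds ((levelChart χ hχ ξ).open_source.mem_nhds (hsp.symm ▸ hp))
  filter_upwards [h2, hfs] with y hy hy'
  rw [Function.comp, ← cutChart_mk hy, hy']

/-- The form on the target of a chart of the symplectic cut induces the restriction of
`ω_can ⊕ ω_std` on the level. -/
lemma pullback_mk_cutChart (hred : IsSmoothReduction n V ξ)
    {p : CutLevel n V ξ} (hp : p ∈ (levelChart χ hχ ξ).source)
    (u v : TangentSpace (𝓡 (2 * n + 3)) p) :
    DForm.pullback (𝓡 (2 * n + 3)) (cutAmbientModel n) CutLevel.incl (cutAmbientForm n V) p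
      ![u, v] =
    DForm.pullback (𝓡 (2 * n + 3)) (𝓡 (2 * n + 2)) SymplecticCut.mk
      (DForm.pullback (𝓡 (2 * n + 2)) 𝓘(ℝ, CutModel n) (cutChart χ hχ ξ)
        (cutModelDForm n)) p ![u, v] := by
  obtain ⟨y, hy, rfl⟩ : ∃ y ∈ (levelChart χ hχ ξ).target, (levelChart χ hχ ξ).symm y = p :=
    ⟨_, (levelChart χ hχ ξ).map_source hp, (levelChart χ hχ ξ).left_inv hp⟩
  have hP := (contMDiffAt_levelChart_symm hred.embedding hy).mdifferentiableAt (by simp)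
  have hC := (contMDiffAt_levelChart hred.embedding hp).mdifferentiableAt (by simp)
  have hw : SymplecticCut.mk ((levelChart χ hχ ξ).symm y) ∈ (cutChart χ hχ ξ).source :=
    mk_mem_cutChart_source hp
  have hc := (contMDiffAt_cutChart hred hw).mdifferentiableAt (by simp)
  have hm := (hred.submersion.contMDiff ((levelChart χ hχ ξ).symm y)).mdifferentiableAt (by simp)
  -- It is enough to compare the pullbacks by the parametrisation of the level.
  have hsurj : ∀ u : EuclideanSpace ℝ (Fin (2 * n + 3)), ∃ u',
      (mfderiv 𝓘(ℝ, ℝ × CutModel n) (𝓡 (2 * n + 3)) (levelChart χ hχ ξ).symm y :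
        ℝ × CutModel n →L[ℝ] EuclideanSpace ℝ (Fin (2 * n + 3))) u' = u := fun u =>
    ⟨_, mfderiv_apply_of_leftInverse hP hC ((levelChart χ hχ ξ).right_inv hy)
      ((levelChart χ hχ ξ).eventually_left_inverse hp) u⟩
  obtain ⟨u', rfl⟩ := hsurj u
  obtain ⟨v', rfl⟩ := hsurj v
  refine (DForm.pullback_apply_pair (I := 𝓘(ℝ, ℝ × CutModel n)) (levelChart χ hχ ξ).symm
    (DForm.pullback (𝓡 (2 * n + 3)) (cutAmbientModel n) CutLevel.incl (cutAmbientForm n V))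
    y u' v').symm.trans ?_
  refine Eq.trans ?_ (DForm.pullback_apply_pair (I := 𝓘(ℝ, ℝ × CutModel n))
    (levelChart χ hχ ξ).symm (DForm.pullback (𝓡 (2 * n + 3)) (𝓡 (2 * n + 2)) SymplecticCut.mk
      (DForm.pullback (𝓡 (2 * n + 2)) 𝓘(ℝ, CutModel n) (cutChart χ hχ ξ)
        (cutModelDForm n))) y u' v')
  have h1 : CutLevel.incl ∘ (levelChart χ hχ ξ).symm =ᶠ[𝓝 y]
      fun y : ℝ × CutModel n => (ambientChart χ hχ ξ).symm (0, y) := by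
    filter_upwards [(levelChart χ hχ ξ).open_target.mem_nhds hy] with z hz
    exact incl_levelChart_symm hz
  have h2 : (cutChart χ hχ ξ ∘ SymplecticCut.mk) ∘ (levelChart χ hχ ξ).symm =ᶠ[𝓝 y]
      fun y : ℝ × CutModel n => y.2 := by
    filter_upwards [(levelChart χ hχ ξ).open_target.mem_nhds hy] with z hz
    simp only [Function.comp, cutChart_mk ((levelChart χ hχ ξ).map_target hz),
      (levelChart χ hχ ξ).right_inv hz]
  have h3 : DForm.pullback (𝓡 (2 * n + 3)) (𝓡 (2 * n + 2)) SymplecticCut.mk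
      (DForm.pullback (𝓡 (2 * n + 2)) 𝓘(ℝ, CutModel n) (cutChart χ hχ ξ)
        (cutModelDForm n)) ((levelChart χ hχ ξ).symm y) = _ :=
    (DForm.pullback_comp hc hm (cutModelDForm n)).symm
  have h4 : DForm.pullback 𝓘(ℝ, ℝ × CutModel n) (𝓡 (2 * n + 3)) (levelChart χ hχ ξ).symm
      (DForm.pullback (𝓡 (2 * n + 3)) (𝓡 (2 * n + 2)) SymplecticCut.mk
      (DForm.pullback (𝓡 (2 * n + 2)) 𝓘(ℝ, CutModel n) (cutChart χ hχ ξ)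
        (cutModelDForm n))) y =
      DForm.pullback 𝓘(ℝ, ℝ × CutModel n) 𝓘(ℝ, CutModel n) (fun y : ℝ × CutModel n => y.2)
        (cutModelDForm n) y := by
    rw [← DForm.pullback_congr h2, DForm.pullback_comp (hc.comp _ hm) hP]
    exact congrArg (fun σ : EuclideanSpace ℝ (Fin (2 * n + 3)) [⋀^Fin 2]→L[ℝ] ℝ =>
      σ.compContinuousLinearMap (mfderiv 𝓘(ℝ, ℝ × CutModel n) (𝓡 (2 * n + 3))
        (levelChart χ hχ ξ).symm y)) h3
  rw [h4, ← DForm.pullback_comp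
    ((hred.embedding.isImmersion.contMDiff _).mdifferentiableAt (by simp)) hP,
    DForm.pullback_congr h1]
  have h6 : (mfderiv 𝓘(ℝ, ℝ × CutModel n) 𝓘(ℝ, CutModel n) (fun y : ℝ × CutModel n => y.2) y :
      ℝ × CutModel n →L[ℝ] CutModel n) = .snd ℝ ℝ (CutModel n) :=
    mfderiv_eq_fderiv.trans fderiv_snd
  have h5 : ∀ u : ℝ × CutModel n, (mfderiv 𝓘(ℝ, ℝ × CutModel n) 𝓘(ℝ, CutModel n)
      (fun y : ℝ × CutModel n => y.2) y : ℝ × CutModel n →L[ℝ] CutModel n) u = u.2 := fun u =>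
    DFunLike.congr_fun h6 u
  refine (pullback_cutAmbientForm hχ ξ (mem_levelChart_target.1 hy) u' v').trans ?_
  refine Eq.trans ?_ (DForm.pullback_apply_pair (fun y : ℝ × CutModel n => y.2) (cutModelDForm n)
    y u' v').symm
  exact congrArg₂ (fun a b : CutModel n => cutModelForm n ![a, b]) (h5 u').symm (h5 v').symm

/-- The form on the symplectic cut is the standard form in the charts induced by adapted charts. -/
lemma eq_pullback_cutChart (hred : IsSmoothReduction n V ξ)
    {σ : DForm (𝓡 (2 * n + 2)) (SymplecticCut n V ξ) 2}
    {p : CutLevel n V ξ} (hp : p ∈ (levelChart χ hχ ξ).source)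
    (hσ : DForm.pullback (𝓡 (2 * n + 3)) (𝓡 (2 * n + 2)) SymplecticCut.mk σ p =
      DForm.pullback (𝓡 (2 * n + 3)) (cutAmbientModel n) CutLevel.incl (cutAmbientForm n V) p) :
    σ (SymplecticCut.mk p) = DForm.pullback (𝓡 (2 * n + 2)) 𝓘(ℝ, CutModel n) (cutChart χ hχ ξ)
        (cutModelDForm n) (SymplecticCut.mk p) := by
  obtain ⟨s, hs, hsp, hfs⟩ := (hred.submersion.isSubmersionAt p).exists_contMDiffAt_section
  have hm := (hred.submersion.contMDiff p).mdifferentiableAt (by simp)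
  have hsurj : ∀ u : EuclideanSpace ℝ (Fin (2 * n + 2)), ∃ u',
      (mfderiv (𝓡 (2 * n + 3)) (𝓡 (2 * n + 2)) SymplecticCut.mk p :
        EuclideanSpace ℝ (Fin (2 * n + 3)) →L[ℝ] EuclideanSpace ℝ (Fin (2 * n + 2))) u' = u :=
    fun u => ⟨_, mfderiv_apply_of_leftInverse hm (hs.mdifferentiableAt (by simp)) hsp hfs u⟩
  refine ContinuousAlternatingMap.ext fun v => ?_
  have hv : v = ![v 0, v 1] := by ext i : 1; fin_cases i <;> rfl
  rw [hv]
  obtain ⟨u', hu⟩ := hsurj (v 0)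
  obtain ⟨v', hv⟩ := hsurj (v 1)
  have h1 := pullback_mk_cutChart hred hp u' v'
  rw [← hσ] at h1
  have h2 := (DForm.pullback_apply_pair (I := 𝓡 (2 * n + 3)) (SymplecticCut.mk : CutLevel n V ξ → _)
    σ p u' v').symm.trans (h1.trans (DForm.pullback_apply_pair _ _ p u' v'))
  erw [hu, hv] at h2
  exact h2

end ReductionCharts

/-! ### The smooth structures of the level and of the symplectic cut -/

section ChartedSpaceOfFamily
variable {M F E ι : Type*} [TopologicalSpace M] [NormedAddCommGroup F] [NormedSpace ℝ F]
  [NormedAddCommGroup E] [NormedSpace ℝ E]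

/-- The charted space structure given by a family of charts with values in a vector space `F`,
transported to the model space `E` by a linear isomorphism. It is not an instance, as it depends on
the family. -/
@[reducible]
noncomputable def chartedSpaceOfFamily (φ : ι → OpenPartialHomeomorph M F) (i : M → ι)
    (hi : ∀ x, x ∈ (φ (i x)).source) (L : F ≃L[ℝ] E) : ChartedSpace E M where
  atlas := range fun j => (φ j).transHomeomorph L.toHomeomorph
  chartAt x := (φ (i x)).transHomeomorph L.toHomeomorph
  mem_chart_source x := hi x
  chart_mem_atlas x := ⟨i x, rfl⟩

lemma isManifold_chartedSpaceOfFamily (φ : ι → OpenPartialHomeomorph M F) (i : M → ι)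
    (hi : ∀ x, x ∈ (φ (i x)).source) (L : F ≃L[ℝ] E)
    (h : ∀ j k, ∀ y ∈ (φ j).target, (φ j).symm y ∈ (φ k).source →
      ContDiffAt ℝ ∞ (φ k ∘ (φ j).symm) y) :
    letI := chartedSpaceOfFamily φ i hi L
    IsManifold 𝓘(ℝ, E) ∞ M := by
  let _ := chartedSpaceOfFamily φ i hi L
  refine isManifold_of_contDiffOn _ _ _ ?_
  rintro _ _ ⟨j, rfl⟩ ⟨k, rfl⟩ z hz
  have h1 : L.symm z ∈ (φ j).target := hz.1.1
  have h2 : (φ j).symm (L.symm z) ∈ (φ k).source := hz.1.2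
  exact (L.contDiff.contDiffAt.comp z ((h j k _ h1 h2).comp z
    L.symm.contDiff.contDiffAt)).contDiffWithinAt

end ChartedSpaceOfFamily

lemma finrank_continuousDual (E : Type*) [NormedAddCommGroup E] [NormedSpace ℝ E]
    [FiniteDimensional ℝ E] : Module.finrank ℝ (E →L[ℝ] ℝ) = Module.finrank ℝ E := by
  rw [← (LinearMap.toContinuousLinearMap : (E →ₗ[ℝ] ℝ) ≃ₗ[ℝ] (E →L[ℝ] ℝ)).finrank_eq,
    Module.finrank_linearMap, Module.finrank_self, mul_one]

/-- An identification of the space of coordinates `(t, q, p, w)` of the level with its model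
space. -/
noncomputable def levelModelEquiv (n : ℕ) :
    (ℝ × CutModel n) ≃L[ℝ] EuclideanSpace ℝ (Fin (2 * n + 3)) :=
  ContinuousLinearEquiv.ofFinrankEq (by simp; ring)

/-- An identification of the space of coordinates `(q, p, w)` of the symplectic cut with its model
space. -/
noncomputable def cutModelEquiv (n : ℕ) :
    CutModel n ≃L[ℝ] EuclideanSpace ℝ (Fin (2 * n + 2)) :=
  ContinuousLinearEquiv.ofFinrankEq (by simp; ring)

/-- An identification of the space of coordinates `(k, t, q, p, w)` of `T^* V × ℂ` with its model
space. -/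
noncomputable def ambientModelEquiv (n : ℕ) : (ℝ × ℝ × CutModel n) ≃L[ℝ]
    (EuclideanSpace ℝ (Fin (n + 1)) × (EuclideanSpace ℝ (Fin (n + 1)) →L[ℝ] ℝ)) × ℂ :=
  ContinuousLinearEquiv.ofFinrankEq (by simp [finrank_continuousDual]; ring)

section AmbientChartModel
variable {n : ℕ} {V : Type*} [TopologicalSpace V]
  [ChartedSpace (EuclideanSpace ℝ (Fin (n + 1))) V] [MulAction Circle V]
  [IsManifold (𝓡 (n + 1)) ∞ V]

/-- The chart of `T^* V × ℂ` induced by an adapted chart, with values in its model space. -/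
noncomputable def ambientChartModel (χ : OpenPartialHomeomorph V (EuclideanSpace ℝ (Fin n) × ℝ))
    (hχ : IsAdaptedChart χ) (ξ : ℝ) : OpenPartialHomeomorph (Cotangent n V × ℂ) (ModelProd
        (ModelProd (EuclideanSpace ℝ (Fin (n + 1))) (EuclideanSpace ℝ (Fin (n + 1)) →L[ℝ] ℝ)) ℂ) :=
  (ambientChart χ hχ ξ).transHomeomorph
    ((ambientModelEquiv n).toHomeomorph.trans (cutAmbientModel n).toHomeomorph.symm)

lemma ambientChartModel_mem_maximalAtlas
    (χ : OpenPartialHomeomorph V (EuclideanSpace ℝ (Fin n) × ℝ)) (hχ : IsAdaptedChart χ) (ξ : ℝ) :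
    ambientChartModel χ hχ ξ ∈
      IsManifold.maximalAtlas (cutAmbientModel n) ∞ (Cotangent n V × ℂ) := by
  have h1 : ContMDiff 𝓘(ℝ, ℝ × ℝ × CutModel n) (cutAmbientModel n) ∞
      ((cutAmbientModel n).symm ∘ ambientModelEquiv n) := fun y =>
    ((cutAmbientModel n).contMDiffOn_symm.contMDiffAt (by
      rw [(cutAmbientModel n).range_eq_univ]; exact Filter.univ_mem)).comp y
        (ambientModelEquiv n).contDiff.contMDiff.contMDiffAt
  have h2 : ContMDiff (cutAmbientModel n) 𝓘(ℝ, ℝ × ℝ × CutModel n) ∞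
      ((ambientModelEquiv n).symm ∘ cutAmbientModel n) :=
    (ambientModelEquiv n).symm.contDiff.contMDiff.comp (cutAmbientModel n).contMDiff
  refine OpenPartialHomeomorph.mem_maximalAtlas_of_contMDiffOn _ ?_ ?_
  · exact fun p hp => (h1.contMDiffAt.comp p (contMDiffAt_ambientChart hχ ξ hp)).contMDiffWithinAt
  · exact fun y hy => (ContMDiffAt.comp y (contMDiffAt_ambientChart_symm hχ ξ hy)
      h2.contMDiffAt).contMDiffWithinAt

end AmbientChartModel

section Existence
variable {n : ℕ} {V : Type*} [TopologicalSpace V]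
  [ChartedSpace (EuclideanSpace ℝ (Fin (n + 1))) V]
  [MulAction Circle V]
  [IsManifold (𝓡 (n + 1)) ∞ V] {ξ : ℝ} [Nonempty (CutLevel n V ξ)]

variable (n V ξ) in
/-- The charts of the level `{H - |z|² / 2 = ξ}` induced by the adapted charts of `V`. -/
noncomputable def levelCharts
    (j : {χ : OpenPartialHomeomorph V (EuclideanSpace ℝ (Fin n) × ℝ) // IsAdaptedChart χ}) :
    OpenPartialHomeomorph (CutLevel n V ξ) (ℝ × CutModel n) := levelChart j.1 j.2 ξ

/-- A choice of an adapted chart at a point of the level. -/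
noncomputable def adaptedChartAt (hV : HasAdaptedCharts n V) (p : CutLevel n V ξ) :
    {χ : OpenPartialHomeomorph V (EuclideanSpace ℝ (Fin n) × ℝ) // IsAdaptedChart χ} :=
  ⟨(hV p.incl.1.1).choose, (hV p.incl.1.1).choose_spec.1⟩

lemma mem_levelCharts_source (hV : HasAdaptedCharts n V) (p : CutLevel n V ξ) :
    p ∈ (levelCharts n V ξ (adaptedChartAt hV p)).source :=
  mem_levelChart_source.2 (hV p.incl.1.1).choose_spec.2

/-- The smooth structure of the level `{H - |z|² / 2 = ξ}`. -/
@[reducible]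
noncomputable def levelChartedSpace (hV : HasAdaptedCharts n V) :
    ChartedSpace (EuclideanSpace ℝ (Fin (2 * n + 3))) (CutLevel n V ξ) :=
  chartedSpaceOfFamily (levelCharts n V ξ) (adaptedChartAt hV) (mem_levelCharts_source hV)
    (levelModelEquiv n)

lemma isManifold_level (hV : HasAdaptedCharts n V) :
    letI := levelChartedSpace (ξ := ξ) hV
    IsManifold (𝓡 (2 * n + 3)) ∞ (CutLevel n V ξ) :=
  isManifold_chartedSpaceOfFamily _ _ _ _ fun _ _ _ => contDiffAt_levelChart_trans

/-- In the charts induced by an adapted chart, the inclusion of the level is `y ↦ (0, y)`. -/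
lemma isSmoothEmbedding_incl (hV : HasAdaptedCharts n V) :
    letI := levelChartedSpace (ξ := ξ) hV
    Manifold.IsSmoothEmbedding (𝓡 (2 * n + 3)) (cutAmbientModel n) ∞
      (CutLevel.incl : CutLevel n V ξ → Cotangent n V × ℂ) := by
  let _ := levelChartedSpace (ξ := ξ) hV
  have := isManifold_level (ξ := ξ) hV
  refine ⟨⟨ℝ, inferInstance, inferInstance, fun p => ?_⟩, CutLevel.isEmbedding_incl⟩
  refine Manifold.IsImmersionAtOfComplement.mk_of_continuousAt
    CutLevel.isEmbedding_incl.continuous.continuousAt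
    (((levelModelEquiv n).symm.prodCongr (.refl ℝ ℝ)).trans
      ((ContinuousLinearEquiv.prodComm ℝ _ _).trans (ambientModelEquiv n)))
    (chartAt _ p) (ambientChartModel _ (adaptedChartAt hV p).2 ξ) (mem_chart_source _ p)
    (mem_levelCharts_source hV p) (IsManifold.chart_mem_maximalAtlas p)
    (ambientChartModel_mem_maximalAtlas _ _ ξ) ?_
  intro z hz
  have hz' : (levelModelEquiv n).symm z ∈ (levelChart _ (adaptedChartAt hV p).2 ξ).target := by
    rw [OpenPartialHomeomorph.extend_target] at hz
    exact hz.1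
  have h0 := (mem_ambientChart_target (hχ := (adaptedChartAt hV p).2) (ξ := ξ) (k := 0)).2
    (mem_levelChart_target.1 hz')
  change (cutAmbientModel n) ((cutAmbientModel n).symm (ambientModelEquiv n
    (ambientChart _ (adaptedChartAt hV p).2 ξ ((levelChart _ (adaptedChartAt hV p).2 ξ).symm
      ((levelModelEquiv n).symm z)).incl))) = ambientModelEquiv n (0, (levelModelEquiv n).symm z)
  rw [(cutAmbientModel n).right_inv (by rw [(cutAmbientModel n).range_eq_univ]; trivial),
    incl_levelChart_symm hz']
  exact congrArg _ ((ambientChart _ (adaptedChartAt hV p).2 ξ).right_inv h0)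

variable [ContMDiffSMul (𝓡 1) (𝓡 (n + 1)) ∞ Circle V]

variable (n V ξ) in
/-- The charts of the symplectic cut induced by the adapted charts of `V`. -/
noncomputable def cutCharts
    (j : {χ : OpenPartialHomeomorph V (EuclideanSpace ℝ (Fin n) × ℝ) // IsAdaptedChart χ}) :
    OpenPartialHomeomorph (SymplecticCut n V ξ) (CutModel n) := cutChart j.1 j.2 ξ

lemma mem_cutCharts_source (hV : HasAdaptedCharts n V) (w : SymplecticCut n V ξ) :
    w ∈ (cutCharts n V ξ
      (adaptedChartAt hV (Function.surjInv SymplecticCut.mk_surjective w))).source := by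
  have h := mk_mem_cutChart_source
    (mem_levelCharts_source hV (Function.surjInv SymplecticCut.mk_surjective w))
  rwa [Function.surjInv_eq SymplecticCut.mk_surjective w] at h

/-- The smooth structure of the symplectic cut. -/
@[reducible]
noncomputable def cutChartedSpace (hV : HasAdaptedCharts n V) :
    ChartedSpace (EuclideanSpace ℝ (Fin (2 * n + 2))) (SymplecticCut n V ξ) :=
  chartedSpaceOfFamily (cutCharts n V ξ) _ (mem_cutCharts_source hV) (cutModelEquiv n)

lemma isManifold_symplecticCut (hV : HasAdaptedCharts n V) :
    letI := cutChartedSpace (ξ := ξ) hV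
    IsManifold (𝓡 (2 * n + 2)) ∞ (SymplecticCut n V ξ) :=
  isManifold_chartedSpaceOfFamily _ _ _ _ fun _ _ _ => contDiffAt_cutChart_trans

/-- In the charts induced by an adapted chart, the projection of the level onto the symplectic cut
is `(t, a) ↦ a`. -/
lemma isSubmersion_mk (hV : HasAdaptedCharts n V) :
    letI := levelChartedSpace (ξ := ξ) hV
    letI := cutChartedSpace (ξ := ξ) hV
    Manifold.IsSubmersion (𝓡 (2 * n + 3)) (𝓡 (2 * n + 2)) ∞
      (SymplecticCut.mk : CutLevel n V ξ → SymplecticCut n V ξ) := by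
  let _ := levelChartedSpace (ξ := ξ) hV
  let _ := cutChartedSpace (ξ := ξ) hV
  have := isManifold_level (ξ := ξ) hV
  have := isManifold_symplecticCut (ξ := ξ) hV
  refine ⟨ℝ, inferInstance, inferInstance, fun p => ?_⟩
  refine Manifold.IsSubmersionAtOfComplement.mk_of_continuousAt
    SymplecticCut.continuous_mk.continuousAt
    ((levelModelEquiv n).symm.trans
      ((ContinuousLinearEquiv.prodComm ℝ _ _).trans ((cutModelEquiv n).prodCongr (.refl ℝ ℝ))))
    (chartAt _ p) ((cutCharts n V ξ (adaptedChartAt hV p)).transHomeomorph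
      (cutModelEquiv n).toHomeomorph) (mem_chart_source _ p)
    (mk_mem_cutChart_source (mem_levelCharts_source hV p)) (IsManifold.chart_mem_maximalAtlas p)
    (IsManifold.subset_maximalAtlas ⟨_, rfl⟩) ?_
  intro z hz
  have hz' : (levelModelEquiv n).symm z ∈ (levelChart _ (adaptedChartAt hV p).2 ξ).target := by
    rw [OpenPartialHomeomorph.extend_target] at hz
    exact hz.1
  change cutModelEquiv n (cutChart _ (adaptedChartAt hV p).2 ξ (SymplecticCut.mk
    ((levelChart _ (adaptedChartAt hV p).2 ξ).symm ((levelModelEquiv n).symm z)))) =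
      cutModelEquiv n ((levelModelEquiv n).symm z).2
  rw [cutChart_mk ((levelChart _ (adaptedChartAt hV p).2 ξ).map_target hz'),
    (levelChart _ (adaptedChartAt hV p).2 ξ).right_inv hz']

end Existence

/-! ### The symplectic form of the cut -/

section CutForm
variable {n : ℕ} {V : Type*} [TopologicalSpace V]
  [ChartedSpace (EuclideanSpace ℝ (Fin (n + 1))) V]
  [MulAction Circle V] [ContMDiffSMul (𝓡 1) (𝓡 (n + 1)) ∞ Circle V]
  [IsManifold (𝓡 (n + 1)) ∞ V] {ξ : ℝ} [Nonempty (CutLevel n V ξ)]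
  {χ : OpenPartialHomeomorph V (EuclideanSpace ℝ (Fin n) × ℝ)} {hχ : IsAdaptedChart χ}

/-- The form on the symplectic cut that is the standard one in the charts induced by adapted
charts: at `w`, the pullback of the standard form by the chosen chart at `w`. -/
noncomputable def cutForm (hV : HasAdaptedCharts n V)
    [ChartedSpace (EuclideanSpace ℝ (Fin (2 * n + 2))) (SymplecticCut n V ξ)] :
    DForm (𝓡 (2 * n + 2)) (SymplecticCut n V ξ) 2 := fun w =>
  DForm.pullback (𝓡 (2 * n + 2)) 𝓘(ℝ, CutModel n) (cutCharts n V ξ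
      (adaptedChartAt hV (Function.surjInv SymplecticCut.mk_surjective w))) (cutModelDForm n) w

variable (hV : HasAdaptedCharts n V)
  [ChartedSpace (EuclideanSpace ℝ (Fin (2 * n + 3))) (CutLevel n V ξ)]
  [ChartedSpace (EuclideanSpace ℝ (Fin (2 * n + 2))) (SymplecticCut n V ξ)]

lemma pullback_mk_pullback_cutChart (hred : IsSmoothReduction n V ξ)
    {p : CutLevel n V ξ} (hp : p ∈ (levelChart χ hχ ξ).source) :
    DForm.pullback (𝓡 (2 * n + 3)) (𝓡 (2 * n + 2)) SymplecticCut.mk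
      (DForm.pullback (𝓡 (2 * n + 2)) 𝓘(ℝ, CutModel n) (cutChart χ hχ ξ) (cutModelDForm n)) p =
    DForm.pullback (𝓡 (2 * n + 3)) (cutAmbientModel n) CutLevel.incl (cutAmbientForm n V) p := by
  refine ContinuousAlternatingMap.ext fun v => ?_
  have hv : v = ![v 0, v 1] := by ext i : 1; fin_cases i <;> rfl
  rw [hv]
  exact (pullback_mk_cutChart hred hp _ _).symm

/-- The pullbacks of the standard form by two charts of the symplectic cut agree, as both induce the
restriction of `ω_can ⊕ ω_std` on the level. -/
lemma cutForm_eq (hred : IsSmoothReduction n V ξ)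
    {w : SymplecticCut n V ξ} (hw : w ∈ (cutChart χ hχ ξ).source) :
    cutForm hV w =
      DForm.pullback (𝓡 (2 * n + 2)) 𝓘(ℝ, CutModel n) (cutChart χ hχ ξ) (cutModelDForm n) w := by
  have h : ∀ (j : {χ : OpenPartialHomeomorph V (EuclideanSpace ℝ (Fin n) × ℝ) // IsAdaptedChart χ}),
      w ∈ (cutChart j.1 j.2 ξ).source →
      DForm.pullback (𝓡 (2 * n + 2)) 𝓘(ℝ, CutModel n) (cutChart j.1 j.2 ξ) (cutModelDForm n) w =
      DForm.pullback (𝓡 (2 * n + 2)) 𝓘(ℝ, CutModel n) (cutChart χ hχ ξ) (cutModelDForm n) w := by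
    intro j hj
    obtain ⟨p, rfl, hp1, hp2⟩ := exists_mem_levelChart_source_inter hj hw
    exact eq_pullback_cutChart hred hp2 (pullback_mk_pullback_cutChart hred hp1)
  exact h _ (mem_cutCharts_source hV w)

/-- The pullback of the standard form by a chart is nondegenerate. -/
lemma eq_zero_of_pullback_cutChart (hred : IsSmoothReduction n V ξ)
    {w : SymplecticCut n V ξ} (hw : w ∈ (cutChart χ hχ ξ).source)
    {v : EuclideanSpace ℝ (Fin (2 * n + 2))}
    (h : ∀ v', (DForm.pullback (𝓡 (2 * n + 2)) 𝓘(ℝ, CutModel n) (cutChart χ hχ ξ)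
      (cutModelDForm n) w : EuclideanSpace ℝ (Fin (2 * n + 2)) [⋀^Fin 2]→L[ℝ] ℝ) ![v, v'] = 0) :
    v = 0 := by
  have hc := (contMDiffAt_cutChart hred hw).mdifferentiableAt (by simp)
  have hp := (contMDiffAt_cutParam (hχ := hχ) (ξ := ξ) hred
    ((cutChart χ hχ ξ).map_source hw)).mdifferentiableAt (by simp)
  let C : EuclideanSpace ℝ (Fin (2 * n + 2)) →L[ℝ] CutModel n :=
    mfderiv (𝓡 (2 * n + 2)) 𝓘(ℝ, CutModel n) (cutChart χ hχ ξ) w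
  let P : CutModel n →L[ℝ] EuclideanSpace ℝ (Fin (2 * n + 2)) :=
    mfderiv 𝓘(ℝ, CutModel n) (𝓡 (2 * n + 2)) (cutParam χ hχ ξ) (cutChart χ hχ ξ w)
  have hPC : ∀ u, P (C u) = u := fun u => mfderiv_apply_of_leftInverse hp hc rfl
    ((cutChart χ hχ ξ).eventually_left_inverse hw) u
  have hCP : ∀ a, C (P a) = a := fun a => mfderiv_apply_of_leftInverse hc hp
    ((cutChart χ hχ ξ).left_inv hw)
    ((cutChart χ hχ ξ).eventually_right_inverse ((cutChart χ hχ ξ).map_source hw)) a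
  have h1 : ∀ b, cutModelForm n ![C v, b] = 0 := fun b => by
    have h2 := (DForm.pullback_apply_pair (I := 𝓡 (2 * n + 2)) (cutChart χ hχ ξ)
      (cutModelDForm n) w v (P b)).symm.trans (h (P b))
    rw [← hCP b]
    exact h2
  rw [← hPC v, cutModelForm_nondegenerate h1, map_zero]

end CutForm

section ExistenceReduction
variable {n : ℕ} {V : Type*} [TopologicalSpace V]
  [ChartedSpace (EuclideanSpace ℝ (Fin (n + 1))) V]
  [MulAction Circle V] [ContMDiffSMul (𝓡 1) (𝓡 (n + 1)) ∞ Circle V]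
  [IsManifold (𝓡 (n + 1)) ∞ V] {ξ : ℝ} [Nonempty (CutLevel n V ξ)]

/-- In the preferred charts, the form on the symplectic cut has constant coefficients. -/
lemma inChart_cutForm (hV : HasAdaptedCharts n V)
    (c : SymplecticCut n V ξ) :
    letI := cutChartedSpace (ξ := ξ) hV
    ∀ y ∈ (extChartAt (𝓡 (2 * n + 2)) c).target,
      DForm.inChart (𝓡 (2 * n + 2)) (cutForm hV) c y =
        (cutModelForm n).compContinuousLinearMap (cutModelEquiv n).symm := by
  let _ := levelChartedSpace (ξ := ξ) hV
  let _ := cutChartedSpace (ξ := ξ) hV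
  have := isManifold_level (ξ := ξ) hV
  have := isManifold_symplecticCut (ξ := ξ) hV
  have hred : IsSmoothReduction n V ξ := ⟨isSmoothEmbedding_incl hV, isSubmersion_mk hV⟩
  intro y hy
  set j := adaptedChartAt hV (Function.surjInv SymplecticCut.mk_surjective c) with hj
  have hs : ∀ z ∈ (extChartAt (𝓡 (2 * n + 2)) c).target,
      (extChartAt (𝓡 (2 * n + 2)) c).symm z ∈ (cutChart j.1 j.2 ξ).source := fun z hz => by
    have := (extChartAt (𝓡 (2 * n + 2)) c).map_target hz
    rwa [extChartAt_source] at this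
  have h1 := cutForm_eq hV hred (hs y hy)
  have hy' : ∀ᶠ z in 𝓝 y, z ∈ (extChartAt (𝓡 (2 * n + 2)) c).target :=
    (isOpen_extChartAt_target c).mem_nhds hy
  have h2 : cutChart j.1 j.2 ξ ∘ (extChartAt (𝓡 (2 * n + 2)) c).symm =ᶠ[𝓝 y]
      (cutModelEquiv n).symm := by
    filter_upwards [hy'] with z hz
    have h3 := (extChartAt (𝓡 (2 * n + 2)) c).right_inv hz
    exact (cutModelEquiv n).injective (h3.trans ((cutModelEquiv n).apply_symm_apply z).symm)
  have hext : MDifferentiableAt 𝓘(ℝ, EuclideanSpace ℝ (Fin (2 * n + 2))) (𝓡 (2 * n + 2))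
      (extChartAt (𝓡 (2 * n + 2)) c).symm y :=
    ((contMDiffOn_extChartAt_symm (n := ∞) c).contMDiffAt hy').mdifferentiableAt (by simp)
  have h4 := DForm.pullback_comp
    ((contMDiffAt_cutChart hred (hs y hy)).mdifferentiableAt (by simp)) hext (cutModelDForm n)
  rw [DForm.pullback_congr h2] at h4
  have h5 : (mfderiv 𝓘(ℝ, EuclideanSpace ℝ (Fin (2 * n + 2))) 𝓘(ℝ, CutModel n)
      (cutModelEquiv n).symm y : EuclideanSpace ℝ (Fin (2 * n + 2)) →L[ℝ] CutModel n) =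
      ((cutModelEquiv n).symm : EuclideanSpace ℝ (Fin (2 * n + 2)) →L[ℝ] CutModel n) :=
    mfderiv_eq_fderiv.trans (cutModelEquiv n).symm.fderiv
  refine (congrArg (fun σ : EuclideanSpace ℝ (Fin (2 * n + 2)) [⋀^Fin 2]→L[ℝ] ℝ =>
      σ.compContinuousLinearMap (mfderiv 𝓘(ℝ, EuclideanSpace ℝ (Fin (2 * n + 2))) (𝓡 (2 * n + 2))
        (extChartAt (𝓡 (2 * n + 2)) c).symm y)) h1).trans (h4.symm.trans ?_)
  exact congrArg (cutModelForm n).compContinuousLinearMap h5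

/-- The symplectic cut exists: its charts and its form are induced by the adapted charts. -/
lemma exists_isSymplecticReduction (hV : HasAdaptedCharts n V) :
    ∃ (_ : ChartedSpace (EuclideanSpace ℝ (Fin (2 * n + 3))) (CutLevel n V ξ))
      (_ : ChartedSpace (EuclideanSpace ℝ (Fin (2 * n + 2))) (SymplecticCut n V ξ))
      (σ : DForm (𝓡 (2 * n + 2)) (SymplecticCut n V ξ) 2), IsSymplecticReduction σ := by
  let _ := levelChartedSpace (ξ := ξ) hV
  let _ := cutChartedSpace (ξ := ξ) hV
  have hL := isManifold_level (ξ := ξ) hV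
  have hW := isManifold_symplecticCut (ξ := ξ) hV
  have hred : IsSmoothReduction n V ξ := ⟨isSmoothEmbedding_incl hV, isSubmersion_mk hV⟩
  refine ⟨_, _, cutForm hV, hL, hW, hred.embedding, hred.submersion, ⟨fun c => ?_, ?_, ?_⟩, ?_⟩
  · exact contDiffOn_const.congr (inChart_cutForm hV c)
  · funext x
    have h1 : DForm.inChart (𝓡 (2 * n + 2)) (cutForm hV) x =ᶠ[𝓝 (extChartAt (𝓡 (2 * n + 2)) x x)]
        fun _ => (cutModelForm n).compContinuousLinearMap (cutModelEquiv n).symm := by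
      filter_upwards [extChartAt_target_mem_nhds x] with y hy using inChart_cutForm hV x y hy
    have h2 : extDeriv (DForm.inChart (𝓡 (2 * n + 2)) (cutForm hV) x)
        (extChartAt (𝓡 (2 * n + 2)) x x) = 0 := by
      rw [h1.extDeriv_eq]
      rw [extDeriv, fderiv_fun_const]
      exact map_zero (ContinuousAlternatingMap.alternatizeUncurryFinCLM ℝ _ _)
    rw [DForm.d, h2]
    rfl
  · intro w v hv
    refine eq_zero_of_pullback_cutChart hred (mem_cutCharts_source hV w) fun v' => ?_
    exact hv v'
  · funext p
    refine Eq.trans ?_ (pullback_mk_pullback_cutChart hred (mem_levelCharts_source hV p))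
    have h1 := cutForm_eq hV hred (mk_mem_cutChart_source (mem_levelCharts_source hV p))
    exact congrArg (fun σ : EuclideanSpace ℝ (Fin (2 * n + 2)) [⋀^Fin 2]→L[ℝ] ℝ =>
      σ.compContinuousLinearMap (mfderiv (𝓡 (2 * n + 3)) (𝓡 (2 * n + 2)) SymplecticCut.mk p)) h1

end ExistenceReduction

/-! ### The circle action on the symplectic cut -/

/-- The rotation `(q, p, w) ↦ (q, p, u w)`. -/
noncomputable def cutModelRotate (n : ℕ) (u : ℂ) : CutModel n →L[ℝ] CutModel n :=
  (ContinuousLinearMap.fst ℝ _ _).prod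
    ((ContinuousLinearMap.fst ℝ _ _ ∘L ContinuousLinearMap.snd ℝ _ _).prod
      (u • (ContinuousLinearMap.snd ℝ _ _ ∘L ContinuousLinearMap.snd ℝ _ _)))

lemma cutModelRotate_apply {n : ℕ} (u : ℂ) (a : CutModel n) :
    cutModelRotate n u a = (a.1, a.2.1, u * a.2.2) := rfl

lemma cutModelForm_rotate {n : ℕ} (u : Circle) (a b : CutModel n) :
    cutModelForm n ![cutModelRotate n u a, cutModelRotate n u b] = cutModelForm n ![a, b] := by
  have h := Circle.normSq_coe u
  rw [Complex.normSq_apply] at h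
  rw [cutModelForm_apply, cutModelForm_apply, cutModelRotate_apply, cutModelRotate_apply]
  simp only [Complex.mul_re, Complex.mul_im]
  linear_combination (a.2.2.re * b.2.2.im - a.2.2.im * b.2.2.re) * h

lemma hasFDerivAt_cutModel_norm {n : ℕ} (a : CutModel n) :
    HasFDerivAt (fun a : CutModel n => ‖a.2.2‖ ^ 2 / 2)
      (innerSL ℝ a.2.2 ∘L ContinuousLinearMap.snd ℝ _ _ ∘L ContinuousLinearMap.snd ℝ _ _) a := by
  have h1 : HasFDerivAt (fun z : ℂ => ‖z‖ ^ 2 / 2) (innerSL ℝ a.2.2) a.2.2 := by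
    have h := (hasStrictFDerivAt_norm_sq a.2.2).hasFDerivAt.mul_const (2⁻¹ : ℝ)
    simp only [div_eq_mul_inv]
    exact h.congr_fderiv (by rw [smul_comm, ← Nat.cast_smul_eq_nsmul ℝ, smul_smul]; norm_num)
  exact h1.comp a ((ContinuousLinearMap.snd ℝ (EuclideanSpace ℝ (Fin n)) ℂ ∘L
    ContinuousLinearMap.snd ℝ (EuclideanSpace ℝ (Fin n)) _).hasFDerivAt)

/-- The vector field `i w ∂ / ∂w` is the Hamiltonian vector field of `|w|² / 2`. -/
lemma cutModelForm_vectorField {n : ℕ} (a b : CutModel n) :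
    cutModelForm n ![(0, 0, Complex.I * a.2.2), b] = -inner ℝ a.2.2 b.2.2 := by
  rw [cutModelForm_apply, Complex.inner]
  simp
  ring

lemma cutModelRotate_mem_cutDomain {n : ℕ} {V : Type*} [TopologicalSpace V]
    {χ : OpenPartialHomeomorph V (EuclideanSpace ℝ (Fin n) × ℝ)} (u : ℂ)
    {a : CutModel n} (ha : a ∈ cutDomain χ) :
    cutModelRotate n u a ∈ cutDomain χ := ha

section CutAction
variable {n : ℕ} {V : Type*} [TopologicalSpace V]
  [ChartedSpace (EuclideanSpace ℝ (Fin (n + 1))) V] [MulAction Circle V] {ξ : ℝ}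

lemma CutLevel.incl_rotate (u : Circle) (p : CutLevel n V ξ) :
    (p.rotate u).incl = (p.incl.1, u * p.incl.2) := rfl

variable [ContMDiffSMul (𝓡 1) (𝓡 (n + 1)) ∞ Circle V] [IsManifold (𝓡 (n + 1)) ∞ V]

lemma SymplecticCut.smul_mk (u : Circle) (p : CutLevel n V ξ) :
    u • SymplecticCut.mk p = SymplecticCut.mk (p.rotate u) := rfl

lemma SymplecticCut.hamiltonian_mk (p : CutLevel n V ξ) :
    SymplecticCut.hamiltonian (SymplecticCut.mk p) = ‖p.incl.2‖ ^ 2 / 2 := rfl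

lemma SymplecticCut.hamiltonian_smul (u : Circle) (w : SymplecticCut n V ξ) :
    SymplecticCut.hamiltonian (u • w) = SymplecticCut.hamiltonian w := by
  obtain ⟨p, rfl⟩ := SymplecticCut.mk_surjective w
  rw [SymplecticCut.smul_mk, SymplecticCut.hamiltonian_mk, SymplecticCut.hamiltonian_mk,
    CutLevel.incl_rotate, norm_mul, Circle.norm_coe, one_mul]

end CutAction

section Action
variable {n : ℕ} {V : Type*} [TopologicalSpace V]
  [ChartedSpace (EuclideanSpace ℝ (Fin (n + 1))) V]
  [MulAction Circle V] [ContMDiffSMul (𝓡 1) (𝓡 (n + 1)) ∞ Circle V]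
  [IsManifold (𝓡 (n + 1)) ∞ V] {ξ : ℝ} [Nonempty (CutLevel n V ξ)]
  {χ : OpenPartialHomeomorph V (EuclideanSpace ℝ (Fin n) × ℝ)} {hχ : IsAdaptedChart χ}

/-- In the charts induced by adapted charts, the circle acts by rotations of the coordinate `w`. -/
lemma smul_cutParam (u : Circle) {a : CutModel n} (ha : a ∈ cutDomain χ) :
    u • cutParam χ hχ ξ a = cutParam χ hχ ξ (cutModelRotate n u a) := by
  rw [cutParam, cutParam, SymplecticCut.smul_mk]
  congr 1
  apply CutLevel.incl_injective
  rw [CutLevel.incl_rotate, incl_levelChart_symm (zero_mem_levelChart_target ha),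
    incl_levelChart_symm (zero_mem_levelChart_target (cutModelRotate_mem_cutDomain u ha)),
    ambientChart_symm_apply, ambientChart_symm_apply, cutModelRotate_apply]
  simp [mul_left_comm, Circle.norm_coe]

lemma hamiltonian_cutParam {a : CutModel n} (ha : a ∈ cutDomain χ) :
    SymplecticCut.hamiltonian (cutParam χ hχ ξ a) = ‖a.2.2‖ ^ 2 / 2 := by
  rw [cutParam, SymplecticCut.hamiltonian_mk,
    incl_levelChart_symm (zero_mem_levelChart_target ha), ambientChart_symm_apply]
  simp

lemma smul_mem_cutChart_source (u : Circle) {w : SymplecticCut n V ξ}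
    (hw : w ∈ (cutChart χ hχ ξ).source) : u • w ∈ (cutChart χ hχ ξ).source := by
  have ha := (cutChart χ hχ ξ).map_source hw
  rw [← (cutChart χ hχ ξ).left_inv hw, cutChart_symm_apply, smul_cutParam u ha]
  exact (cutChart χ hχ ξ).map_target (cutModelRotate_mem_cutDomain u ha)

lemma cutChart_smul (u : Circle) {w : SymplecticCut n V ξ} (hw : w ∈ (cutChart χ hχ ξ).source) :
    cutChart χ hχ ξ (u • w) = cutModelRotate n u (cutChart χ hχ ξ w) := by
  have ha := (cutChart χ hχ ξ).map_source hw
  conv_lhs => rw [← (cutChart χ hχ ξ).left_inv hw, cutChart_symm_apply, smul_cutParam u ha]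
  exact (cutChart χ hχ ξ).right_inv (cutModelRotate_mem_cutDomain u ha)

lemma hamiltonian_eq_cutChart {w : SymplecticCut n V ξ} (hw : w ∈ (cutChart χ hχ ξ).source) :
    SymplecticCut.hamiltonian w = ‖(cutChart χ hχ ξ w).2.2‖ ^ 2 / 2 := by
  conv_lhs => rw [← (cutChart χ hχ ξ).left_inv hw]
  exact hamiltonian_cutParam ((cutChart χ hχ ξ).map_source hw)

variable [ChartedSpace (EuclideanSpace ℝ (Fin (2 * n + 3))) (CutLevel n V ξ)]
  [ChartedSpace (EuclideanSpace ℝ (Fin (2 * n + 2))) (SymplecticCut n V ξ)]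

lemma contMDiff_circle_coe : ContMDiff (𝓡 1) 𝓘(ℝ, ℂ) ∞ (fun u : Circle => (u : ℂ)) :=
  have : Fact (Module.finrank ℝ ℂ = 1 + 1) := finrank_real_complex_fact'
  contMDiff_coe_sphere

lemma contMDiffAt_smul_cut (hred : IsSmoothReduction n V ξ)
    (u : Circle) {w : SymplecticCut n V ξ} (hw : w ∈ (cutChart χ hχ ξ).source) :
    ContMDiffAt ((𝓡 1).prod (𝓡 (2 * n + 2))) (𝓡 (2 * n + 2)) ∞
      (fun p : Circle × SymplecticCut n V ξ => p.1 • p.2) (u, w) := by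
  have h1 : ContMDiffAt ((𝓡 1).prod (𝓡 (2 * n + 2))) 𝓘(ℝ, CutModel n) ∞
      (fun p : Circle × SymplecticCut n V ξ => cutChart χ hχ ξ p.2) (u, w) :=
    ContMDiffAt.comp (u, w) (contMDiffAt_cutChart hred hw) contMDiffAt_snd
  have h2 : ContMDiffAt ((𝓡 1).prod (𝓡 (2 * n + 2))) 𝓘(ℝ, ℂ) ∞
      (fun p : Circle × SymplecticCut n V ξ => (p.1 : ℂ)) (u, w) :=
    contMDiff_circle_coe.contMDiffAt.comp (u, w) contMDiffAt_fst
  have h3 : ContDiff ℝ ∞ fun y : ℂ × CutModel n => cutModelRotate n y.1 y.2 := by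
    simp only [cutModelRotate_apply]
    fun_prop
  have h4 : ContMDiffAt ((𝓡 1).prod (𝓡 (2 * n + 2))) 𝓘(ℝ, CutModel n) ∞
      (fun p : Circle × SymplecticCut n V ξ =>
        cutModelRotate n p.1 (cutChart χ hχ ξ p.2)) (u, w) :=
    h3.contMDiff.contMDiffAt.comp (u, w) (h2.prodMk_space h1)
  refine (ContMDiffAt.comp (u, w) (contMDiffAt_cutParam (hχ := hχ) (ξ := ξ) hred
    (cutModelRotate_mem_cutDomain u ((cutChart χ hχ ξ).map_source hw))) h4).congr_of_eventuallyEq ?_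
  filter_upwards [continuousAt_snd.preimage_mem_nhds
    ((cutChart χ hχ ξ).open_source.mem_nhds hw)] with p hp
  conv_lhs => rw [← (cutChart χ hχ ξ).left_inv hp]
  exact smul_cutParam p.1 ((cutChart χ hχ ξ).map_source hp)

/-- In the charts induced by adapted charts, the tangent map of the action is the rotation of the
coordinate `w`. -/
lemma mfderiv_cutChart_smul (hred : IsSmoothReduction n V ξ)
    (u : Circle) {w : SymplecticCut n V ξ} (hw : w ∈ (cutChart χ hχ ξ).source)
    (v : EuclideanSpace ℝ (Fin (2 * n + 2))) :
    (mfderiv (𝓡 (2 * n + 2)) 𝓘(ℝ, CutModel n) (cutChart χ hχ ξ) (u • w) :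
        EuclideanSpace ℝ (Fin (2 * n + 2)) →L[ℝ] CutModel n)
      ((mfderiv (𝓡 (2 * n + 2)) (𝓡 (2 * n + 2)) (fun w : SymplecticCut n V ξ => u • w) w :
        EuclideanSpace ℝ (Fin (2 * n + 2)) →L[ℝ] EuclideanSpace ℝ (Fin (2 * n + 2))) v) =
    cutModelRotate n u ((mfderiv (𝓡 (2 * n + 2)) 𝓘(ℝ, CutModel n) (cutChart χ hχ ξ) w :
        EuclideanSpace ℝ (Fin (2 * n + 2)) →L[ℝ] CutModel n) v) := by
  have hc := fun {w : SymplecticCut n V ξ} (hw : w ∈ (cutChart χ hχ ξ).source) =>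
    (contMDiffAt_cutChart hred hw).mdifferentiableAt (by simp)
  have hu : MDifferentiableAt (𝓡 (2 * n + 2)) (𝓡 (2 * n + 2))
      (fun w : SymplecticCut n V ξ => u • w) w :=
    ((contMDiffAt_smul_cut hred u hw).comp w
      (contMDiffAt_const.prodMk contMDiffAt_id)).mdifferentiableAt (by simp)
  have h1 : cutChart χ hχ ξ ∘ (fun w : SymplecticCut n V ξ => u • w) =ᶠ[𝓝 w]
      cutModelRotate n u ∘ cutChart χ hχ ξ := by
    filter_upwards [(cutChart χ hχ ξ).open_source.mem_nhds hw] with z hz using cutChart_smul u hz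
  have h2 := h1.mfderiv_eq (I := 𝓡 (2 * n + 2)) (I' := 𝓘(ℝ, CutModel n))
  rw [mfderiv_comp w (hc (smul_mem_cutChart_source u hw)) hu,
    mfderiv_comp w (cutModelRotate n u).differentiableAt.mdifferentiableAt (hc hw),
    (mfderiv_eq_fderiv.trans (cutModelRotate n (u : ℂ)).fderiv :)] at h2
  exact DFunLike.congr_fun h2 v

/-- The symplectic form in the chart induced by an adapted chart. -/
lemma IsSymplecticReduction.form_apply {σ : DForm (𝓡 (2 * n + 2)) (SymplecticCut n V ξ) 2}
    (h : IsSymplecticReduction σ) {w : SymplecticCut n V ξ} (hw : w ∈ (cutChart χ hχ ξ).source)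
    (u v : EuclideanSpace ℝ (Fin (2 * n + 2))) :
    (σ w : EuclideanSpace ℝ (Fin (2 * n + 2)) [⋀^Fin 2]→L[ℝ] ℝ) ![u, v] = cutModelForm n
      ![(mfderiv (𝓡 (2 * n + 2)) 𝓘(ℝ, CutModel n) (cutChart χ hχ ξ) w :
        EuclideanSpace ℝ (Fin (2 * n + 2)) →L[ℝ] CutModel n) u,
        (mfderiv (𝓡 (2 * n + 2)) 𝓘(ℝ, CutModel n) (cutChart χ hχ ξ) w :
        EuclideanSpace ℝ (Fin (2 * n + 2)) →L[ℝ] CutModel n) v] := by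
  obtain ⟨p, rfl, hp, -⟩ := exists_mem_levelChart_source_inter hw hw
  have h1 := eq_pullback_cutChart h.isSmoothReduction hp (congrFun h.pullback_eq p)
  rw [h1]
  exact DForm.pullback_apply_pair (I := 𝓡 (2 * n + 2)) (cutChart χ hχ ξ) (cutModelDForm n) _ u v

/-- In the charts induced by adapted charts, the fundamental vector field is `i w ∂ / ∂w`. -/
lemma mfderiv_cutChart_circleVectorField (hred : IsSmoothReduction n V ξ)
    {w : SymplecticCut n V ξ} (hw : w ∈ (cutChart χ hχ ξ).source) :
    (mfderiv (𝓡 (2 * n + 2)) 𝓘(ℝ, CutModel n) (cutChart χ hχ ξ) w :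
        EuclideanSpace ℝ (Fin (2 * n + 2)) →L[ℝ] CutModel n)
      (circleVectorField (𝓡 (2 * n + 2)) w) =
    (0, 0, Complex.I * (cutChart χ hχ ξ w).2.2) := by
  have hc := (contMDiffAt_cutChart hred hw).mdifferentiableAt (by simp)
  have h0 : Circle.exp 0 • w = w := by simp
  have hγ : MDifferentiableAt 𝓘(ℝ, ℝ) (𝓡 (2 * n + 2)) (fun t : ℝ => Circle.exp t • w) 0 := by
    have h1 : ContMDiffAt ((𝓡 1).prod (𝓡 (2 * n + 2))) (𝓡 (2 * n + 2)) ∞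
      (fun p : Circle × SymplecticCut n V ξ => p.1 • p.2) (Circle.exp 0, w) :=
      contMDiffAt_smul_cut hred _ hw
    exact (ContMDiffAt.comp (0 : ℝ) h1
      (contMDiff_circleExp.contMDiffAt.prodMk contMDiffAt_const)).mdifferentiableAt (by simp)
  set a := cutChart χ hχ ξ w with ha
  have h1 : cutChart χ hχ ξ ∘ (fun t : ℝ => Circle.exp t • w) =
      fun t : ℝ => (a.1, a.2.1, (Circle.exp t : ℂ) * a.2.2) := by
    funext t
    rw [Function.comp, cutChart_smul _ hw, cutModelRotate_apply]
  have h2 : HasDerivAt (fun t : ℝ => (Circle.exp t : ℂ) * a.2.2) (Complex.I * a.2.2) 0 := by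
    have h3 : HasDerivAt (fun t : ℝ => (Circle.exp t : ℂ)) Complex.I 0 := by
      have := ((Complex.ofRealCLM.hasDerivAt (x := (0 : ℝ))).mul_const Complex.I).cexp
      simpa [Circle.coe_exp] using this
    exact h3.mul_const _
  have h3 : HasDerivAt (fun t : ℝ => (a.1, a.2.1, (Circle.exp t : ℂ) * a.2.2))
      ((0, 0, Complex.I * a.2.2) : CutModel n) 0 :=
    (hasDerivAt_const _ _).prodMk ((hasDerivAt_const _ _).prodMk h2)
  have h4 : mfderiv 𝓘(ℝ, ℝ) 𝓘(ℝ, CutModel n)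
      (cutChart χ hχ ξ ∘ (fun t : ℝ => Circle.exp t • w)) 0 = _ :=
    mfderiv_comp_of_eq hc hγ h0
  rw [h1, mfderiv_eq_fderiv, h3.hasFDerivAt.fderiv] at h4
  have h5 : ∀ z, z = w → (mfderiv (𝓡 (2 * n + 2)) 𝓘(ℝ, CutModel n) (cutChart χ hχ ξ) z :
      EuclideanSpace ℝ (Fin (2 * n + 2)) →L[ℝ] CutModel n) =
      mfderiv (𝓡 (2 * n + 2)) 𝓘(ℝ, CutModel n) (cutChart χ hχ ξ) w := by rintro _ rfl; rfl
  have h6 : ContinuousLinearMap.toSpanSingleton ℝ ((0, 0, Complex.I * a.2.2) : CutModel n) 1 =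
    (0, 0, Complex.I * a.2.2) := by rw [ContinuousLinearMap.toSpanSingleton_apply, one_smul]
  rw [← h5 _ h0]
  exact (DFunLike.congr_fun h4 (1 : ℝ)).symm.trans h6

/-- The circle acts on the symplectic cut by symplectic diffeomorphisms, with Hamiltonian
`|z|² / 2`. -/
lemma IsSymplecticReduction.isHamiltonianCircleAction
    (hV : HasAdaptedCharts n V)
    {σ : DForm (𝓡 (2 * n + 2)) (SymplecticCut n V ξ) 2} (h : IsSymplecticReduction σ) :
    IsHamiltonianCircleAction (𝓡 (2 * n + 2)) σ
        (SymplecticCut.hamiltonian : SymplecticCut n V ξ → ℝ) where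
  smooth_action := fun ⟨u, w⟩ =>
    contMDiffAt_smul_cut h.isSmoothReduction u (mem_cutCharts_source hV w)
  symplectic := by
    intro u
    funext w
    have hw := mem_cutCharts_source hV w
    refine ContinuousAlternatingMap.ext fun v => ?_
    have hv : v = ![v 0, v 1] := by ext i : 1; fin_cases i <;> rfl
    rw [hv]
    refine (DForm.pullback_apply_pair (I := 𝓡 (2 * n + 2))
      (fun w : SymplecticCut n V ξ => u • w) σ w _ _).trans ?_
    refine (h.form_apply (smul_mem_cutChart_source u hw) _ _).trans
      (Eq.trans ?_ (h.form_apply hw _ _).symm)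
    exact (congrArg₂ (fun a b : CutModel n => cutModelForm n ![a, b])
      (mfderiv_cutChart_smul h.isSmoothReduction u hw _)
      (mfderiv_cutChart_smul h.isSmoothReduction u hw _)).trans (cutModelForm_rotate u _ _)
  smooth_hamiltonian := by
    intro w
    have hw := mem_cutCharts_source hV w
    have h1 : ContDiff ℝ ∞ fun a : CutModel n => ‖a.2.2‖ ^ 2 / 2 :=
      contDiff_norm_sq_div_two.comp (contDiff_snd.comp contDiff_snd)
    refine (h1.contMDiff.contMDiffAt.comp w
      (contMDiffAt_cutChart h.isSmoothReduction hw)).congr_of_eventuallyEq ?_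
    filter_upwards [(cutCharts n V ξ _).open_source.mem_nhds hw] with z hz
      using hamiltonian_eq_cutChart hz
  invariant := SymplecticCut.hamiltonian_smul
  hamiltonian := by
    intro w v
    have hw := mem_cutCharts_source hV w
    have hc := (contMDiffAt_cutChart h.isSmoothReduction hw).mdifferentiableAt (by simp)
    refine (h.form_apply hw _ _).trans ?_
    rw [mfderiv_cutChart_circleVectorField h.isSmoothReduction hw]
    have h1 : SymplecticCut.hamiltonian =ᶠ[𝓝 w] (fun a : CutModel n => ‖a.2.2‖ ^ 2 / 2) ∘
        cutCharts n V ξ (adaptedChartAt hV (Function.surjInv SymplecticCut.mk_surjective w)) := by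
      filter_upwards [(cutCharts n V ξ _).open_source.mem_nhds hw] with z hz
        using hamiltonian_eq_cutChart hz
    have h2 := (h1.mfderiv_eq (I := 𝓡 (2 * n + 2)) (I' := 𝓘(ℝ, ℝ))).trans
      (mfderiv_comp w (hasFDerivAt_cutModel_norm _).differentiableAt.mdifferentiableAt hc)
    have h3 := (mfderiv_eq_fderiv (f := fun a : CutModel n => ‖a.2.2‖ ^ 2 / 2)).trans
      (hasFDerivAt_cutModel_norm (cutCharts n V ξ
        (adaptedChartAt hV (Function.surjInv SymplecticCut.mk_surjective w)) w)).fderiv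
    have h4 := (DFunLike.congr_fun h2 v).trans (DFunLike.congr_fun h3 _)
    refine Eq.trans ?_ (congrArg Neg.neg h4).symm
    exact cutModelForm_vectorField _ _

end Action

/-! ### Weights -/

/-- The trace of the action in terms of its weights. -/
lemma trace_eq_sum_weights {T : Type*} [AddCommGroup T] [Module ℝ T] {A J : T →ₗ[ℝ] T}
    {k : ℕ} (hJ : ∀ a, J (J a) = -a)
    (hAJ : ∀ a, A (J a) = J (A a))
    (b : Module.Basis (Fin k ⊕ Fin k) ℝ T) (hb : ∀ j, b (Sum.inr j) = J (b (Sum.inl j)))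
    (z : Fin k → ℂ)
    (hA : ∀ j, A (b (Sum.inl j)) = (z j).re • b (Sum.inl j) + (z j).im • J (b (Sum.inl j))) :
    LinearMap.trace ℝ T A = 2 * ∑ j, (z j).re := by
  rw [LinearMap.trace_eq_matrix_trace ℝ b, Matrix.trace, Fintype.sum_sum_type, two_mul]
  congr 1
  · refine Finset.sum_congr rfl fun j _ => ?_
    rw [Matrix.diag_apply, LinearMap.toMatrix_apply, hA, ← hb]
    simp
  · refine Finset.sum_congr rfl fun j _ => ?_
    rw [Matrix.diag_apply, LinearMap.toMatrix_apply, hb, hAJ, hA, map_add, map_smul, map_smul, hJ,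
      ← hb]
    simp

section Weights
variable {n : ℕ} {T : Type*} [AddCommGroup T] [Module ℝ T] [TopologicalSpace T]

/-- The `cutModelJ`-complex basis `(e₁, 0, 0), …, (eₙ, 0, 0), (0, 0, 1)` of `ℝⁿ × ℝⁿ × ℂ`. -/
noncomputable def cutModelBasisFun (n : ℕ) : Fin (n + 1) → CutModel n :=
  Fin.lastCases (0, 0, 1) fun j => (EuclideanSpace.single j 1, 0, 0)

lemma sum_smul_cutModelBasisFun (c : Fin (n + 1) → ℝ) :
    ∑ j, c j • cutModelBasisFun n j =
      (WithLp.toLp 2 fun j : Fin n => c j.castSucc, 0, (c (Fin.last n) : ℂ)) := by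
  rw [Fin.sum_univ_castSucc]
  simp only [cutModelBasisFun, Fin.lastCases_castSucc, Fin.lastCases_last]
  refine Prod.ext ?_ (Prod.ext ?_ ?_)
  · ext i
    simp [Prod.fst_sum, Finset.sum_apply, Pi.single_apply]
  · simp [Prod.snd_sum]
  · simp [Prod.snd_sum]

lemma linearIndependent_cutModelBasisFun : LinearIndependent ℝ
    (Sum.elim (cutModelBasisFun n) (fun j => cutModelJ n (cutModelBasisFun n j))) := by
  rw [Fintype.linearIndependent_iff]
  intro c hc
  rw [Fintype.sum_sum_type] at hc
  simp only [Sum.elim_inl, Sum.elim_inr, ← map_smul, ← map_sum] at hc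
  rw [sum_smul_cutModelBasisFun fun j => c (Sum.inl j),
    sum_smul_cutModelBasisFun fun j => c (Sum.inr j), cutModelJ_apply] at hc
  have h1 : ∀ j : Fin n, c (Sum.inl j.castSucc) = 0 := fun j => by
    simpa using congrArg (fun a : CutModel n => a.1 j) hc
  have h2 : ∀ j : Fin n, c (Sum.inr j.castSucc) = 0 := fun j => by
    simpa using congrArg (fun a : CutModel n => a.2.1 j) hc
  have h3 : c (Sum.inl (Fin.last n)) = 0 := by
    simpa using congrArg (fun a : CutModel n => a.2.2.re) hc
  have h4 : c (Sum.inr (Fin.last n)) = 0 := by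
    simpa using congrArg (fun a : CutModel n => a.2.2.im) hc
  rintro (j | j)
  · exact Fin.lastCases h3 h1 j
  · exact Fin.lastCases h4 h2 j

/-- The weights of the action of the circle on `ℝⁿ × ℝⁿ × ℂ` by rotations of the last factor are
`0, …, 0, 1`. -/
lemma cutModelRotate_basisFun (u : Circle) (j : Fin (n + 1)) :
    cutModelRotate n u (cutModelBasisFun n j) =
      ((u ^ (Fin.lastCases 1 (fun _ => 0) j : ℤ) : Circle) : ℂ).re • cutModelBasisFun n j +
      ((u ^ (Fin.lastCases 1 (fun _ => 0) j : ℤ) : Circle) : ℂ).im •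
        cutModelJ n (cutModelBasisFun n j) := by
  induction j using Fin.lastCases with
  | last =>
    simp only [cutModelBasisFun, Fin.lastCases_last, cutModelRotate_apply, cutModelJ_apply,
      zpow_one]
    refine Prod.ext (by simp) (Prod.ext (by simp) ?_)
    apply Complex.ext <;> simp
  | cast j =>
    simp [cutModelBasisFun, cutModelRotate_apply]

/-- A circle action on a symplectic vector space that is conjugate to the rotation of the last
factor of `ℝⁿ × ℝⁿ × ℂ` has weights. -/
lemma exists_weights (C : T ≃L[ℝ] CutModel n) (σ : T [⋀^Fin 2]→L[ℝ] ℝ)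
    (hσ : ∀ a b, σ ![a, b] = cutModelForm n ![C a, C b]) (A : Circle → T →L[ℝ] T)
    (hA : ∀ u a, C (A u a) = cutModelRotate n u (C a)) :
    ∃ m : Fin (n + 1) → ℤ, ∃ J : T →L[ℝ] T,
      (∀ a, J (J a) = -a) ∧ (∀ a b, σ ![J a, J b] = σ ![a, b]) ∧
      (∀ a, a ≠ 0 → 0 < σ ![a, J a]) ∧ (∀ u a, A u (J a) = J (A u a)) ∧
      ∃ b : Module.Basis (Fin (n + 1) ⊕ Fin (n + 1)) ℝ T,
        (∀ j, b (Sum.inr j) = J (b (Sum.inl j))) ∧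
        ∀ (u : Circle) (j : Fin (n + 1)), A u (b (Sum.inl j)) =
          ((u ^ m j : Circle) : ℂ).re • b (Sum.inl j) +
          ((u ^ m j : Circle) : ℂ).im • J (b (Sum.inl j)) := by
  have hJJ : ∀ a, cutModelJ n (cutModelJ n a) = -a := fun a => by
    simp [cutModelJ_apply, ← mul_assoc]
    rfl
  have hcard : Fintype.card (Fin (n + 1) ⊕ Fin (n + 1)) = Module.finrank ℝ (CutModel n) := by
    simp; ring
  let b := basisOfLinearIndependentOfCardEqFinrank
    (linearIndependent_cutModelBasisFun (n := n)) hcard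
  have hb : ⇑b = Sum.elim (cutModelBasisFun n) (fun j => cutModelJ n (cutModelBasisFun n j)) :=
    coe_basisOfLinearIndependentOfCardEqFinrank _ _
  refine ⟨Fin.lastCases 1 fun _ => 0, C.symm.toContinuousLinearMap ∘L cutModelJ n ∘L
    C.toContinuousLinearMap, fun a => ?_, fun a c => ?_, fun a ha => ?_, fun u a => ?_,
    b.map C.symm.toLinearEquiv, fun j => ?_, fun u j => ?_⟩
  · simp [hJJ]
  · rw [hσ, hσ]
    simp [cutModelForm_apply, cutModelJ_apply]
    rw [real_inner_comm (C c).2.1 (C a).1, real_inner_comm (C a).2.1 (C c).1]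
    ring
  · rw [hσ]
    simpa using cutModelForm_self_J (a := C a) (by simpa using ha)
  · apply C.injective
    rw [hA]
    simp [hA, cutModelJ_apply, cutModelRotate_apply]
    ring
  · simp [hb]
  · apply C.injective
    rw [hA]
    simp [hb, cutModelRotate_basisFun]

lemma trace_cutModelRotate (u : ℂ) :
    LinearMap.trace ℝ (CutModel n) (cutModelRotate n u) = 2 * n + 2 * u.re := by
  have h : ((cutModelRotate n u : CutModel n →L[ℝ] CutModel n) : CutModel n →ₗ[ℝ] CutModel n) =
      LinearMap.prodMap LinearMap.id (LinearMap.prodMap LinearMap.id (Algebra.lmul ℝ ℂ u)) := by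
    ext <;> simp [cutModelRotate_apply]
  rw [h, LinearMap.trace_prodMap', LinearMap.trace_prodMap', LinearMap.trace_id,
    ← Algebra.trace_apply, Algebra.trace_complex_apply]
  simp
  ring

/-- Integers with `∑ (1 - Re u ^ mⱼ) = 1 - Re u` on the circle are all `0`, except for one which is
`1` or `-1`. -/
lemma exists_weight_eq_one_or_neg_one {m : Fin (n + 1) → ℤ}
    (h : ∀ u : Circle, ∑ j, ((u ^ m j : Circle) : ℂ).re = n + (u : ℂ).re) :
    ∃ j, (m j = 1 ∨ m j = -1) ∧ ∀ i, i ≠ j → m i = 0 := by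
  have hexp : ∀ (k : ℤ) (t : ℝ), ((Circle.exp t ^ k : Circle) : ℂ).re = Real.cos (k * t) := by
    intro k t
    rw [← Circle.exp_zsmul, zsmul_eq_mul, Circle.coe_exp, Complex.exp_ofReal_mul_I_re]
  have h1 : ∀ t : ℝ, ∑ j, (1 - Real.cos (m j * t)) = 1 - Real.cos t := by
    intro t
    have := h (Circle.exp t)
    have h0 := hexp 1 t
    simp only [hexp] at this
    simp only [zpow_one, Int.cast_one, one_mul] at h0
    rw [h0] at this
    rw [Finset.sum_sub_distrib, this]
    simp
  have hnn : ∀ (t : ℝ) (j : Fin (n + 1)), 0 ≤ 1 - Real.cos (m j * t) := fun t j =>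
    sub_nonneg.2 (Real.cos_le_one _)
  -- At `t = π / m`, the term of a weight `m` with `|m| ≥ 2` would be too large.
  have habs : ∀ j, m j ^ 2 ≤ 1 := by
    intro j
    by_contra! hj
    have hm0 : m j ≠ 0 := by rintro h0; simp [h0] at hj
    have hm0' : (m j : ℝ) ≠ 0 := by exact_mod_cast hm0
    have h2 := Finset.single_le_sum (fun i _ => hnn (Real.pi / m j) i) (Finset.mem_univ j)
    rw [h1, mul_div_cancel₀ _ hm0', Real.cos_pi] at h2
    have h3 : Real.cos (Real.pi / m j) = -1 := by
      linarith [Real.neg_one_le_cos (Real.pi / m j)]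
    obtain ⟨k, hk⟩ := Real.cos_eq_neg_one_iff.1 h3
    have h4 : m j * (1 + 2 * k) = 1 := by
      have : (m j : ℝ) * (1 + 2 * k) = 1 := by
        have hpi := Real.pi_pos.ne'
        field_simp at hk
        linarith
      exact_mod_cast this
    have h5 := Int.eq_one_or_neg_one_of_mul_eq_one h4
    rcases h5 with h5 | h5 <;> simp [h5] at hj
  have hcase : ∀ j, m j = -1 ∨ m j = 0 ∨ m j = 1 := fun j => by
    have h2 := habs j
    have h3 : -1 ≤ m j := by nlinarith
    have h4 : m j ≤ 1 := by nlinarith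
    omega
  have hsum : ∑ j, m j ^ 2 = 1 := by
    have h2 := h1 Real.pi
    have h3 : ∀ j, 1 - Real.cos (m j * Real.pi) = 2 * (m j : ℝ) ^ 2 := by
      intro j
      rcases hcase j with h3 | h3 | h3 <;> simp [h3] <;> norm_num
    simp only [h3, Real.cos_pi, ← Finset.mul_sum] at h2
    have h4 : (∑ j, (m j : ℝ) ^ 2) = 1 := by linarith
    exact_mod_cast h4
  obtain ⟨j, hj⟩ : ∃ j, m j ≠ 0 := by
    by_contra! h0
    simp [h0] at hsum
  refine ⟨j, ?_, fun i hi => ?_⟩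
  · rcases hcase j with h2 | h2 | h2
    · exact Or.inr h2
    · exact absurd h2 hj
    · exact Or.inl h2
  · have h2 : ∑ i ∈ {j, i}, m i ^ 2 ≤ ∑ i, m i ^ 2 :=
      Finset.sum_le_univ_sum_of_nonneg fun i => sq_nonneg (m i)
    rw [Finset.sum_pair hi.symm, hsum] at h2
    have h3 : 0 < m j ^ 2 := by positivity
    have h4 : m i ^ 2 = 0 := by nlinarith [sq_nonneg (m i)]
    exact pow_eq_zero_iff (two_ne_zero) |>.1 h4

/-- The sum of the weights is independent of the complex structure `J`. The trace determines the
weights up to signs, and the sign of the only nonzero weight is determined by the positivity of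
`σ (·, J ·)`. -/
lemma sum_weights_eq_one (C : T ≃L[ℝ] CutModel n) (σ : T [⋀^Fin 2]→L[ℝ] ℝ)
    (hσ : ∀ a b, σ ![a, b] = cutModelForm n ![C a, C b]) (A : Circle → T →L[ℝ] T)
    (hA : ∀ u a, C (A u a) = cutModelRotate n u (C a)) {m : Fin (n + 1) → ℤ} {J : T →L[ℝ] T}
    (hJ : ∀ a, J (J a) = -a) (hpos : ∀ a, a ≠ 0 → 0 < σ ![a, J a])
    (hAJ : ∀ u a, A u (J a) = J (A u a))
    (b : Module.Basis (Fin (n + 1) ⊕ Fin (n + 1)) ℝ T)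
    (hb : ∀ j, b (Sum.inr j) = J (b (Sum.inl j)))
    (hAb : ∀ (u : Circle) (j : Fin (n + 1)), A u (b (Sum.inl j)) =
          ((u ^ m j : Circle) : ℂ).re • b (Sum.inl j) +
          ((u ^ m j : Circle) : ℂ).im • J (b (Sum.inl j))) :
    ∑ j, m j = 1 := by
  have h : ∀ u : Circle, ∑ j, ((u ^ m j : Circle) : ℂ).re = n + (u : ℂ).re := by
    intro u
    have h1 := trace_eq_sum_weights (A := (A u : T →ₗ[ℝ] T)) (J := (J : T →ₗ[ℝ] T)) hJ (hAJ u) b hb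
      (fun j => ((u ^ m j : Circle) : ℂ)) (hAb u)
    have h2 : ((cutModelRotate n u : CutModel n →L[ℝ] CutModel n) : CutModel n →ₗ[ℝ] CutModel n) =
        C.toLinearEquiv.conj (A u : T →ₗ[ℝ] T) := by
      refine LinearMap.ext fun a => ?_
      simp [LinearEquiv.conj_apply, hA]
    have h3 := trace_cutModelRotate (n := n) (u : ℂ)
    rw [h2, LinearMap.trace_conj', h1] at h3
    linarith
  obtain ⟨j, hj, hi⟩ := exists_weight_eq_one_or_neg_one h
  rw [Finset.sum_eq_single j (fun i _ hij => hi i hij) (by simp)]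
  refine hj.resolve_right fun hj => ?_
  -- For the weight `-1`, the quarter turn would be `-J`, while it is nonnegative.
  let u := Circle.exp (Real.pi / 2)
  have hu : (u : ℂ) = Complex.I := by
    rw [Circle.coe_exp]
    simp
  have h1 : A u (b (Sum.inl j)) = -J (b (Sum.inl j)) := by
    rw [hAb, hj, zpow_neg_one, Circle.coe_inv, hu]
    simp
  have h2 := hpos _ (b.ne_zero (Sum.inl j))
  have h3 : 0 ≤ σ ![b (Sum.inl j), A u (b (Sum.inl j))] := by
    rw [hσ, hA, hu, cutModelForm_apply, cutModelRotate_apply]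
    simp
    nlinarith [sq_nonneg (C (b (Sum.inl j))).2.2.re, sq_nonneg (C (b (Sum.inl j))).2.2.im]
  have h4 : σ ![b (Sum.inl j), -J (b (Sum.inl j))] = -σ ![b (Sum.inl j), J (b (Sum.inl j))] := by
    rw [hσ, hσ, map_neg]
    simp [cutModelForm_apply]
    ring
  rw [h1, h4] at h3
  linarith

end Weights

/-! ### Fixed points -/

section FixedPoints
variable {n : ℕ} {V : Type*} [TopologicalSpace V]
  [ChartedSpace (EuclideanSpace ℝ (Fin (n + 1))) V]
  [MulAction Circle V] [ContMDiffSMul (𝓡 1) (𝓡 (n + 1)) ∞ Circle V]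
  [IsManifold (𝓡 (n + 1)) ∞ V] {ξ : ℝ}

lemma ReducedSpace.range_toCut :
    range (ReducedSpace.toCut : ReducedSpace n V ξ → SymplecticCut n V ξ) =
      {w | SymplecticCut.hamiltonian w = 0} := by
  ext w
  constructor
  · rintro ⟨r, rfl⟩
    induction r using Quotient.inductionOn with
    | h p =>
      change ‖(0 : ℂ)‖ ^ 2 / 2 = 0
      simp
  · intro hw
    obtain ⟨p, rfl⟩ := SymplecticCut.mk_surjective w
    have h0 : p.incl.2 = 0 := by
      have h1 : ‖p.incl.2‖ ^ 2 / 2 = 0 := hw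
      simpa using h1
    have h1 : cotangentHamiltonian p.incl.1 = ξ := by
      have := p.cutHamiltonian_incl
      rw [cutHamiltonian, h0] at this
      simpa using this
    refine ⟨Quotient.mk _ ⟨p.incl.1, h1⟩, ?_⟩
    exact congrArg SymplecticCut.mk (CutLevel.incl_injective (Prod.ext rfl h0.symm))

lemma fixedPoints_symplecticCut (hV : HasAdaptedCharts n V) :
    MulAction.fixedPoints Circle (SymplecticCut n V ξ) =
      {w | SymplecticCut.hamiltonian w = 0} := by
  ext w
  obtain ⟨p, rfl⟩ := SymplecticCut.mk_surjective w
  have : Nonempty (CutLevel n V ξ) := ⟨p⟩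
  obtain ⟨χ, hχ, hx⟩ := hV p.incl.1.1
  have hw : SymplecticCut.mk p ∈ (cutChart χ hχ ξ).source :=
    mk_mem_cutChart_source (mem_levelChart_source.2 hx)
  rw [mem_ofPred_eq, hamiltonian_eq_cutChart hw]
  constructor
  · intro hf
    -- The element `-1` already fixes only points with `w = 0`.
    have h1 := cutChart_smul (-1 : Circle) hw
    rw [hf (-1 : Circle)] at h1
    have h2 : (cutChart χ hχ ξ (SymplecticCut.mk p)).2.2 = 0 := by
      have h3 := congrArg (fun a : CutModel n => a.2.2) h1
      simp only [cutModelRotate_apply] at h3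
      have h4 : (((-1 : Circle)) : ℂ) = -1 := by simp
      rw [h4, neg_one_mul] at h3
      exact self_eq_neg.1 h3
    simp [h2]
  · intro h0 u
    have h2 : (cutChart χ hχ ξ (SymplecticCut.mk p)).2.2 = 0 := by simpa using h0
    refine (cutChart χ hχ ξ).injOn (smul_mem_cutChart_source u hw) hw ?_
    rw [cutChart_smul u hw, cutModelRotate_apply, h2, mul_zero, ← h2]

end FixedPoints

section LinearisedAction
variable {n : ℕ} {V : Type*} [TopologicalSpace V]
  [ChartedSpace (EuclideanSpace ℝ (Fin (n + 1))) V]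
  [MulAction Circle V] [ContMDiffSMul (𝓡 1) (𝓡 (n + 1)) ∞ Circle V]
  [IsManifold (𝓡 (n + 1)) ∞ V] {ξ : ℝ} [Nonempty (CutLevel n V ξ)]
  [ChartedSpace (EuclideanSpace ℝ (Fin (2 * n + 3))) (CutLevel n V ξ)]
  [ChartedSpace (EuclideanSpace ℝ (Fin (2 * n + 2))) (SymplecticCut n V ξ)]

/-- At a fixed point, the linearised action is conjugate, by a symplectic linear isomorphism, to the
rotation of the last factor of `ℝⁿ × ℝⁿ × ℂ`. -/
lemma IsSymplecticReduction.exists_linearisation (hV : HasAdaptedCharts n V)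
    {σ : DForm (𝓡 (2 * n + 2)) (SymplecticCut n V ξ) 2} (h : IsSymplecticReduction σ)
    {w : SymplecticCut n V ξ} (hw : w ∈ MulAction.fixedPoints Circle (SymplecticCut n V ξ)) :
    ∃ C : EuclideanSpace ℝ (Fin (2 * n + 2)) ≃L[ℝ] CutModel n,
      (∀ a b, (σ w : EuclideanSpace ℝ (Fin (2 * n + 2)) [⋀^Fin 2]→L[ℝ] ℝ) ![a, b] =
        cutModelForm n ![C a, C b]) ∧
      ∀ (u : Circle) a, C ((linearisedAction (𝓡 (2 * n + 2)) w u :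
        EuclideanSpace ℝ (Fin (2 * n + 2)) →L[ℝ] EuclideanSpace ℝ (Fin (2 * n + 2))) a) =
        cutModelRotate n u (C a) := by
  obtain ⟨p, rfl⟩ := SymplecticCut.mk_surjective w
  obtain ⟨χ, hχ, hx⟩ := hV p.incl.1.1
  have hs : SymplecticCut.mk p ∈ (cutChart χ hχ ξ).source :=
    mk_mem_cutChart_source (mem_levelChart_source.2 hx)
  have hc := (contMDiffAt_cutChart h.isSmoothReduction hs).mdifferentiableAt (by simp)
  have hp := (contMDiffAt_cutParam (hχ := hχ) (ξ := ξ) h.isSmoothReduction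
    ((cutChart χ hχ ξ).map_source hs)).mdifferentiableAt (by simp)
  let C : EuclideanSpace ℝ (Fin (2 * n + 2)) ≃L[ℝ] CutModel n :=
    ContinuousLinearEquiv.equivOfInverse
      (mfderiv (𝓡 (2 * n + 2)) 𝓘(ℝ, CutModel n) (cutChart χ hχ ξ) (SymplecticCut.mk p) :
        EuclideanSpace ℝ (Fin (2 * n + 2)) →L[ℝ] CutModel n)
      (mfderiv 𝓘(ℝ, CutModel n) (𝓡 (2 * n + 2)) (cutParam χ hχ ξ)
        (cutChart χ hχ ξ (SymplecticCut.mk p)) :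
        CutModel n →L[ℝ] EuclideanSpace ℝ (Fin (2 * n + 2)))
      (fun u => mfderiv_apply_of_leftInverse hp hc rfl
        ((cutChart χ hχ ξ).eventually_left_inverse hs) u)
      (fun a => mfderiv_apply_of_leftInverse hc hp ((cutChart χ hχ ξ).left_inv hs)
        ((cutChart χ hχ ξ).eventually_right_inverse ((cutChart χ hχ ξ).map_source hs)) a)
  refine ⟨C, fun a b => h.form_apply hs a b, fun u a => ?_⟩
  refine Eq.trans ?_ (mfderiv_cutChart_smul h.isSmoothReduction u hs a)
  have h5 : ∀ z, z = SymplecticCut.mk p →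
      (mfderiv (𝓡 (2 * n + 2)) 𝓘(ℝ, CutModel n) (cutChart χ hχ ξ) z :
      EuclideanSpace ℝ (Fin (2 * n + 2)) →L[ℝ] CutModel n) =
      mfderiv (𝓡 (2 * n + 2)) 𝓘(ℝ, CutModel n) (cutChart χ hχ ξ) (SymplecticCut.mk p) := by
    rintro _ rfl; rfl
  rw [h5 _ (hw u)]
  rfl

lemma IsSymplecticReduction.exists_isWeights (hV : HasAdaptedCharts n V)
    {σ : DForm (𝓡 (2 * n + 2)) (SymplecticCut n V ξ) 2} (h : IsSymplecticReduction σ)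
    {w : SymplecticCut n V ξ} (hw : w ∈ MulAction.fixedPoints Circle (SymplecticCut n V ξ)) :
    ∃ m : Fin (n + 1) → ℤ, IsWeights (𝓡 (2 * n + 2)) σ w m := by
  obtain ⟨C, hσ, hC⟩ := h.exists_linearisation hV hw
  exact exists_weights C (σ w) hσ (linearisedAction (𝓡 (2 * n + 2)) w) hC

lemma IsSymplecticReduction.sum_weights (hV : HasAdaptedCharts n V)
    {σ : DForm (𝓡 (2 * n + 2)) (SymplecticCut n V ξ) 2} (h : IsSymplecticReduction σ)
    {w : SymplecticCut n V ξ} (hw : w ∈ MulAction.fixedPoints Circle (SymplecticCut n V ξ))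
    {m : Fin (n + 1) → ℤ} (hm : IsWeights (𝓡 (2 * n + 2)) σ w m) : ∑ j, m j = 1 := by
  obtain ⟨C, hσ, hC⟩ := h.exists_linearisation hV hw
  obtain ⟨J, hJ, -, hpos, hAJ, b, hb, hAb⟩ := hm
  exact sum_weights_eq_one C (σ w) hσ (linearisedAction (𝓡 (2 * n + 2)) w) hC hJ hpos hAJ b hb hAb

end LinearisedAction

/-! ### The level is not empty -/

section NonemptyLevel
variable {n : ℕ} {V : Type*} [TopologicalSpace V]
  [ChartedSpace (EuclideanSpace ℝ (Fin (n + 1))) V] [MulAction Circle V]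

lemma IsPrincipalCircleBundle.nonempty_total {B : Type*} [TopologicalSpace B]
    [ChartedSpace (EuclideanSpace ℝ (Fin n)) B] [Nonempty B] {π : V → B}
    (hπ : IsPrincipalCircleBundle n π) : Nonempty V := by
  obtain ⟨b⟩ := ‹Nonempty B›
  obtain ⟨U, -, -, Φ, -⟩ := hπ.locally_trivial b
  exact ⟨Φ.symm (b, 1)⟩

/-- The fundamental vector field has no zeros, so that the level is not empty. -/
lemma IsAdaptedChart.nonempty_cutLevel [IsManifold (𝓡 (n + 1)) ∞ V] (ξ : ℝ)
    {χ : OpenPartialHomeomorph V (EuclideanSpace ℝ (Fin n) × ℝ)} (hχ : IsAdaptedChart χ) {x : V}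
    (hx : x ∈ χ.source) : Nonempty (CutLevel n V ξ) := by
  have h : ((χ x).1, (χ x).2) ∈ χ.target := χ.map_source hx
  exact ⟨⟨(ambientChart χ hχ ξ).symm (0, (χ x).2, (χ x).1, 0, 0),
    (cutHamiltonian_ambientChart_symm hχ ξ h).trans (zero_add ξ)⟩⟩

end NonemptyLevel

/-! ### The symplectic cut of a principal circle bundle -/

theorem mainTheorem5 {n : ℕ}
    {V : Type*} [TopologicalSpace V] [T2Space V] [SecondCountableTopology V]
    [ChartedSpace (EuclideanSpace ℝ (Fin (n + 1))) V] [IsManifold (𝓡 (n + 1)) ∞ V]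
    {B : Type*} [TopologicalSpace B] [T2Space B] [SecondCountableTopology B]
    [ChartedSpace (EuclideanSpace ℝ (Fin n)) B] [IsManifold (𝓡 n) ∞ B] [PathConnectedSpace B]
    [MulAction Circle V] [ContMDiffSMul (𝓡 1) (𝓡 (n + 1)) ∞ Circle V]
    (π : V → B) (hπ : IsPrincipalCircleBundle n π) (ξ : ℝ) :
    (∃ (_ : ChartedSpace (EuclideanSpace ℝ (Fin (2 * n + 3))) (CutLevel n V ξ))
      (_ : ChartedSpace (EuclideanSpace ℝ (Fin (2 * n + 2))) (SymplecticCut n V ξ))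
      (σ : DForm (𝓡 (2 * n + 2)) (SymplecticCut n V ξ) 2), IsSymplecticReduction σ) ∧
    ∀ (_ : ChartedSpace (EuclideanSpace ℝ (Fin (2 * n + 3))) (CutLevel n V ξ))
      (_ : ChartedSpace (EuclideanSpace ℝ (Fin (2 * n + 2))) (SymplecticCut n V ξ))
      (σ : DForm (𝓡 (2 * n + 2)) (SymplecticCut n V ξ) 2), IsSymplecticReduction σ →
      (∀ (u : Circle) (p : CutLevel n V ξ),
        u • SymplecticCut.mk p = SymplecticCut.mk (CutLevel.rotate u p)) ∧
      (∀ p : CutLevel n V ξ, SymplecticCut.hamiltonian (SymplecticCut.mk p) = ‖p.1.2‖ ^ 2 / 2) ∧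
      IsHamiltonianCircleAction (𝓡 (2 * n + 2)) σ
        (SymplecticCut.hamiltonian : SymplecticCut n V ξ → ℝ) ∧
      MulAction.fixedPoints Circle (SymplecticCut n V ξ) =
        Set.range (ReducedSpace.toCut : ReducedSpace n V ξ → SymplecticCut n V ξ) ∧
      ∀ w ∈ MulAction.fixedPoints Circle (SymplecticCut n V ξ),
        (∃ m : Fin (n + 1) → ℤ, IsWeights (𝓡 (2 * n + 2)) σ w m) ∧
        ∀ m : Fin (n + 1) → ℤ, IsWeights (𝓡 (2 * n + 2)) σ w m → ∑ j, m j = 1 := by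
  have hV := hπ.hasAdaptedCharts
  obtain ⟨x⟩ := hπ.nonempty_total
  obtain ⟨χ, hχ, hx⟩ := hV x
  have := hχ.nonempty_cutLevel ξ hx
  refine ⟨exists_isSymplecticReduction hV, fun _ _ σ h => ?_⟩
  exact ⟨fun _ _ => rfl, fun _ => rfl, h.isHamiltonianCircleAction hV,
    (fixedPoints_symplecticCut hV).trans ReducedSpace.range_toCut.symm,
    fun w hw => ⟨h.exists_isWeights hV hw, fun m hm => h.sum_weights hV hw hm⟩⟩
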